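/- **Setting.** Let $(P,\omega)$ be a symplectic manifold. Hamiltonian vector fields are defined by $\omega(X_f,\cdot)=df$ and the Poisson bracket by $\{f,g\}=\omega(X_f,X_g)$, extended complex-bilinearly to complex valued functions. A (local) star product on $(P,\omega)$ is an associative product $f*g=\sum_{k\ge0}\lambda^kM_k(f,g)$ on $C^\infty(P,\mathbb C)[[\lambda]]$ with $\mathbb C$-bilinear $M_k$ (extended coefficientwise to series) such that $M_0(f,g)=fg$, $M_1(f,g)-M_1(g,f)=i\{f,g\}$, $f*1=1*f=f$ and $\operatorname{supp}M_k(f,g)\subseteq\operatorname{supp}f\cap\operatorname{supp}g$. Let $*$ be such a star product. Let $U\subseteq P$ be open and $J\in C^\infty(U,\mathbb R)$, let $i:C\hookrightarrow U$ be an embedded hypersurface with $C=\{x\in U: J(x)=0\}$ and $dJ\neq0$ at every point of $C$. Since the $M_k$ are local, they induce operators on $C^\infty(U)=C^\infty(U,\mathbb C)$, again denoted by $M_k$, and a star product $*$ on $C^\infty(U)[[\lambda]]$. Let $p:C^\infty(C,\mathbb C)\to C^\infty(U)$ be a prolongation, that is a homomorphism of unital $\mathbb C$-algebras with $i^*\circ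 p=\mathrm{id}$, extended coefficientwise to series, and put $\mathrm{prol}=p\circ i^*$. Let $(\hat C,\hat\omega)$ be the reduced phase space: the quotient manifold $\pi:C\to\hat C$ of $C$ by the flow lines of $X_J$ on $C$ ($\pi$ is a surjective submersion whose fibres are exactly these flow lines), with the symplectic form characterized by $\pi^*\hat\omega=i^*\omega$. Suppose that the foliation has a global transversal section, i.e. there is a smooth $s:\hat C\to C$ with $\pi\circ s=\mathrm{id}$, and that there is a smooth flow parameter $t:C\to\mathbb R$, i.e. $c=\Phi_{t(c)}(s(\pi(c)))$ for all $c\in C$, where $\Phi$ is the flow of $X_J$ on $C$. In $C^\infty(U)[[\lambda]]$ put $I=\{f: i^*f=0\}$, $B=\{f:\{f,f'\}\in I\ \forall f'\in I\}$, $F=\{f: f=\mathrm{prol}(f)\}$, $I^*=\{g*J\}$, $B^*=\{f: f*g-g*f\in I^*\ \forall g\in I^*\}$. For $f\in C^\infty(U)$ let $\pi_J(f)$ be the function $h$ with $f-\mathrm{prol}(f)=hJ$, and define $T=\sum_k\lambda^kT_k$ by $T_0=\mathrm{id}$, $T_k(f)=-\sum_{j=1}^kT_{k-j}(M_j(\pi_J(f),J))$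 for $k\ge1$. With $M_j^-(f,g)=M_j(f,g)-M_j(g,f)$ define $S=\sum_k\lambda^kS_k$ by $S_0=\mathrm{id}$ and, for $k\ge1$, $S_kf=p(u_k)$, where $$u_k(c)=-i\int_0^{t(c)}(F_{k+1}f)\bigl(\Phi_\tau(s(\pi(c)))\bigr)\,d\tau,\qquad F_kf=\sum_{j=2}^kM_j^-(J,S_{k-j}f)+\sum_{l=1}^{k-1}\sum_{j=1}^{k-l}T_l\bigl(M_j^-(J,S_{k-j-l}f)\bigr).$$ **Statement.** All these operators are well defined: the $M_k$ restrict to $U$, $h=\pi_J(f)$ exists in $C^\infty(U)$ and is unique, and the functions $u_k$ are smooth. The map $S:B\cap F\to B^*\cap F$ is a bijection, and $\mathrm{prol}(T(Sf*Sg))\in B^*\cap F$ for all $f,g\in B\cap F$, so that $$f\star g:=S^{-1}\bigl(\mathrm{prol}(T(Sf*Sg))\bigr)$$ is well defined on $B\cap F$. The map $u\mapsto p(\pi^*u)$ is a bijection from $C^\infty(\hat C,\mathbb C)[[\lambda]]$ onto $B\cap F$, and under this identification $\star$ is a (local) star product $\sum_k\lambda^k\tilde M_k$ on $(\hat C,\hat\omega)$,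 called reduced from $*$ by $J$. If all $M_k$ are bidifferential operators of finite order, then so are all $\tilde M_k$. -/

import Mathlib

open scoped Manifold ContDiff Topology PowerSeries
open TopologicalSpace

noncomputable section

namespace StarReduction

/-- The model space of real `n`-dimensional manifolds. -/
abbrev E (n : ℕ) : Type := EuclideanSpace ℝ (Fin n)

section Manifolds

variable {n : ℕ} {M : Type*} [TopologicalSpace M] [ChartedSpace (E n) M]
  {m : ℕ} {N : Type*} [TopologicalSpace N] [ChartedSpace (E m) N]

/-- The `ℂ`-algebra of complex valued smooth functions on the `n`-dimensional manifold `M`, with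
the pointwise operations. The algebra of formal power series in the formal parameter with
coefficients in it is `(Sm n M)⟦X⟧`. -/
def Sm (n : ℕ) (M : Type*) [TopologicalSpace M] [ChartedSpace (E n) M] :
    Subalgebra ℂ (M → ℂ) where
  carrier := {f | ContMDiff (𝓡 n) 𝓘(ℝ, ℂ) ∞ f}
  mul_mem' hf hg := (contDiff_mul (𝕜 := ℝ)).contMDiff.comp (ContMDiff.prodMk_space hf hg)
  add_mem' hf hg := (contDiff_add (𝕜 := ℝ)).contMDiff.comp (ContMDiff.prodMk_space hf hg)
  algebraMap_mem' _ := contMDiff_const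

/-- Pull-back of smooth functions along a smooth map. -/
def Sm.pullback (φ : M → N) (hφ : ContMDiff (𝓡 n) (𝓡 m) ∞ φ) : Sm m N →ₐ[ℂ] Sm n M where
  toFun f := ⟨fun x => f.1 (φ x), f.2.comp hφ⟩
  map_one' := rfl
  map_mul' _ _ := rfl
  map_zero' := rfl
  map_add' _ _ := rfl
  commutes' _ := rfl

open Classical in
/-- A function on `M` as an element of `Sm n M`. The value `0` is used for functions
that are not smooth. -/
def Sm.ofFun (u : M → ℂ) : Sm n M :=
  if h : ContMDiff (𝓡 n) 𝓘(ℝ, ℂ) ∞ u then ⟨u, h⟩ else 0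

/-- Fields of real bilinear forms on the tangent spaces of `M`. -/
def TwoForm (n : ℕ) (M : Type*) [TopologicalSpace M] [ChartedSpace (E n) M] : Type _ :=
  ∀ x : M, TangentSpace (𝓡 n) x →ₗ[ℝ] TangentSpace (𝓡 n) x →ₗ[ℝ] ℝ

/-- The pull-back `φ^* Ω`. -/
def TwoForm.pullback (Ω : TwoForm m N) (φ : M → N) : TwoForm n M := fun x =>
  (Ω (φ x)).compl₁₂ (mfderiv (𝓡 n) (𝓡 m) φ x).toLinearMap (mfderiv (𝓡 n) (𝓡 m) φ x).toLinearMap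

/-- The component of `Ω` along the constant vectors `v`, `w` in the preferred chart at `x₀`,
as a function on the target of this chart. -/
def TwoForm.coord (Ω : TwoForm n M) (x₀ : M) (v w : E n) (y : E n) : ℝ :=
  Ω ((chartAt (E n) x₀).symm y)
    (mfderiv (𝓡 n) (𝓡 n) (chartAt (E n) x₀).symm y v)
    (mfderiv (𝓡 n) (𝓡 n) (chartAt (E n) x₀).symm y w)

/-- Symplectic forms: smooth, closed, nondegenerate alternating two-forms. Smoothness and
closedness (`dΩ = 0`) are expressed in charts. -/
structure TwoForm.IsSymplectic (Ω : TwoForm n M) : Prop where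
  alternating : ∀ x v, Ω x v v = 0
  nondegenerate : ∀ x v, (∀ w, Ω x v w = 0) → v = 0
  smooth : ∀ (x₀ : M) (v w : E n), ContDiffOn ℝ ∞ (Ω.coord x₀ v w) (chartAt (E n) x₀).target
  closed : ∀ (x₀ : M), ∀ y ∈ (chartAt (E n) x₀).target, ∀ u v w : E n,
    fderiv ℝ (Ω.coord x₀ v w) y u + fderiv ℝ (Ω.coord x₀ w u) y v
      + fderiv ℝ (Ω.coord x₀ u v) y w = 0

/-- The Hamiltonian vector field `X_f` of a real function, `Ω(X_f, ·) = df`. -/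
def hamVec (Ω : TwoForm n M) (f : M → ℝ) (x : M) : TangentSpace (𝓡 n) x :=
  Classical.epsilon fun v => ∀ w, Ω x v w = mfderiv (𝓡 n) 𝓘(ℝ, ℝ) f x w

/-- The Poisson bracket `{f, g} = Ω(X_f, X_g)` of real functions. -/
def poissonReal (Ω : TwoForm n M) (f g : M → ℝ) (x : M) : ℝ :=
  Ω x (hamVec Ω f x) (hamVec Ω g x)

/-- The complex bilinear extension of the Poisson bracket to complex valued functions. -/
def poisson (Ω : TwoForm n M) (f g : M → ℂ) (x : M) : ℂ :=
  ((poissonReal Ω (fun y => (f y).re) (fun y => (g y).re) x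
      - poissonReal Ω (fun y => (f y).im) (fun y => (g y).im) x : ℝ) : ℂ)
    + Complex.I *
      ((poissonReal Ω (fun y => (f y).re) (fun y => (g y).im) x
        + poissonReal Ω (fun y => (f y).im) (fun y => (g y).re) x : ℝ) : ℂ)

/-- The coefficient of order `k` of the Poisson bracket of two formal series, at a point. -/
def poissonSeries (Ω : TwoForm n M) (f g : (Sm n M)⟦X⟧) (k : ℕ) (x : M) : ℂ :=
  ∑ i ∈ Finset.HasAntidiagonal.antidiagonal k, poisson Ω (PowerSeries.coeff i.1 f).1 (PowerSeries.coeff i.2 g).1 x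

/-- The product `f ∗ g = ∑ λ^k B_k(f, g)` of formal series determined by a sequence of
operations `B_k`. -/
def star {A : Type*} [Semiring A] (B : ℕ → A → A → A) (f g : A⟦X⟧) : A⟦X⟧ :=
  PowerSeries.mk fun k => ∑ i ∈ Finset.HasAntidiagonal.antidiagonal k, ∑ j ∈ Finset.HasAntidiagonal.antidiagonal i.2,
    B i.1 (PowerSeries.coeff j.1 f) (PowerSeries.coeff j.2 g)

/-- The action `D f = ∑ λ^k ∑_{i + j = k} D_i f_j` of a formal series of operators. -/
def act {A : Type*} [Semiring A] (D : ℕ → A → A) (f : A⟦X⟧) : A⟦X⟧ :=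
  PowerSeries.mk fun k => ∑ i ∈ Finset.HasAntidiagonal.antidiagonal k, D i.1 (PowerSeries.coeff i.2 f)

/-- Local star products on the symplectic manifold `(M, Ω)`. -/
structure IsStarProduct (Ω : TwoForm n M) (B : ℕ → Sm n M → Sm n M → Sm n M) : Prop where
  add_left : ∀ k f f' g, B k (f + f') g = B k f g + B k f' g
  smul_left : ∀ k (a : ℂ) f g, B k (a • f) g = a • B k f g
  add_right : ∀ k f g g', B k f (g + g') = B k f g + B k f g'
  smul_right : ∀ k (a : ℂ) f g, B k f (a • g) = a • B k f g
  assoc : ∀ f g h : (Sm n M)⟦X⟧, star B (star B f g) h = star B f (star B g h)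
  zeroth : ∀ f g, B 0 f g = f * g
  first : ∀ f g x, (B 1 f g).1 x - (B 1 g f).1 x = Complex.I * poisson Ω f.1 g.1 x
  one_star : ∀ f : (Sm n M)⟦X⟧, star B 1 f = f
  star_one : ∀ f : (Sm n M)⟦X⟧, star B f 1 = f
  supp : ∀ k f g, tsupport (B k f g).1 ⊆ tsupport f.1 ∩ tsupport g.1

/-- The iterated partial derivative `∂_{α 0} ⋯ ∂_{α (a - 1)} f` at `x`, computed in the preferred
chart at `x₀`. -/
def partialDeriv (x₀ : M) {a : ℕ} (α : Fin a → Fin n) (f : M → ℂ) (x : M) : ℂ :=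
  iteratedFDeriv ℝ a (fun y => f ((chartAt (E n) x₀).symm y)) (chartAt (E n) x₀ x)
    fun i => EuclideanSpace.single (α i) (1 : ℝ)

/-- Bidifferential operators of finite order: for some `r`, one has
`B(f, g) = ∑ c_{α β} ∂_α f ∂_β g` (`α`, `β` of length at most `r`) in local coordinates,
with smooth coefficients. -/
def IsBidifferential (B : Sm n M → Sm n M → Sm n M) : Prop :=
  ∃ r : ℕ, ∀ x₀ : M, ∃ V : Set M, IsOpen V ∧ x₀ ∈ V ∧ V ⊆ (chartAt (E n) x₀).source ∧
    ∃ c : ∀ a b : ℕ, (Fin a → Fin n) → (Fin b → Fin n) → M → ℂ,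
      (∀ a b α β, ContMDiffOn (𝓡 n) 𝓘(ℝ, ℂ) ∞ (c a b α β) V) ∧
      ∀ f g : Sm n M, ∀ x ∈ V, (B f g).1 x =
        ∑ a ∈ Finset.range (r + 1), ∑ b ∈ Finset.range (r + 1),
          ∑ α : Fin a → Fin n, ∑ β : Fin b → Fin n,
            c a b α β x * partialDeriv x₀ α f.1 x * partialDeriv x₀ β g.1 x

/-- `h` is the value at `(f, g)` of the operator on the open subset `U` induced by `B`: near each
point of `U` it is computed from smooth functions on `M` that have the same germs as `f`, `g`. -/
def IsRestriction (B : Sm n M → Sm n M → Sm n M) (U : Opens M) (f g h : Sm n U) : Prop :=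
  ∀ (x : U) (F G : Sm n M), (∀ᶠ y : U in 𝓝 x, F.1 y = f.1 y) → (∀ᶠ y : U in 𝓝 x, G.1 y = g.1 y) →
    h.1 x = (B F G).1 x

/-- The operator induced on the open subset `U` by a local bilinear operator `B` on `M`. -/
def restrictOp (B : Sm n M → Sm n M → Sm n M) (U : Opens M) (f g : Sm n U) : Sm n U :=
  Classical.epsilon (IsRestriction B U f g)

end Manifolds

section Reduction

variable {n : ℕ}
  {P : Type*} [TopologicalSpace P] [ChartedSpace (E (n + 2)) P]
  {C : Type*} [TopologicalSpace C] [ChartedSpace (E (n + 1)) C]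
  {Q : Type*} [TopologicalSpace Q] [ChartedSpace (E n) Q]

/-- A constraint hypersurface `ι : C ↪ U`, where `U` is an open neighbourhood of it in `P`, cut
out in `U` by the constraint function `J`, whose differential vanishes nowhere on `C`. -/
structure Constraint (n : ℕ) {P : Type*} [TopologicalSpace P] [ChartedSpace (E (n + 2)) P]
    (U : Opens P) (C : Type*) [TopologicalSpace C] [ChartedSpace (E (n + 1)) C] where
  J : U → ℝ
  J_smooth : ContMDiff (𝓡 (n + 2)) 𝓘(ℝ, ℝ) ∞ J
  ι : C → U
  ι_smooth : ContMDiff (𝓡 (n + 1)) (𝓡 (n + 2)) ∞ ι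
  ι_embedding : Manifold.IsSmoothEmbedding (𝓡 (n + 1)) (𝓡 (n + 2)) ∞ ι
  range_ι : Set.range ι = {x | J x = 0}
  dJ_ne_zero : ∀ c, mfderiv (𝓡 (n + 2)) 𝓘(ℝ, ℝ) J (ι c) ≠ 0

variable {U : Opens P}

/-- The symplectic form of `P` restricted to the open subset `U`. -/
def formOn (Ω : TwoForm (n + 2) P) (U : Opens P) : TwoForm (n + 2) U :=
  Ω.pullback (Subtype.val : U → P)

namespace Constraint

variable (K : Constraint n U C)

/-- The constraint function as an element of the algebra of complex valued functions. -/
def JC : Sm (n + 2) U :=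
  ⟨fun x => (K.J x : ℂ), Complex.ofRealCLM.contDiff.contMDiff.comp K.J_smooth⟩

/-- Restriction of functions to the constraint surface. -/
def res : Sm (n + 2) U →ₐ[ℂ] Sm (n + 1) C := Sm.pullback K.ι K.ι_smooth

/-- `y` is reached from `x` after time `t` by the flow of the Hamiltonian vector field `X_J`
on the constraint surface. -/
def FlowsTo (Ω : TwoForm (n + 2) P) (x : C) (t : ℝ) (y : C) : Prop :=
  ∃ γ : ℝ → C, γ 0 = x ∧ γ t = y ∧
    IsMIntegralCurveOn (I := 𝓡 (n + 2)) (fun τ => K.ι (γ τ)) (hamVec (formOn Ω U) K.J)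
      (Set.uIcc 0 t)

open Classical in
/-- The Hamiltonian flow `Φ_t` of `J` on the constraint surface (with value `x` where it is
not defined). -/
def flow (Ω : TwoForm (n + 2) P) (t : ℝ) (x : C) : C :=
  if h : ∃ y, K.FlowsTo Ω x t y then h.choose else x

end Constraint

/-- A prolongation prescription: a homomorphism of algebras that extends functions
on the constraint surface to functions on the neighbourhood `U`. -/
structure Prolongation (K : Constraint n U C) where
  p : Sm (n + 1) C →ₐ[ℂ] Sm (n + 2) U
  res_p : ∀ u, K.res (p u) = u

/-- The reduced phase space: the quotient manifold of `C` by the leaves of the foliation generated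
by `X_J`, with the symplectic form characterized by `π^* Ω_red = ι^* Ω`. -/
structure ReducedPhaseSpace (Ω : TwoForm (n + 2) P) (K : Constraint n U C) (Q : Type*)
    [TopologicalSpace Q] [ChartedSpace (E n) Q] where
  π : C → Q
  π_smooth : ContMDiff (𝓡 (n + 1)) (𝓡 n) ∞ π
  π_submersion : Manifold.IsSubmersion (𝓡 (n + 1)) (𝓡 n) ∞ π
  π_surjective : Function.Surjective π
  fibers : ∀ x y, π x = π y ↔ ∃ t, K.FlowsTo Ω x t y
  form : TwoForm n Q
  form_symplectic : form.IsSymplectic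
  pullback_form : (form.pullback π : TwoForm (n + 1) C) = (formOn Ω U).pullback K.ι

/-- A transversal section of the foliation, given by the section `s` of `π` whose image it is, so
that `s ∘ π` is the projection onto it along the leaves. The function `t` is the flow parameter,
`c = Φ_{t(c)} (s (π c))`. -/
structure TransversalSection {Ω : TwoForm (n + 2) P} {K : Constraint n U C}
    (R : ReducedPhaseSpace Ω K Q) where
  s : Q → C
  s_smooth : ContMDiff (𝓡 n) (𝓡 (n + 1)) ∞ s
  π_s : ∀ q, R.π (s q) = q
  t : C → ℝ
  t_smooth : ContMDiff (𝓡 (n + 1)) 𝓘(ℝ, ℝ) ∞ t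
  flowsTo : ∀ c, K.FlowsTo Ω (s (R.π c)) (t c) c

/-- The classical vanishing ideal `I`. -/
def idealI (K : Constraint n U C) : Set (Sm (n + 2) U)⟦X⟧ :=
  {f | PowerSeries.map K.res.toRingHom f = 0}

/-- `B = {f | {f, f'} ∈ I for all f' ∈ I}`. -/
def algB (Ω : TwoForm (n + 2) P) (K : Constraint n U C) : Set (Sm (n + 2) U)⟦X⟧ :=
  {f | ∀ f' ∈ idealI K, ∀ k c, poissonSeries (formOn Ω U) f f' k (K.ι c) = 0}

section Star

/- In this section `M` is the sequence of operators of a star product on `U`. -/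

variable (M : ℕ → Sm (n + 2) U → Sm (n + 2) U → Sm (n + 2) U)

/-- The left ideal `I^* = {g ∗ J}`. -/
def idealIStar (K : Constraint n U C) : Set (Sm (n + 2) U)⟦X⟧ :=
  {f | ∃ g, f = star M g (PowerSeries.C K.JC)}

/-- `B^* = {f | f ∗ g - g ∗ f ∈ I^* for all g ∈ I^*}`. -/
def algBStar (K : Constraint n U C) : Set (Sm (n + 2) U)⟦X⟧ :=
  {f | ∀ g ∈ idealIStar M K, star M f g - star M g f ∈ idealIStar M K}

/-- The antisymmetric part `M_k^-(f, g) = M_k(f, g) - M_k(g, f)`. -/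
def anti (k : ℕ) (f g : Sm (n + 2) U) : Sm (n + 2) U := M k f g - M k g f

namespace Prolongation

variable {K : Constraint n U C} (p : Prolongation K)

/-- `prol f = p (ι^* f)` for functions. -/
def prolFun (f : Sm (n + 2) U) : Sm (n + 2) U := p.p (K.res f)

/-- `prol` for formal series. -/
def prol (f : (Sm (n + 2) U)⟦X⟧) : (Sm (n + 2) U)⟦X⟧ :=
  PowerSeries.map p.p.toRingHom (PowerSeries.map K.res.toRingHom f)

/-- The pure prolongations `F`. -/
def pureF : Set (Sm (n + 2) U)⟦X⟧ := {f | f = p.prol f}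

/-- The component along the constraint function: the `h` with `f - prol f = h J`. -/
def compJ (f : Sm (n + 2) U) : Sm (n + 2) U :=
  Classical.epsilon fun h => f - p.prolFun f = h * K.JC

/-- `T_0 = id` and `T_k(f) = - ∑_{j=1}^{k} T_{k-j}(M_j(f_J, J))`, with `f_J` the component
of `f` along `J`. -/
def T : ℕ → Sm (n + 2) U → Sm (n + 2) U
  | 0, f => f
  | k + 1, f => -∑ j : Fin (k + 1), T (k - j) (M (j + 1) (p.compJ f) K.JC)

/-- `F_k[S; T](f) = ∑_{j=2}^{k} M_j^-(J, S_{k-j} f)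
  + ∑_{i=1}^{k-1} ∑_{j=1}^{k-i} T_i(M_j^-(J, S_{k-j-i} f))`. -/
def Fop (S : ℕ → Sm (n + 2) U → Sm (n + 2) U) (k : ℕ) (f : Sm (n + 2) U) : Sm (n + 2) U :=
  ∑ j ∈ Finset.Icc 2 k, anti M j K.JC (S (k - j) f)
    + ∑ i ∈ Finset.Icc 1 (k - 1), ∑ j ∈ Finset.Icc 1 (k - i),
        p.T M i (anti M j K.JC (S (k - j - i) f))

variable {Ω : TwoForm (n + 2) P} {R : ReducedPhaseSpace Ω K Q} (σ : TransversalSection R)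

/-- The function `c ↦ -i ∫_0^{t(c)} (F_{k+1}[S; T] f)(Φ_τ(s(π(c)))) dτ` on the constraint
surface. -/
def leafIntegral (S : ℕ → Sm (n + 2) U → Sm (n + 2) U) (k : ℕ) (f : Sm (n + 2) U) (c : C) : ℂ :=
  -Complex.I * ∫ τ in (0 : ℝ)..σ.t c,
    (p.Fop M S (k + 1) f).1 (K.ι (K.flow Ω τ (σ.s (R.π c))))

/-- The operators `S_0, …, S_k` (the members of index larger than `k` are not meaningful). -/
def SUpTo : ℕ → ℕ → Sm (n + 2) U → Sm (n + 2) U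
  | 0 => fun _ f => f
  | k + 1 => Function.update (SUpTo k) (k + 1) fun f =>
      p.p (Sm.ofFun (p.leafIntegral M σ (SUpTo k) (k + 1) f))

/-- The operators `S_k`: `S_0 = id`, and for `k ≥ 1`, `S_k f` is the prolongation of the leaf
integral of `F_{k+1}[S_0, …, S_{k-1}; T_0, …, T_k](f)`. -/
def S (k : ℕ) : Sm (n + 2) U → Sm (n + 2) U := p.SUpTo M σ k k

/-- `B ∩ F`. -/
def BF (Ω : TwoForm (n + 2) P) : Set (Sm (n + 2) U)⟦X⟧ := algB Ω K ∩ p.pureF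

/-- `B^* ∩ F`. -/
def BStarF : Set (Sm (n + 2) U)⟦X⟧ := algBStar M K ∩ p.pureF

/-- `prol (T (S f ∗ S g))`. -/
def preStar (f g : (Sm (n + 2) U)⟦X⟧) : (Sm (n + 2) U)⟦X⟧ :=
  p.prol (act (p.T M) (star M (act (p.S M σ) f) (act (p.S M σ) g)))

/-- The reduced product `f ⋆ g = S⁻¹(prol (T (S f ∗ S g)))`, with the inverse of `S` on
`B ∩ F`. -/
def reducedStar (f g : (Sm (n + 2) U)⟦X⟧) : (Sm (n + 2) U)⟦X⟧ :=
  Function.invFunOn (act (p.S M σ)) (p.BF Ω) (p.preStar M σ f g)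

/-- The identification of series on the reduced phase space with elements of `B ∩ F`:
pull back to `C`, then prolong. -/
def lift (R : ReducedPhaseSpace Ω K Q) (u : (Sm n Q)⟦X⟧) : (Sm (n + 2) U)⟦X⟧ :=
  PowerSeries.map p.p.toRingHom
    (PowerSeries.map (Sm.pullback R.π R.π_smooth).toRingHom u)

end Prolongation

end Star

end Reduction

end StarReduction

end

/-! Write `f_J` for the component of `f` along `J` and let `D` be the series of operators with `D_0
= id` and `D_k f = M_k(f_J, J)` for `k ≥ 1`. Since `f = prol f + f_J J`, one has `D f = prol f + f_J
* J`, and the recursion for `T` says precisely that `T` is the inverse of `D`. Hence `f` equals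
`prol (T f)` modulo the left ideal `I^*`, and `f` lies in `I^*` if and only if `i^* T f = 0`
(`FormalConstraint.decomp`, `FormalConstraint.mem_ideal_iff`). As `B^*` is the idealizer of `I^*`,
the quotient `B^* / I^*` is an associative algebra; `B^* ∩ F` is a set of representatives, with
product `prol (T (f * g))`.

Because `I^*` is generated by `J`, an `f` belongs to `B^*` if and only if `i^* T (J * f - f * J) =
0`. In order `k + 1` this reads `-i X_J(i^* f_k) + i^* F_{k+1} = 0`, where `F_{k+1}` involves only
coefficients of index below `k`: an ordinary differential equation along the leaves for the
restriction of `f_k`. It has exactly one solution with given values on the transversal section. The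
operators `S_k` are the solutions whose corrections vanish there, so elements of `B ∩ F` and of `B^*
∩ F` are both parametrized by their values on the section, and `S` matches them
(`FormalReduction.S_C_mem`, `FormalReduction.eq_zero_of_ρ`, `FormalReduction.bijOn_S`). Transporting
the product gives associativity and the unit. The antisymmetric part of first order is that of
`M_1`, and `π` respects Poisson brackets (`Constraint.poisson_lift`).

All of this is algebra once three analytic facts are known. Functions vanishing on `C` are divisible
by `J`, by Hadamard's lemma applied along segments transversal to `C` (`exists_quotient`). The
vector field `X_J` is tangent to `C`, spans the kernel of the differential of `π`, and the flow
parameter has derivative one along it (`TransversalSection.d_tC`). Therefore `(π, t)` is a local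
diffeomorphism, its local inverses describe the flow from the section, and leaf integrals are smooth
(`TransversalSection.contMDiff_leafInt`).

Leaf integration is not a local operator on `C`, but it is linear over functions pulled back from
the leaf space. Locality and differential order are therefore measured over that algebra, by
annihilators and iterated commutators, where they are stable under sums and compositions
(`FormalReduction.localFamily_redM`). On the leaf space itself, Taylor's formula turns a bounded
commutator order back into an expression in partial derivatives (`isBidifferential_of_order`). -/

noncomputable section

namespace StarReduction

/-! ### Formal series of linear and bilinear operators -/

section FormalSeries

variable {A B D A' : Type*} [CommRing A] [Algebra ℂ A] [CommRing B] [Algebra ℂ B]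
  [CommRing D] [Algebra ℂ D] [CommRing A'] [Algebra ℂ A']

open PowerSeries Finset

theorem sum_antidiagonal_assoc {N : Type*} [AddCommMonoid N] (F : ℕ → ℕ → ℕ → N) (k : ℕ) :
    ∑ i ∈ antidiagonal k, ∑ j ∈ antidiagonal i.1, F j.1 j.2 i.2
      = ∑ i ∈ antidiagonal k, ∑ j ∈ antidiagonal i.2, F i.1 j.1 j.2 := by
  rw [sum_sigma', sum_sigma']
  refine sum_nbij' (fun x => ⟨(x.2.1, x.2.2 + x.1.2), (x.2.2, x.1.2)⟩)
    (fun x => ⟨(x.1.1 + x.2.1, x.2.2), (x.1.1, x.2.1)⟩) ?_ ?_ ?_ ?_ ?_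
  · rintro ⟨⟨i, j⟩, ⟨k, l⟩⟩; simp only [mem_sigma, HasAntidiagonal.mem_antidiagonal]
    rintro ⟨rfl, rfl⟩; simp [add_assoc]
  · rintro ⟨⟨i, j⟩, ⟨k, l⟩⟩; simp only [mem_sigma, HasAntidiagonal.mem_antidiagonal]
    rintro ⟨rfl, rfl⟩; simp [add_assoc]
  · rintro ⟨⟨i, j⟩, ⟨k, l⟩⟩ h
    simp only [mem_sigma, HasAntidiagonal.mem_antidiagonal] at h
    obtain ⟨h1, rfl⟩ := h
    rfl
  · rintro ⟨⟨i, j⟩, ⟨k, l⟩⟩ h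
    simp only [mem_sigma, HasAntidiagonal.mem_antidiagonal] at h
    obtain ⟨h1, rfl⟩ := h
    rfl
  · rintro ⟨⟨i, j⟩, ⟨k, l⟩⟩ h; rfl

/-- The `ℂ`-linear map on formal series given by a formal series of linear operators. -/
def ser (L : ℕ → A →ₗ[ℂ] B) : A⟦X⟧ →ₗ[ℂ] B⟦X⟧ where
  toFun f := PowerSeries.mk fun k => ∑ i ∈ antidiagonal k, L i.1 (coeff i.2 f)
  map_add' f g := by ext k; simp [sum_add_distrib]
  map_smul' a f := by ext k; simp [smul_sum]

/-- The bilinear map on formal series given by a formal series of bilinear operators. -/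
def bser (M : ℕ → A →ₗ[ℂ] A' →ₗ[ℂ] B) : A⟦X⟧ →ₗ[ℂ] A'⟦X⟧ →ₗ[ℂ] B⟦X⟧ :=
  LinearMap.mk₂ ℂ (fun f g => PowerSeries.mk fun k => ∑ i ∈ antidiagonal k,
      ∑ j ∈ antidiagonal i.2, M i.1 (coeff j.1 f) (coeff j.2 g))
    (fun f f' g => by ext k; simp [sum_add_distrib])
    (fun a f g => by ext k; simp [smul_sum])
    (fun f g g' => by ext k; simp [sum_add_distrib])
    (fun a f g => by ext k; simp [smul_sum])

theorem coeff_ser (L : ℕ → A →ₗ[ℂ] B) (f : A⟦X⟧) (k : ℕ) :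
    coeff k (ser L f) = ∑ i ∈ antidiagonal k, L i.1 (coeff i.2 f) := by simp [ser]

theorem coeff_bser (M : ℕ → A →ₗ[ℂ] A' →ₗ[ℂ] B) (f : A⟦X⟧) (g : A'⟦X⟧) (k : ℕ) :
    coeff k (bser M f g) = ∑ i ∈ antidiagonal k,
      ∑ j ∈ antidiagonal i.2, M i.1 (coeff j.1 f) (coeff j.2 g) := by simp [bser]

theorem coeff_ser_C (L : ℕ → A →ₗ[ℂ] B) (a : A) (k : ℕ) :
    coeff k (ser L (PowerSeries.C a)) = L k a := by
  rw [coeff_ser, sum_eq_single (k, 0)]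
  · simp
  · rintro ⟨i, j⟩ h hne
    have : j ≠ 0 := by
      rintro rfl
      simp_all
    simp [PowerSeries.coeff_C, this]
  · simp

theorem coeff_bser_C (M : ℕ → A →ₗ[ℂ] A' →ₗ[ℂ] B) (f : A⟦X⟧) (a : A') (k : ℕ) :
    coeff k (bser M f (PowerSeries.C a)) = ∑ i ∈ antidiagonal k, M i.1 (coeff i.2 f) a := by
  rw [coeff_bser]
  refine sum_congr rfl fun i _ => ?_
  rw [sum_eq_single (i.2, 0)]
  · simp
  · rintro ⟨i, j⟩ h hne
    have : j ≠ 0 := by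
      rintro rfl
      simp_all
    simp [PowerSeries.coeff_C, this]
  · simp

theorem coeff_C_bser (M : ℕ → A →ₗ[ℂ] A' →ₗ[ℂ] B) (a : A) (g : A'⟦X⟧) (k : ℕ) :
    coeff k (bser M (PowerSeries.C a) g) = ∑ i ∈ antidiagonal k, M i.1 a (coeff i.2 g) := by
  rw [coeff_bser]
  refine sum_congr rfl fun i _ => ?_
  rw [sum_eq_single (0, i.2)]
  · simp
  · rintro ⟨i, j⟩ h hne
    have : i ≠ 0 := by
      rintro rfl
      simp_all
    simp [PowerSeries.coeff_C, this]
  · simp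

/-- The composition of formal series of operators. -/
def serComp (L : ℕ → B →ₗ[ℂ] D) (L' : ℕ → A →ₗ[ℂ] B) (k : ℕ) : A →ₗ[ℂ] D :=
  ∑ i ∈ antidiagonal k, L i.1 ∘ₗ L' i.2

theorem ser_ser (L : ℕ → B →ₗ[ℂ] D) (L' : ℕ → A →ₗ[ℂ] B) (f : A⟦X⟧) :
    ser L (ser L' f) = ser (serComp L L') f := by
  ext k
  simp only [coeff_ser, map_sum, serComp, LinearMap.sum_apply, LinearMap.comp_apply]
  exact (sum_antidiagonal_assoc (fun a b c => L a (L' b (coeff c f))) k).symm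

/-- The composition of a formal series of operators with a formal series of bilinear operators. -/
def serCompB (L : ℕ → B →ₗ[ℂ] D) (M : ℕ → A →ₗ[ℂ] A' →ₗ[ℂ] B) (k : ℕ) :
    A →ₗ[ℂ] A' →ₗ[ℂ] D :=
  ∑ i ∈ antidiagonal k, (M i.2).compr₂ (L i.1)

theorem ser_bser (L : ℕ → B →ₗ[ℂ] D) (M : ℕ → A →ₗ[ℂ] A' →ₗ[ℂ] B) (f : A⟦X⟧) (g : A'⟦X⟧) :
    ser L (bser M f g) = bser (serCompB L M) f g := by
  ext k
  simp only [coeff_ser, coeff_bser, map_sum, serCompB, LinearMap.sum_apply,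
    LinearMap.compr₂_apply]
  rw [← sum_antidiagonal_assoc
    (fun a b c => ∑ j ∈ antidiagonal c, L a (M b (coeff j.1 f) (coeff j.2 g))) k]
  exact sum_congr rfl fun i _ => sum_comm

/-- The composition of a formal series of bilinear operators with a formal series of operators in
the left argument. -/
def serCompL (M : ℕ → B →ₗ[ℂ] A' →ₗ[ℂ] D) (L : ℕ → A →ₗ[ℂ] B) (k : ℕ) : A →ₗ[ℂ] A' →ₗ[ℂ] D :=
  ∑ i ∈ antidiagonal k, (M i.1) ∘ₗ (L i.2)

theorem bser_ser_left (M : ℕ → B →ₗ[ℂ] A' →ₗ[ℂ] D) (L : ℕ → A →ₗ[ℂ] B) (f : A⟦X⟧)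
    (g : A'⟦X⟧) : bser M (ser L f) g = bser (serCompL M L) f g := by
  ext k
  simp only [coeff_ser, coeff_bser, map_sum, serCompL, LinearMap.sum_apply,
    LinearMap.comp_apply]
  -- Both sides sum over the same quadruples: the indices of the two operators and the degrees in
  -- `f` and `g`.
  rw [← sum_antidiagonal_assoc (fun a b c => ∑ x ∈ antidiagonal b,
    M a (L x.1 (coeff x.2 f)) (coeff c g)) k]
  have : ∀ i ∈ antidiagonal k, ∑ x ∈ antidiagonal i.2, ∑ j ∈ antidiagonal i.1,
      M j.1 (L j.2 (coeff x.1 f)) (coeff x.2 g) = ∑ j ∈ antidiagonal i.1,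
      ∑ x ∈ antidiagonal i.2, M j.1 (L j.2 (coeff x.1 f)) (coeff x.2 g) :=
    fun i _ => sum_comm
  have h2 := sum_antidiagonal_assoc (fun a b c => ∑ x ∈ antidiagonal c,
    M a (L b (coeff x.1 f)) (coeff x.2 g)) k
  rw [sum_congr rfl this, h2]
  rw [sum_antidiagonal_assoc (fun a b c => ∑ x ∈ antidiagonal b,
    M a (L x.1 (coeff x.2 f)) (coeff c g)) k]
  refine sum_congr rfl fun i _ => ?_
  exact sum_antidiagonal_assoc (fun a b c => M i.1 (L a (coeff b f)) (coeff c g)) i.2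

theorem bser_swap (M : ℕ → A →ₗ[ℂ] A' →ₗ[ℂ] B) (f : A⟦X⟧) (g : A'⟦X⟧) :
    bser (fun k => (M k).flip) g f = bser M f g := by
  ext k
  simp only [coeff_bser, LinearMap.flip_apply]
  refine sum_congr rfl fun i _ => ?_
  exact sum_nbij' Prod.swap Prod.swap (by simp [add_comm]) (by simp [add_comm]) (by simp)
    (by simp) (by simp)

/-- The composition of a formal series of bilinear operators with a formal series of operators in
the right argument. -/
def serCompR (M : ℕ → A →ₗ[ℂ] B →ₗ[ℂ] D) (L : ℕ → A' →ₗ[ℂ] B) (k : ℕ) : A →ₗ[ℂ] A' →ₗ[ℂ] D :=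
  ∑ i ∈ antidiagonal k, (M i.1).compl₂ (L i.2)

theorem bser_ser_right (M : ℕ → A →ₗ[ℂ] B →ₗ[ℂ] D) (L : ℕ → A' →ₗ[ℂ] B) (f : A⟦X⟧)
    (g : A'⟦X⟧) : bser M f (ser L g) = bser (serCompR M L) f g := by
  rw [← bser_swap M, bser_ser_left, ← bser_swap]
  suffices h : (fun k => (serCompL (fun k => (M k).flip) L k).flip) = serCompR M L by rw [h]
  ext k f g
  simp [serCompL, serCompR, LinearMap.sum_apply]

/-- A series of operators starting with an injective operator is injective. -/
theorem eq_zero_of_ser_eq_zero (L : ℕ → A →ₗ[ℂ] B) (h0 : ∀ a, L 0 a = 0 → a = 0) {f : A⟦X⟧}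
    (h : ser L f = 0) : f = 0 := by
  ext k
  rw [map_zero]
  induction k using Nat.strong_induction_on with
  | _ k ih =>
    have := congrArg (coeff k) h
    rw [coeff_ser, map_zero, sum_eq_single (0, k)] at this
    · exact h0 _ this
    · rintro ⟨i, j⟩ hij hne
      have hj : j < k := by
        rw [HasAntidiagonal.mem_antidiagonal] at hij
        rcases Nat.eq_zero_or_pos i with rfl | hi
        · simp_all
        · simp only at hij; omega
      simp [ih j hj]
    · simp

end FormalSeries

end StarReduction

/-! ### Algebra of the left ideal of a constraint and its idealizer -/

namespace StarReduction

open PowerSeries Finset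

/-- Formal star products on a commutative algebra. -/
structure FormalStar (A : Type*) [CommRing A] [Algebra ℂ A] where
  M : ℕ → A →ₗ[ℂ] A →ₗ[ℂ] A
  assoc : ∀ f g h, bser M (bser M f g) h = bser M f (bser M g h)
  zeroth : ∀ f g, M 0 f g = f * g
  one_star : ∀ f, bser M 1 f = f
  star_one : ∀ f, bser M f 1 = f

/-- A formal star product on `A`, together with a constraint `J` that generates the kernel of
a split surjection `res : A → B`. -/
structure FormalConstraint (A B : Type*) [CommRing A] [Algebra ℂ A] [CommRing B] [Algebra ℂ B]
    extends FormalStar A where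
  res : A →ₐ[ℂ] B
  p : B →ₐ[ℂ] A
  res_p : ∀ u, res (p u) = u
  J : A
  res_J : res J = 0
  regular : ∀ h, h * J = 0 → h = 0
  comp : A →ₗ[ℂ] A
  comp_spec : ∀ f, f - p (res f) = comp f * J

namespace FormalConstraint

variable {A B : Type*} [CommRing A] [Algebra ℂ A] [CommRing B] [Algebra ℂ B]
  (d : FormalConstraint A B)

/-- The recursively defined operators `T_k`. -/
def T : ℕ → A →ₗ[ℂ] A
  | 0 => LinearMap.id
  | k + 1 => -∑ j : Fin (k + 1), T (k - j) ∘ₗ (d.M (j + 1)).flip d.J ∘ₗ d.comp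

/-- The formal series whose inverse is `T`. -/
def invT : ℕ → A →ₗ[ℂ] A
  | 0 => LinearMap.id
  | k + 1 => (d.M (k + 1)).flip d.J ∘ₗ d.comp

/-- This is the recursion defining `T`, with the term `T_{k+1}` moved to the other side. -/
theorem serComp_T_invT (k : ℕ) : serComp d.T d.invT (k + 1) = 0 := by
  rw [serComp, Nat.sum_antidiagonal_succ']
  have h : d.T (k + 1) = -∑ j ∈ range (k + 1), d.T (k - j) ∘ₗ d.invT (j + 1) := by
    rw [T, ← Fin.sum_univ_eq_sum_range (fun j => d.T (k - j) ∘ₗ d.invT (j + 1))]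
    rfl
  rw [h, ← Nat.sum_antidiagonal_swap, Nat.sum_antidiagonal_eq_sum_range_succ_mk]
  simp [invT, LinearMap.comp_id]

theorem ser_eq_self {L : ℕ → A →ₗ[ℂ] A} (h0 : L 0 = LinearMap.id) (h : ∀ k, L (k + 1) = 0)
    (f : A⟦X⟧) : ser L f = f := by
  ext k
  rw [coeff_ser, sum_eq_single (0, k)]
  · simp [h0]
  · rintro ⟨i, j⟩ hij hne
    rcases i with _ | i
    · rw [HasAntidiagonal.mem_antidiagonal] at hij
      simp_all
    · simp [h]
  · simp

theorem T_invT (f : A⟦X⟧) : ser d.T (ser d.invT f) = f := by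
  rw [ser_ser]
  refine ser_eq_self ?_ d.serComp_T_invT f
  simp [serComp, T, invT, LinearMap.comp_id]

/-- `T` starts with the identity and is therefore injective on series, so its right inverse is also
a left inverse. -/
theorem invT_T (f : A⟦X⟧) : ser d.invT (ser d.T f) = f := by
  rw [← sub_eq_zero]
  apply eq_zero_of_ser_eq_zero d.T (by simp [T])
  rw [map_sub, T_invT, sub_self]

/-- Restriction of series. -/
def resS (f : A⟦X⟧) : B⟦X⟧ := PowerSeries.map d.res.toRingHom f

/-- Prolongation of series. -/
def pS (f : B⟦X⟧) : A⟦X⟧ := PowerSeries.map d.p.toRingHom f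

/-- The projection modulo the left ideal generated by the constraint. -/
def proj (f : A⟦X⟧) : B⟦X⟧ := d.resS (ser d.T f)

@[simp] theorem coeff_resS (f : A⟦X⟧) (k : ℕ) : coeff k (d.resS f) = d.res (coeff k f) := by
  simp [resS]

@[simp] theorem coeff_pS (f : B⟦X⟧) (k : ℕ) : coeff k (d.pS f) = d.p (coeff k f) := by
  simp [pS]

theorem resS_pS (u : B⟦X⟧) : d.resS (d.pS u) = u := by
  ext k
  simp [d.res_p]

theorem proj_sub (f g : A⟦X⟧) : d.proj (f - g) = d.proj f - d.proj g := by
  simp [proj, resS]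

theorem comp_pS (u : B) : d.comp (d.p u) = 0 := by
  apply d.regular
  rw [← d.comp_spec, d.res_p, sub_self]

theorem comp_mul_J (g : A) : d.comp (g * d.J) = g := by
  rw [← sub_eq_zero]
  apply d.regular
  rw [sub_mul, ← d.comp_spec, map_mul, d.res_J, mul_zero, map_zero, sub_zero, sub_self]

/-- The identity in order zero of `invT` splits each coefficient into its prolongation and `comp f`
times `J`; the latter is the `M_0` term of the star product whose higher terms are the higher
operators of `invT`. -/
theorem ser_invT (f : A⟦X⟧) : ser d.invT f = d.pS (d.resS f)
    + bser d.M (PowerSeries.mk fun k => d.comp (coeff k f)) (PowerSeries.C d.J) := by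
  ext k
  rw [map_add, coeff_bser_C, coeff_ser]
  rcases k with _ | k
  · simp [invT, d.zeroth, ← d.comp_spec]
  · rw [Nat.sum_antidiagonal_succ, Nat.sum_antidiagonal_succ]
    simp only [invT, LinearMap.id_apply, LinearMap.comp_apply, LinearMap.flip_apply,
      coeff_mk, d.zeroth, ← d.comp_spec, coeff_pS, coeff_resS]
    ring

theorem ser_invT_pS (u : B⟦X⟧) : ser d.invT (d.pS u) = d.pS u := by
  rw [ser_invT, resS_pS]
  have : (PowerSeries.mk fun k => d.comp (coeff k (d.pS u))) = 0 := by
    ext k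
    simp [comp_pS]
  rw [this, map_zero, LinearMap.zero_apply, add_zero]

theorem ser_T_pS (u : B⟦X⟧) : ser d.T (d.pS u) = d.pS u := by
  conv_lhs => rw [← d.ser_invT_pS u]
  exact d.T_invT _

theorem proj_pS (u : B⟦X⟧) : d.proj (d.pS u) = u := by
  rw [proj, ser_T_pS, resS_pS]

/-- The star multiple `g * J` is `invT` of the pointwise multiple `g J`. So `T` turns it back into
the pointwise multiple, which restricts to zero. -/
theorem proj_star_J (g : A⟦X⟧) : d.proj (bser d.M g (PowerSeries.C d.J)) = 0 := by
  have : bser d.M g (PowerSeries.C d.J) = ser d.invT (g * PowerSeries.C d.J) := by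
    rw [ser_invT]
    have h1 : d.pS (d.resS (g * PowerSeries.C d.J)) = 0 := by
      ext k
      simp [d.res_J]
    have h2 : (PowerSeries.mk fun k => d.comp (coeff k (g * PowerSeries.C d.J))) = g := by
      ext k
      simp [comp_mul_J]
    rw [h1, h2, zero_add]
  rw [proj, this, T_invT]
  ext k
  simp [d.res_J]

theorem decomp (f : A⟦X⟧) : ∃ g, f = d.pS (d.proj f) + bser d.M g (PowerSeries.C d.J) := by
  have h := d.invT_T f
  rw [ser_invT] at h
  exact ⟨_, h.symm⟩

/-- The left ideal generated by the constraint. -/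
def ideal : Set A⟦X⟧ := {f | ∃ g, f = bser d.M g (PowerSeries.C d.J)}

theorem mem_ideal_iff (f : A⟦X⟧) : f ∈ d.ideal ↔ d.proj f = 0 := by
  constructor
  · rintro ⟨g, rfl⟩
    exact d.proj_star_J g
  · intro h
    obtain ⟨g, hg⟩ := d.decomp f
    refine ⟨g, ?_⟩
    rw [hg, h]
    simp [pS]

theorem ideal_sub {f g : A⟦X⟧} (hf : f ∈ d.ideal) (hg : g ∈ d.ideal) : f - g ∈ d.ideal := by
  rw [mem_ideal_iff] at *
  rw [proj_sub, hf, hg, sub_zero]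

theorem star_mem_ideal (f : A⟦X⟧) {g : A⟦X⟧} (hg : g ∈ d.ideal) : bser d.M f g ∈ d.ideal := by
  obtain ⟨h, rfl⟩ := hg
  exact ⟨bser d.M f h, (d.assoc _ _ _).symm⟩

theorem J_mem_ideal : PowerSeries.C d.J ∈ d.ideal := ⟨1, (d.one_star _).symm⟩

theorem sub_pS_proj_mem (f : A⟦X⟧) : f - d.pS (d.proj f) ∈ d.ideal := by
  obtain ⟨g, hg⟩ := d.decomp f
  exact ⟨g, by rw [sub_eq_iff_eq_add', ← hg]⟩

/-- The idealizer of the left ideal generated by the constraint. -/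
def normalizer : Set A⟦X⟧ :=
  {f | ∀ g ∈ d.ideal, bser d.M f g - bser d.M g f ∈ d.ideal}

/-- A left ideal absorbs `f * g`, so only `g * f` with `g = k * J` is in question, and associativity
reduces it to `J * f`. -/
theorem mem_normalizer_iff (f : A⟦X⟧) :
    f ∈ d.normalizer ↔ bser d.M (PowerSeries.C d.J) f ∈ d.ideal := by
  constructor
  · intro h
    have := d.ideal_sub (d.star_mem_ideal f d.J_mem_ideal) (h _ d.J_mem_ideal)
    rwa [sub_sub_cancel] at this
  · rintro h g ⟨k, rfl⟩
    refine d.ideal_sub (d.star_mem_ideal _ ⟨k, rfl⟩) ?_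
    rw [d.assoc]
    exact d.star_mem_ideal _ h

theorem mem_normalizer_iff_proj (f : A⟦X⟧) : f ∈ d.normalizer ↔
    d.proj (bser d.M (PowerSeries.C d.J) f - bser d.M f (PowerSeries.C d.J)) = 0 := by
  rw [mem_normalizer_iff, mem_ideal_iff, proj_sub, proj_star_J, sub_zero]

theorem star_mem_ideal_of_normalizer {f g : A⟦X⟧} (hf : f ∈ d.ideal) (hg : g ∈ d.normalizer) :
    bser d.M f g ∈ d.ideal := by
  obtain ⟨h, rfl⟩ := hf
  rw [d.assoc]
  exact d.star_mem_ideal _ ((d.mem_normalizer_iff g).1 hg)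

theorem normalizer_star {f g : A⟦X⟧} (hf : f ∈ d.normalizer) (hg : g ∈ d.normalizer) :
    bser d.M f g ∈ d.normalizer := by
  rw [mem_normalizer_iff] at hf ⊢
  rw [← d.assoc]
  exact d.star_mem_ideal_of_normalizer hf hg

theorem ideal_subset_normalizer : d.ideal ⊆ d.normalizer := fun f hf => by
  rw [mem_normalizer_iff]
  exact d.star_mem_ideal _ hf

theorem normalizer_sub {f g : A⟦X⟧} (hf : f ∈ d.normalizer) (hg : g ∈ d.normalizer) :
    f - g ∈ d.normalizer := by
  rw [mem_normalizer_iff] at *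
  rw [map_sub]
  exact d.ideal_sub hf hg

/-- The product on the quotient of the normalizer by the ideal, realized on prolongations. -/
def prodS (f g : A⟦X⟧) : A⟦X⟧ := d.pS (d.proj (bser d.M f g))

theorem prodS_mem {f g : A⟦X⟧} (hf : f ∈ d.normalizer) (hg : g ∈ d.normalizer) :
    d.prodS f g ∈ d.normalizer := by
  have h1 := d.normalizer_star hf hg
  have h2 := d.ideal_subset_normalizer (d.sub_pS_proj_mem (bser d.M f g))
  have := d.normalizer_sub h1 h2
  rwa [sub_sub_cancel] at this

/-- Passing to a representative changes a product by an element of the left ideal. Left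
multiplication always preserves this ideal, and right multiplication by `h` does so because `h` is
in the idealizer. -/
theorem prodS_assoc {f g h : A⟦X⟧} (hh : h ∈ d.normalizer) :
    d.prodS (d.prodS f g) h = d.prodS f (d.prodS g h) := by
  have h1 : d.proj (bser d.M (d.prodS f g) h) = d.proj (bser d.M (bser d.M f g) h) := by
    have := d.star_mem_ideal_of_normalizer (d.sub_pS_proj_mem (bser d.M f g)) hh
    rw [mem_ideal_iff, map_sub, LinearMap.sub_apply, proj_sub, sub_eq_zero] at this
    exact this.symm
  have h2 : d.proj (bser d.M f (d.prodS g h)) = d.proj (bser d.M f (bser d.M g h)) := by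
    have := d.star_mem_ideal f (d.sub_pS_proj_mem (bser d.M g h))
    rw [mem_ideal_iff, map_sub, proj_sub, sub_eq_zero] at this
    exact this.symm
  rw [prodS, h1, prodS, h2, d.assoc]

/-- The commutator operators with the constraint. -/
def commJ (k : ℕ) : A →ₗ[ℂ] A := d.M k d.J - (d.M k).flip d.J

theorem commJ_zero : d.commJ 0 = 0 := by
  ext f
  simp [commJ, d.zeroth, mul_comm]

theorem comm_eq_ser (f : A⟦X⟧) :
    bser d.M (PowerSeries.C d.J) f - bser d.M f (PowerSeries.C d.J) = ser d.commJ f := by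
  ext k
  simp [coeff_C_bser, coeff_bser_C, coeff_ser, commJ]

/-- The inhomogeneity in the recursion for the elements of the normalizer. -/
def Fop (x : ℕ → A) (k : ℕ) : A :=
  ∑ j ∈ Icc 2 k, d.commJ j (x (k - j))
    + ∑ i ∈ Icc 1 (k - 1), ∑ j ∈ Icc 1 (k - i), d.T i (d.commJ j (x (k - j - i)))

theorem coeff_T_comm_zero (f : A⟦X⟧) : coeff 0 (ser d.T (ser d.commJ f)) = 0 := by
  simp [coeff_ser, commJ_zero]

/-- As `M_0` is commutative, the commutator with `J` raises the order. Hence the highest coefficient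
occurring in order `k + 1` is that of index `k`, and only through `T_0` and `commJ 1`. -/
theorem coeff_T_comm_succ (f : A⟦X⟧) (k : ℕ) : coeff (k + 1) (ser d.T (ser d.commJ f))
    = d.commJ 1 (coeff k f) + d.Fop (fun j => coeff j f) (k + 1) := by
  have key : ∀ m (F : ℕ → ℕ → A), F 0 m = 0 →
      ∑ i ∈ antidiagonal m, F i.1 i.2 = ∑ i ∈ Icc 1 m, F i (m - i) := by
    intro m F h0
    rw [Nat.sum_antidiagonal_eq_sum_range_succ, range_eq_Ico, sum_eq_sum_Ico_succ_bot (by omega),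
      tsub_zero, h0, zero_add]
    rfl
  have hin : ∀ m, coeff m (ser d.commJ f) = ∑ j ∈ Icc 1 m, d.commJ j (coeff (m - j) f) := by
    intro m
    rw [coeff_ser, key m (fun i j => d.commJ i (coeff j f))]
    simp [commJ_zero]
  rw [coeff_ser, Nat.sum_antidiagonal_succ]
  have h1 : ∑ i ∈ antidiagonal k, d.T (i.1 + 1) (coeff i.2 (ser d.commJ f))
      = ∑ i ∈ Icc 1 k, d.T i (coeff (k + 1 - i) (ser d.commJ f)) := by
    -- The value `0` at `i = 0` removes the `T_0` term so that `key` applies. The summand `i = k +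
    -- 1` vanishes because the commutator series starts in order one.
    have h := key (k + 1) (fun i j => if i = 0 then 0 else d.T i (coeff j (ser d.commJ f))) (by simp)
    rw [Nat.sum_antidiagonal_succ, sum_Icc_succ_top (by omega)] at h
    simp only [if_true, zero_add, Nat.add_eq_zero_iff, one_ne_zero, and_false, if_false,
      tsub_self, hin 0] at h
    rw [h]
    simp only [Icc_eq_empty (show ¬ (1 ≤ 0) by omega), sum_empty, map_zero, add_zero]
    refine sum_congr rfl fun i hi => ?_
    rw [mem_Icc] at hi
    rw [if_neg (by omega)]
  simp only at h1 ⊢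
  rw [h1, Fop, ← add_assoc]
  congr 1
  · rw [hin, T, LinearMap.id_apply, ← Finset.add_sum_Ioc_eq_sum_Icc (by omega)]
    rfl
  · refine sum_congr rfl fun i hi => ?_
    rw [hin, map_sum]
    refine sum_congr rfl fun j hj => ?_
    rw [show k + 1 - i - j = k + 1 - j - i by omega]

theorem mem_normalizer_iff_coeff (f : A⟦X⟧) : f ∈ d.normalizer ↔ ∀ k,
    d.res (d.commJ 1 (coeff k f)) + d.res (d.Fop (fun j => coeff j f) (k + 1)) = 0 := by
  rw [mem_normalizer_iff_proj, comm_eq_ser, proj]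
  constructor
  · intro h k
    have := congrArg (coeff (k + 1)) h
    rwa [coeff_resS, coeff_T_comm_succ, map_zero, map_add] at this
  · intro h
    ext k
    rcases k with _ | k
    · simp [coeff_T_comm_zero]
    · rw [coeff_resS, coeff_T_comm_succ, map_zero, map_add, h k]

end FormalConstraint

end StarReduction

/-! ### Algebra of the reduction: solving the equations along the leaves -/

namespace StarReduction

open PowerSeries Finset

/-- The algebraic data of the reduction of a formal star product: `δ` is the derivative along the
leaves, `L` inverts it up to the factor `-i`, and `π`, `s` are the pull-backs along the projection
to the leaf space and along a transversal section. -/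
structure FormalReduction (A B D : Type*) [CommRing A] [Algebra ℂ A] [CommRing B] [Algebra ℂ B]
    [CommRing D] [Algebra ℂ D] extends FormalConstraint A B where
  δ : B →ₗ[ℂ] B
  res_commJ : ∀ f, res (toFormalConstraint.commJ 1 f) = -Complex.I • δ (res f)
  L : B →ₗ[ℂ] B
  δ_L : ∀ w, δ (L w) = -Complex.I • w
  π : D →ₐ[ℂ] B
  s : B →ₐ[ℂ] D
  s_π : ∀ v, s (π v) = v
  s_L : ∀ w, s (L w) = 0
  δ_π : ∀ v, δ (π v) = 0
  π_s : ∀ u, δ u = 0 → π (s u) = u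
  S : ℕ → A →ₗ[ℂ] A
  S_zero : S 0 = LinearMap.id
  S_succ : ∀ k f, S (k + 1) f = p (L (res (toFormalConstraint.Fop (fun j => S j f) (k + 2))))

namespace FormalReduction

variable {A B D : Type*} [CommRing A] [Algebra ℂ A] [CommRing B] [Algebra ℂ B]
    [CommRing D] [Algebra ℂ D] (d : FormalReduction A B D)

/-- The prolongations of series that are constant along the leaves. -/
def BF : Set A⟦X⟧ := {f | f = d.pS (d.resS f) ∧ ∀ k, d.δ (d.res (coeff k f)) = 0}

/-- The prolongations in the normalizer of the ideal. -/
def NF : Set A⟦X⟧ := {f | f = d.pS (d.resS f) ∧ f ∈ d.normalizer}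

/-- The values on the transversal section. -/
def ρ (f : A⟦X⟧) : D⟦X⟧ := PowerSeries.map d.s.toRingHom (d.resS f)

/-- Pull back to the constraint surface, then prolong. -/
def lift (v : D⟦X⟧) : A⟦X⟧ := d.pS (PowerSeries.map d.π.toRingHom v)

@[simp] theorem coeff_ρ (f : A⟦X⟧) (k : ℕ) : coeff k (d.ρ f) = d.s (d.res (coeff k f)) := by
  simp [ρ]

@[simp] theorem coeff_lift (v : D⟦X⟧) (k : ℕ) : coeff k (d.lift v) = d.p (d.π (coeff k v)) := by
  simp [lift]

theorem ρ_lift (v : D⟦X⟧) : d.ρ (d.lift v) = v := by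
  ext k
  simp [d.res_p, d.s_π]

theorem lift_mem (v : D⟦X⟧) : d.lift v ∈ d.BF := by
  refine ⟨?_, fun k => ?_⟩
  · rw [lift, d.resS_pS]
  · rw [coeff_lift, d.res_p, d.δ_π]

theorem lift_ρ {f : A⟦X⟧} (hf : f ∈ d.BF) : d.lift (d.ρ f) = f := by
  obtain ⟨h1, h2⟩ := hf
  conv_rhs => rw [h1]
  ext k
  rw [coeff_lift, coeff_ρ, d.π_s _ (h2 k), d.coeff_pS, d.coeff_resS]

theorem bijOn_lift : Set.BijOn d.lift Set.univ d.BF :=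
  ⟨fun v _ => d.lift_mem v, fun v _ w _ h => by rw [← d.ρ_lift v, h, d.ρ_lift],
    fun f hf => ⟨d.ρ f, trivial, d.lift_ρ hf⟩⟩

/-- The corrections of positive order are prolonged leaf integrals, which start at the section and
vanish on it. -/
theorem ρ_S (f : A⟦X⟧) : d.ρ (ser d.S f) = d.ρ f := by
  ext k
  rw [coeff_ρ, coeff_ρ, coeff_ser, map_sum, map_sum, sum_eq_single (0, k)]
  · rw [d.S_zero]; rfl
  · rintro ⟨i, j⟩ hij hne
    rcases i with _ | i
    · rw [HasAntidiagonal.mem_antidiagonal] at hij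
      simp_all
    · simp only [d.S_succ, d.res_p, d.s_L]
  · simp

theorem pure_S {f : A⟦X⟧} (hf : f = d.pS (d.resS f)) :
    ser d.S f = d.pS (d.resS (ser d.S f)) := by
  have h : ∀ k a, a = d.p (d.res a) → d.S k a = d.p (d.res (d.S k a)) := by
    intro k a ha
    rcases k with _ | k
    · rwa [d.S_zero]
    · rw [d.S_succ, d.res_p]
  ext k
  rw [d.coeff_pS, d.coeff_resS, coeff_ser, map_sum, map_sum]
  refine sum_congr rfl fun i _ => h _ _ ?_
  conv_lhs => rw [hf]
  rw [d.coeff_pS, d.coeff_resS]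

/-- The equation of lowest order is the assumption on `a`. In the higher ones the factor `-i` of
`res_commJ` and the factor `-i` of `δ_L` combine to `-1`, which cancels the inhomogeneity. -/
theorem S_C_mem {a : A} (ha : d.δ (d.res a) = 0) :
    ser d.S (PowerSeries.C a) ∈ d.normalizer := by
  rw [d.mem_normalizer_iff_coeff]
  intro k
  simp only [coeff_ser_C]
  rcases k with _ | k
  · rw [d.S_zero, LinearMap.id_apply, d.res_commJ, ha]
    simp [FormalConstraint.Fop]
  · rw [d.res_commJ, d.S_succ, d.res_p, d.δ_L, smul_smul]
    simp

/-- The obstruction is the restriction of the composed series `T ∘ commJ ∘ S`. By `S_C_mem` each of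
its operators vanishes on every coefficient of `f`, hence the series vanishes on `f`. -/
theorem S_mem {f : A⟦X⟧} (hf : f ∈ d.BF) : ser d.S f ∈ d.NF := by
  refine ⟨d.pure_S hf.1, ?_⟩
  rw [d.mem_normalizer_iff_proj, d.comm_eq_ser, FormalConstraint.proj, ser_ser, ser_ser]
  have key : ∀ k a, d.δ (d.res a) = 0 →
      d.res (serComp (serComp d.T d.commJ) d.S k a) = 0 := by
    intro k a ha
    have := d.S_C_mem ha
    rw [d.mem_normalizer_iff_proj, d.comm_eq_ser, FormalConstraint.proj, ser_ser, ser_ser] at this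
    have := congrArg (coeff k) this
    rwa [d.coeff_resS, coeff_ser_C, map_zero] at this
  ext k
  rw [d.coeff_resS, coeff_ser, map_sum, map_zero]
  exact sum_eq_zero fun i _ => key _ _ (hf.2 _)

/-- Uniqueness for the equations along the leaves: once the lower coefficients vanish, so does the
inhomogeneity, and the next coefficient is constant along the leaves with value zero on the section.
-/
theorem eq_zero_of_ρ {f : A⟦X⟧} (hf : f ∈ d.NF) (h : d.ρ f = 0) : f = 0 := by
  have key : ∀ k, coeff k f = 0 := by
    intro k
    induction k using Nat.strong_induction_on with
    | _ k ih =>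
      have h1 := (d.mem_normalizer_iff_coeff f).1 hf.2 k
      have h2 : d.Fop (fun j => coeff j f) (k + 1) = 0 := by
        rw [FormalConstraint.Fop]
        rw [sum_eq_zero, sum_eq_zero, add_zero]
        · intro i hi
          refine sum_eq_zero fun j hj => ?_
          simp only [mem_Icc] at hi hj
          rw [ih _ (by omega), map_zero, map_zero]
        · intro j hj
          simp only [mem_Icc] at hj
          rw [ih _ (by omega), map_zero]
      rw [h2, map_zero, add_zero, d.res_commJ] at h1
      have h3 : d.δ (d.res (coeff k f)) = 0 := by
        rcases smul_eq_zero.1 h1 with h | h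
        · simp at h
        · exact h
      have h4 := congrArg (coeff k) h
      rw [coeff_ρ, map_zero] at h4
      have h5 := d.π_s _ h3
      rw [h4, map_zero] at h5
      rw [hf.1, d.coeff_pS, d.coeff_resS, ← h5, map_zero]
  ext k
  rw [key, map_zero]

theorem NF_sub {f g : A⟦X⟧} (hf : f ∈ d.NF) (hg : g ∈ d.NF) : f - g ∈ d.NF := by
  refine ⟨?_, d.normalizer_sub hf.2 hg.2⟩
  conv_lhs => rw [hf.1, hg.1]
  simp [FormalConstraint.pS, FormalConstraint.resS]

theorem eq_of_ρ_eq {f g : A⟦X⟧} (hf : f ∈ d.NF) (hg : g ∈ d.NF) (h : d.ρ f = d.ρ g) : f = g := by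
  rw [← sub_eq_zero]
  apply d.eq_zero_of_ρ (d.NF_sub hf hg)
  ext k
  have := congrArg (coeff k) h
  simp only [coeff_ρ] at this
  simp [this]

/-- Values on the section determine the elements of both sets, and `S` preserves these values. The
preimage of `g` is the lift of its values. -/
theorem bijOn_S : Set.BijOn (ser d.S) d.BF d.NF := by
  refine ⟨fun f hf => d.S_mem hf, fun f hf g hg h => ?_, fun g hg => ?_⟩
  · rw [← d.lift_ρ hf, ← d.ρ_S, h, d.ρ_S, d.lift_ρ hg]
  · refine ⟨d.lift (d.ρ g), d.lift_mem _, ?_⟩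
    apply d.eq_of_ρ_eq (d.S_mem (d.lift_mem _)) hg
    rw [d.ρ_S, d.ρ_lift]

theorem prodS_mem_NF {f g : A⟦X⟧} (hf : f ∈ d.NF) (hg : g ∈ d.NF) : d.prodS f g ∈ d.NF :=
  ⟨by rw [FormalConstraint.prodS, d.resS_pS], d.prodS_mem hf.2 hg.2⟩

/-- The series of operators on the leaf space with values in the normalizer. -/
def Slift (k : ℕ) : D →ₗ[ℂ] A := d.S k ∘ₗ d.p.toLinearMap ∘ₗ d.π.toLinearMap

theorem ser_Slift (v : D⟦X⟧) : ser d.Slift v = ser d.S (d.lift v) := by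
  ext k
  simp [coeff_ser, Slift]

theorem Slift_mem (v : D⟦X⟧) : ser d.Slift v ∈ d.NF := by
  rw [ser_Slift]
  exact d.S_mem (d.lift_mem v)

theorem ρ_Slift (v : D⟦X⟧) : d.ρ (ser d.Slift v) = v := by
  rw [ser_Slift, d.ρ_S, d.ρ_lift]

/-- The operators of the reduced star product. -/
def redM : ℕ → D →ₗ[ℂ] D →ₗ[ℂ] D :=
  serCompB (fun k => d.s.toLinearMap ∘ₗ d.res.toLinearMap ∘ₗ d.T k)
    (serCompR (serCompL d.M d.Slift) d.Slift)

theorem bser_redM (u v : D⟦X⟧) :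
    bser d.redM u v = d.ρ (d.prodS (ser d.Slift u) (ser d.Slift v)) := by
  rw [redM, ← ser_bser, ← bser_ser_right, ← bser_ser_left]
  ext k
  simp [FormalConstraint.prodS, FormalConstraint.proj, coeff_ser, d.res_p]

/-- Both sides lie in `NF` and have the same values on the section. -/
theorem Slift_redM (u v : D⟦X⟧) :
    ser d.Slift (bser d.redM u v) = d.prodS (ser d.Slift u) (ser d.Slift v) := by
  apply d.eq_of_ρ_eq (d.Slift_mem _) (d.prodS_mem_NF (d.Slift_mem _) (d.Slift_mem _))
  rw [ρ_Slift, bser_redM]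

theorem redM_assoc (u v w : D⟦X⟧) :
    bser d.redM (bser d.redM u v) w = bser d.redM u (bser d.redM v w) := by
  rw [d.bser_redM (bser d.redM u v), d.bser_redM u (bser d.redM v w), Slift_redM, Slift_redM, d.prodS_assoc (d.Slift_mem _).2]

theorem one_mem_NF : (1 : A⟦X⟧) ∈ d.NF := by
  refine ⟨by simp [FormalConstraint.pS, FormalConstraint.resS], ?_⟩
  rw [d.mem_normalizer_iff, d.star_one]
  exact d.J_mem_ideal

theorem Slift_one : ser d.Slift 1 = 1 := by
  apply d.eq_of_ρ_eq (d.Slift_mem _) d.one_mem_NF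
  rw [ρ_Slift]
  simp [ρ, FormalConstraint.resS]

theorem redM_one (u : D⟦X⟧) : bser d.redM u 1 = u := by
  have h := (d.Slift_mem u).1
  rw [bser_redM, Slift_one, FormalConstraint.prodS, d.star_one, h, d.proj_pS, ← h, ρ_Slift]

theorem one_redM (u : D⟦X⟧) : bser d.redM 1 u = u := by
  have h := (d.Slift_mem u).1
  rw [bser_redM, Slift_one, FormalConstraint.prodS, d.one_star, h, d.proj_pS, ← h, ρ_Slift]

theorem redM_zero (u v : D) : d.redM 0 u v = u * v := by
  simp [redM, serCompB, serCompL, serCompR, FormalConstraint.T, d.zeroth, Slift, d.S_zero, d.res_p,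
    d.s_π]

/-- The contributions of `T_1` and `S_1` come with the commutative product `M_0` and are symmetric
in `u` and `v`, so they cancel. -/
theorem redM_one_sub (u v : D) : d.redM 1 u v - d.redM 1 v u
    = d.s (d.res (d.M 1 (d.p (d.π u)) (d.p (d.π v)) - d.M 1 (d.p (d.π v)) (d.p (d.π u)))) := by
  have h1 : antidiagonal 1 = ({(0, 1), (1, 0)} : Finset (ℕ × ℕ)) := rfl
  simp [redM, serCompB, serCompL, serCompR, h1, FormalConstraint.T, d.zeroth, Slift, d.S_zero,
    d.res_p, d.s_π, mul_comm]
  ring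

end FormalReduction

end StarReduction

/-! ### Germs and differentials of smooth functions -/

namespace StarReduction

section Germs

variable {n : ℕ} {M : Type*} [TopologicalSpace M] [ChartedSpace (E n) M]
  {m : ℕ} {N : Type*} [TopologicalSpace N] [ChartedSpace (E m) N]

theorem Sm.contMDiff (f : Sm n M) : ContMDiff (𝓡 n) 𝓘(ℝ, ℂ) ∞ f.1 := f.2

theorem Sm.continuous (f : Sm n M) : Continuous f.1 := (Sm.contMDiff f).continuous

theorem Sm.mdifferentiableAt (f : Sm n M) (x : M) :
    MDifferentiableAt (𝓡 n) 𝓘(ℝ, ℂ) f.1 x := (Sm.contMDiff f).mdifferentiableAt (by simp)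

theorem Sm.ext {f g : Sm n M} (h : ∀ x, f.1 x = g.1 x) : f = g := Subtype.ext (funext h)

theorem Sm.ofFun_apply {u : M → ℂ} (h : ContMDiff (𝓡 n) 𝓘(ℝ, ℂ) ∞ u) (x : M) :
    (Sm.ofFun u : Sm n M).1 x = u x := by
  rw [Sm.ofFun, dif_pos h]

/-- The differential of a smooth function. -/
def Sm.d (f : Sm n M) (x : M) : TangentSpace (𝓡 n) x →ₗ[ℝ] ℂ :=
  (mfderiv (𝓡 n) 𝓘(ℝ, ℂ) f.1 x : TangentSpace (𝓡 n) x →L[ℝ] ℂ).toLinearMap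

theorem Sm.d_congr {f g : Sm n M} {x : M} (h : ∀ᶠ y in 𝓝 x, f.1 y = g.1 y) : Sm.d f x = Sm.d g x := by
  rw [Sm.d, Sm.d, Filter.EventuallyEq.mfderiv_eq h]

theorem Sm.d_mul (f g : Sm n M) (x : M) (v : TangentSpace (𝓡 n) x) :
    Sm.d (f * g) x v = f.1 x * Sm.d g x v + g.1 x * Sm.d f x v := by
  have := ((Sm.mdifferentiableAt f x).hasMFDerivAt.mul (Sm.mdifferentiableAt g x).hasMFDerivAt).mfderiv
  exact congrArg (fun L : TangentSpace (𝓡 n) x →L[ℝ] ℂ => L v) this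

theorem Sm.d_algebraMap (a : ℂ) (x : M) : Sm.d (algebraMap ℂ (Sm n M) a) x = 0 := by
  ext v
  have : mfderiv (𝓡 n) 𝓘(ℝ, ℂ) (fun _ : M => a) x = 0 := mfderiv_const
  exact congrArg (fun L : TangentSpace (𝓡 n) x →L[ℝ] ℂ => L v) this

theorem Sm.d_pullback (φ : M → N) (hφ : ContMDiff (𝓡 n) (𝓡 m) ∞ φ) (f : Sm m N) (x : M)
    (v : TangentSpace (𝓡 n) x) :
    Sm.d (Sm.pullback φ hφ f) x v = Sm.d f (φ x) (mfderiv (𝓡 n) (𝓡 m) φ x v) := by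
  have := mfderiv_comp x (Sm.mdifferentiableAt f (φ x)) (hφ.mdifferentiableAt (by simp) (x := x))
  exact congrArg (fun L : TangentSpace (𝓡 n) x →L[ℝ] ℂ => L v) this

variable [T2Space M] [IsManifold (𝓡 n) ∞ M]

theorem Sm.exists_bump (x : M) {V : Set M} (hV : V ∈ 𝓝 x) :
    ∃ χ : Sm n M, (∀ᶠ y in 𝓝 x, χ.1 y = 1) ∧ tsupport χ.1 ⊆ V ∧ HasCompactSupport χ.1 := by
  obtain ⟨f, -, hf⟩ := (SmoothBumpFunction.nhds_basis_tsupport (I := 𝓡 n) (c := x)).mem_iff.1 hV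
  have hs : tsupport (fun y => ((f y : ℝ) : ℂ)) ⊆ tsupport f :=
    closure_mono fun y hy h => hy (by simp [h])
  refine ⟨⟨fun y => (f y : ℂ), Complex.ofRealCLM.contDiff.contMDiff.comp f.contMDiff⟩, ?_, ?_, ?_⟩
  · filter_upwards [f.eventuallyEq_one] with y hy
    simp [hy]
  · exact hs.trans hf
  · exact f.hasCompactSupport.of_isClosed_subset (isClosed_tsupport _) hs

theorem Sm.exists_germ (g : M → ℂ) (x : M)
    (hg : ∀ᶠ y in 𝓝 x, ContMDiffAt (𝓡 n) 𝓘(ℝ, ℂ) ∞ g y) :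
    ∃ G : Sm n M, ∀ᶠ y in 𝓝 x, G.1 y = g y := by
  obtain ⟨χ, h1, h2, -⟩ := Sm.exists_bump (n := n) x hg
  refine ⟨⟨fun y => χ.1 y * g y, ?_⟩, ?_⟩
  · refine contMDiff_of_tsupport fun y hy => ?_
    exact (contDiff_mul (𝕜 := ℝ)).contMDiff.contMDiffAt.comp y
      (ContMDiffAt.prodMk_space (Sm.contMDiff χ y) (h2 (tsupport_mul_subset_left hy)))
  · filter_upwards [h1] with y hy
    simp [hy]

theorem Sm.exists_germ_of_open (x : M) {V : Set M} (hV : IsOpen V) (hx : x ∈ V) (g : M → ℂ)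
    (hg : ContMDiffOn (𝓡 n) 𝓘(ℝ, ℂ) ∞ g V) :
    ∃ G : Sm n M, ∀ᶠ y in 𝓝 x, G.1 y = g y :=
  Sm.exists_germ g x (by
    filter_upwards [hV.mem_nhds hx] with y hy using (hg y hy).contMDiffAt (hV.mem_nhds hy))

/-- A linear function of the preferred chart at `x₀` extends from a neighbourhood of each point of
its domain to a smooth function. -/
theorem Sm.exists_coord (x₀ x : M) (hx : x ∈ (chartAt (E n) x₀).source) (l : E n →L[ℝ] ℂ) :
    ∃ G : Sm n M, ∀ᶠ y in 𝓝 x, G.1 y = l (chartAt (E n) x₀ y) := by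
  refine Sm.exists_germ_of_open x (chartAt (E n) x₀).open_source hx _ ?_
  exact l.contDiff.contMDiff.comp_contMDiffOn (contMDiffOn_chart (I := 𝓡 n) (x := x₀))

/-- Coordinate functions, cut off by a bump function, already separate tangent vectors. -/
theorem Sm.eq_zero_of_d (x : M) (v : TangentSpace (𝓡 n) x) (h : ∀ f : Sm n M, Sm.d f x v = 0) :
    v = 0 := by
  have hx : x ∈ (extChartAt (𝓡 n) x).source := mem_extChartAt_source x
  have h1 : ∀ l : E n →L[ℝ] ℂ, l (mfderiv (𝓡 n) 𝓘(ℝ, E n) (extChartAt (𝓡 n) x) x v) = 0 := by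
    intro l
    obtain ⟨G, hG⟩ := Sm.exists_coord x x (mem_chart_source _ x) l
    have h2 := h G
    have h3 : MDifferentiableAt (𝓡 n) 𝓘(ℝ, E n) (extChartAt (𝓡 n) x) x :=
      mdifferentiableAt_extChartAt (mem_chart_source _ x)
    have h4 : mfderiv (𝓡 n) 𝓘(ℝ, ℂ) G.1 x
        = l.comp (mfderiv (𝓡 n) 𝓘(ℝ, E n) (extChartAt (𝓡 n) x) x) := by
      rw [Filter.EventuallyEq.mfderiv_eq hG]
      have := mfderiv_comp x (l.mdifferentiableAt (x := extChartAt (𝓡 n) x x)) h3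
      rw [ContinuousLinearMap.mfderiv_eq] at this
      exact this
    rw [Sm.d, h4] at h2
    exact h2
  have h5 : mfderiv (𝓡 n) 𝓘(ℝ, E n) (extChartAt (𝓡 n) x) x v = 0 := by
    refine PiLp.ext fun i => ?_
    have := h1 (Complex.ofRealCLM.comp (EuclideanSpace.proj i))
    exact Complex.ofReal_eq_zero.1 this
  exact (isInvertible_mfderiv_extChartAt hx).injective (h5.trans (map_zero _).symm)

end Germs

end StarReduction

/-! ### Pointwise symplectic linear algebra and Poisson brackets -/

namespace StarReduction

section Poisson

variable {n : ℕ} {M : Type*} [TopologicalSpace M] [ChartedSpace (E n) M]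
  {m : ℕ} {N : Type*} [TopologicalSpace N] [ChartedSpace (E m) N]

instance (x : M) : FiniteDimensional ℝ (TangentSpace (𝓡 n) x) :=
  inferInstanceAs (FiniteDimensional ℝ (E n))

theorem finrank_tangentSpace (x : M) : Module.finrank ℝ (TangentSpace (𝓡 n) x) = n :=
  (finrank_euclideanSpace (𝕜 := ℝ) (ι := Fin n)).trans (Fintype.card_fin n)

/-- Forms that are alternating and nondegenerate at a point. -/
structure TwoForm.SymplecticAt (Ω : TwoForm n M) (x : M) : Prop where
  alternating : ∀ v, Ω x v v = 0
  nondegenerate : ∀ v, (∀ w, Ω x v w = 0) → v = 0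

theorem TwoForm.IsSymplectic.symplecticAt {Ω : TwoForm n M} (h : Ω.IsSymplectic) (x : M) :
    Ω.SymplecticAt x := ⟨h.alternating x, h.nondegenerate x⟩

namespace TwoForm.SymplecticAt

variable {Ω : TwoForm n M} {x : M}

theorem skew (h : Ω.SymplecticAt x) (v w : TangentSpace (𝓡 n) x) : Ω x v w = -Ω x w v := by
  have := h.alternating (v + w)
  simp only [map_add, LinearMap.add_apply, h.alternating, zero_add, add_zero] at this
  linarith

theorem ext (h : Ω.SymplecticAt x) {v v' : TangentSpace (𝓡 n) x} (hv : ∀ w, Ω x v w = Ω x v' w) : v = v' := by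
  rw [← sub_eq_zero]
  apply h.nondegenerate
  intro w
  rw [map_sub, LinearMap.sub_apply, hv, sub_self]

theorem exists_vec (h : Ω.SymplecticAt x) (l : TangentSpace (𝓡 n) x →ₗ[ℝ] ℝ) : ∃ v, ∀ w, Ω x v w = l w := by
  have hinj : Function.Injective (Ω x) := by
    rw [injective_iff_map_eq_zero]
    intro v hv
    exact h.nondegenerate v fun w => by rw [hv]; rfl
  have hs : Function.Surjective (Ω x) :=
    (LinearMap.injective_iff_surjective_of_finrank_eq_finrank
      (Subspace.dual_finrank_eq (K := ℝ) (V := TangentSpace (𝓡 n) x)).symm).1 hinj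
  obtain ⟨v, hv⟩ := hs l
  exact ⟨v, fun w => by rw [hv]⟩

theorem hamVec_spec (h : Ω.SymplecticAt x) (f : M → ℝ) (w : TangentSpace (𝓡 n) x) :
    Ω x (hamVec Ω f x) w = mfderiv (𝓡 n) 𝓘(ℝ, ℝ) f x w := by
  have := h.exists_vec
    (mfderiv (𝓡 n) 𝓘(ℝ, ℝ) f x : TangentSpace (𝓡 n) x →L[ℝ] ℝ).toLinearMap
  exact Classical.epsilon_spec (p := fun v => ∀ w, Ω x v w = mfderiv (𝓡 n) 𝓘(ℝ, ℝ) f x w) this w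

theorem eq_hamVec (h : Ω.SymplecticAt x) (f : M → ℝ) (v : TangentSpace (𝓡 n) x)
    (hv : ∀ w, Ω x v w = mfderiv (𝓡 n) 𝓘(ℝ, ℝ) f x w) : v = hamVec Ω f x :=
  h.ext fun w => (hv w).trans (h.hamVec_spec f w).symm

end TwoForm.SymplecticAt

theorem Sm.mfderiv_re (f : Sm n M) (x : M) (v : TangentSpace (𝓡 n) x) :
    mfderiv (𝓡 n) 𝓘(ℝ, ℝ) (fun y => (f.1 y).re) x v = (Sm.d f x v).re := by
  have := mfderiv_comp x (Complex.reCLM.mdifferentiableAt (x := f.1 x)) (Sm.mdifferentiableAt f x)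
  rw [ContinuousLinearMap.mfderiv_eq] at this
  exact congrArg (fun L : TangentSpace (𝓡 n) x →L[ℝ] ℝ => L v) this

theorem Sm.mfderiv_im (f : Sm n M) (x : M) (v : TangentSpace (𝓡 n) x) :
    mfderiv (𝓡 n) 𝓘(ℝ, ℝ) (fun y => (f.1 y).im) x v = (Sm.d f x v).im := by
  have := mfderiv_comp x (Complex.imCLM.mdifferentiableAt (x := f.1 x)) (Sm.mdifferentiableAt f x)
  rw [ContinuousLinearMap.mfderiv_eq] at this
  exact congrArg (fun L : TangentSpace (𝓡 n) x →L[ℝ] ℝ => L v) this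

theorem Sm.ofReal_d (J : M → ℝ) (hJ : ContMDiff (𝓡 n) 𝓘(ℝ, ℝ) ∞ J) (x : M)
    (v : TangentSpace (𝓡 n) x) :
    Sm.d (⟨fun y => (J y : ℂ), Complex.ofRealCLM.contDiff.contMDiff.comp hJ⟩ : Sm n M) x v
      = Complex.ofReal (mfderiv (𝓡 n) 𝓘(ℝ, ℝ) J x v) := by
  have := mfderiv_comp x (Complex.ofRealCLM.mdifferentiableAt (x := J x))
    (hJ.mdifferentiableAt (by simp) (x := x))
  rw [ContinuousLinearMap.mfderiv_eq] at this
  exact congrArg (fun L : TangentSpace (𝓡 n) x →L[ℝ] ℂ => L v) this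

/-- The Poisson bracket is determined by the Hamiltonian vectors at the point. -/
theorem poisson_eq {Ω : TwoForm n M} {x : M} (h : Ω.SymplecticAt x) (f g : Sm n M) :
    poisson Ω f.1 g.1 x = -(Sm.d g x (hamVec Ω (fun y => (f.1 y).re) x)
      + Complex.I * Sm.d g x (hamVec Ω (fun y => (f.1 y).im) x)) := by
  have h1 : ∀ (a : M → ℝ), poissonReal Ω a (fun y => (g.1 y).re) x
      = -(Sm.d g x (hamVec Ω a x)).re := fun a => by
    rw [poissonReal, h.skew, h.hamVec_spec, Sm.mfderiv_re]
  have h2 : ∀ (a : M → ℝ), poissonReal Ω a (fun y => (g.1 y).im) x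
      = -(Sm.d g x (hamVec Ω a x)).im := fun a => by
    rw [poissonReal, h.skew, h.hamVec_spec, Sm.mfderiv_im]
  rw [poisson, h1, h1, h2, h2]
  apply Complex.ext <;> simp <;> ring

theorem poisson_ofReal {Ω : TwoForm n M} {x : M} (h : Ω.SymplecticAt x) (f : Sm n M)
    (J : M → ℝ) : poisson Ω f.1 (fun y => (J y : ℂ)) x = Sm.d f x (hamVec Ω J x) := by
  have h1 : ∀ (a : M → ℝ), poissonReal Ω a (fun y => ((J y : ℂ)).re) x
      = mfderiv (𝓡 n) 𝓘(ℝ, ℝ) a x (hamVec Ω J x) := fun a => by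
    simp only [poissonReal, Complex.ofReal_re, h.hamVec_spec]
    rfl
  have h2 : ∀ (a : M → ℝ), poissonReal Ω a (fun y => ((J y : ℂ)).im) x = 0 := fun a => by
    rw [poissonReal, h.skew, h.hamVec_spec]
    simp only [Complex.ofReal_im]
    rw [mfderiv_const]
    exact neg_zero
  rw [poisson, h1, h1, h2, h2, Sm.mfderiv_re, Sm.mfderiv_im]
  apply Complex.ext <;> simp

/-- Hamiltonian vectors are compatible with pull-back along maps with bijective differential. -/
theorem mfderiv_hamVec_pullback {Ω : TwoForm m N} {φ : M → N} {x : M}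
    (h : Ω.SymplecticAt (φ x))
    (hs : Function.Surjective (mfderiv (𝓡 n) (𝓡 m) φ x))
    (h' : (Ω.pullback φ : TwoForm n M).SymplecticAt x) (f : M → ℝ) (F : N → ℝ)
    (hf : ∀ w, mfderiv (𝓡 n) 𝓘(ℝ, ℝ) f x w
      = mfderiv (𝓡 m) 𝓘(ℝ, ℝ) F (φ x) (mfderiv (𝓡 n) (𝓡 m) φ x w)) :
    mfderiv (𝓡 n) (𝓡 m) φ x (hamVec (Ω.pullback φ) f x) = hamVec Ω F (φ x) := by
  apply h.eq_hamVec
  intro w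
  obtain ⟨w, rfl⟩ := hs w
  rw [← hf, ← h'.hamVec_spec]
  rfl

theorem symplecticAt_pullback {Ω : TwoForm m N} {φ : M → N} {x : M}
    (h : Ω.SymplecticAt (φ x)) (hb : Function.Bijective (mfderiv (𝓡 n) (𝓡 m) φ x)) :
    (Ω.pullback φ : TwoForm n M).SymplecticAt x := by
  refine ⟨fun v => h.alternating _, fun v hv => ?_⟩
  have : mfderiv (𝓡 n) (𝓡 m) φ x v = 0 := by
    apply h.nondegenerate
    intro w
    obtain ⟨w, rfl⟩ := hb.2 w
    exact hv w
  exact hb.1 (this.trans (map_zero _).symm)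

theorem poisson_pullback {Ω : TwoForm m N} {φ : M → N} {x : M}
    (h : Ω.SymplecticAt (φ x)) (hb : Function.Bijective (mfderiv (𝓡 n) (𝓡 m) φ x))
    (f g : Sm n M) (F G : Sm m N)
    (hf : ∀ w, Sm.d f x w = Sm.d F (φ x) (mfderiv (𝓡 n) (𝓡 m) φ x w))
    (hg : ∀ w, Sm.d g x w = Sm.d G (φ x) (mfderiv (𝓡 n) (𝓡 m) φ x w)) :
    poisson (Ω.pullback φ : TwoForm n M) f.1 g.1 x = poisson Ω F.1 G.1 (φ x) := by
  have h' := symplecticAt_pullback h hb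
  rw [poisson_eq h', poisson_eq h, hg, hg,
    mfderiv_hamVec_pullback h hb.2 h' _ (fun y => (F.1 y).re),
    mfderiv_hamVec_pullback h hb.2 h' _ (fun y => (F.1 y).im)]
  · intro w
    rw [Sm.mfderiv_im, Sm.mfderiv_im, hf]
  · intro w
    rw [Sm.mfderiv_re, Sm.mfderiv_re, hf]

end Poisson

/-! ### Passage to open subsets -/

section Restriction

variable {n : ℕ} {M : Type*} [TopologicalSpace M] [ChartedSpace (E n) M] {U : Opens M}

theorem Sm.d_restrict {x : U} {f : Sm n U} {F : Sm n M} (h : ∀ᶠ y : U in 𝓝 x, F.1 y = f.1 y)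
    (v : TangentSpace (𝓡 n) x) :
    Sm.d f x v = Sm.d F x (mfderiv (𝓡 n) (𝓡 n) (Subtype.val : U → M) x v) := by
  rw [← Sm.d_pullback (Subtype.val : U → M) contMDiff_subtype_val]
  rw [Sm.d_congr]
  filter_upwards [h] with y hy using hy.symm

variable [T2Space M] [IsManifold (𝓡 n) ∞ M]

theorem Sm.exists_extension (x : U) (f : Sm n U) :
    ∃ F : Sm n M, ∀ᶠ y : U in 𝓝 x, F.1 y = f.1 y := by
  classical
  let g : M → ℂ := fun y => if h : y ∈ U then f.1 ⟨y, h⟩ else 0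
  have hg : (fun y : U => g y) = f.1 := funext fun y => by simp [g, y.2]
  obtain ⟨F, hF⟩ := Sm.exists_germ (n := n) g x (by
    filter_upwards [U.2.mem_nhds x.2] with y hy
    have : ContMDiffAt (𝓡 n) 𝓘(ℝ, ℂ) ∞ (fun y : U => g y) ⟨y, hy⟩ := by
      rw [hg]
      exact Sm.contMDiff f _
    exact contMDiffAt_subtype_iff.1 this)
  refine ⟨F, ?_⟩
  filter_upwards [continuous_subtype_val.continuousAt.eventually hF] with y hy
  rw [hy, ← hg]

/-- Every function on `U` has locally an extension to `M`, so a vector killed by the differential of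
the inclusion is killed by all functions on `U`. Equality of dimensions gives surjectivity. -/
theorem bijective_mfderiv_val (x : U) :
    Function.Bijective (mfderiv (𝓡 n) (𝓡 n) (Subtype.val : U → M) x) := by
  have hinj : Function.Injective (mfderiv (𝓡 n) (𝓡 n) (Subtype.val : U → M) x) := by
    rw [injective_iff_map_eq_zero]
    intro v hv
    apply Sm.eq_zero_of_d
    intro f
    obtain ⟨F, hF⟩ := Sm.exists_extension x f
    rw [Sm.d_restrict hF, hv, map_zero]
  exact ⟨hinj, (LinearMap.injective_iff_surjective_of_finrank_eq_finrank
    (f := (mfderiv (𝓡 n) (𝓡 n) (Subtype.val : U → M) x).toLinearMap)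
    ((finrank_tangentSpace x).trans (finrank_tangentSpace x.1).symm)).1 hinj⟩

end Restriction

section FormOn

variable {n : ℕ} {P : Type*} [TopologicalSpace P] [ChartedSpace (E (n + 2)) P] [T2Space P]
  [IsManifold (𝓡 (n + 2)) ∞ P] {Ω : TwoForm (n + 2) P}

theorem symplecticAt_formOn (hΩ : Ω.IsSymplectic) (U : Opens P) (x : U) :
    (formOn Ω U).SymplecticAt x :=
  symplecticAt_pullback (hΩ.symplecticAt _) (bijective_mfderiv_val x)

theorem poisson_formOn (hΩ : Ω.IsSymplectic) (U : Opens P) (x : U) {f g : Sm (n + 2) U}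
    {F G : Sm (n + 2) P} (hf : ∀ᶠ y : U in 𝓝 x, F.1 y = f.1 y)
    (hg : ∀ᶠ y : U in 𝓝 x, G.1 y = g.1 y) :
    poisson (formOn Ω U) f.1 g.1 x = poisson Ω F.1 G.1 x :=
  poisson_pullback (hΩ.symplecticAt _) (bijective_mfderiv_val x) f g F G
    (Sm.d_restrict hf) (Sm.d_restrict hg)

end FormOn

end StarReduction

/-! ### Locality and restriction of star products -/

namespace StarReduction

theorem tsupport_subset_of_eventually {X : Type*} [TopologicalSpace X] {f h : X → ℂ}
    (H : ∀ x, (∀ᶠ y in 𝓝 x, f y = 0) → h x = 0) : tsupport h ⊆ tsupport f :=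
  closure_minimal (fun x hx => by
    by_contra hn
    exact hx (H x (notMem_tsupport_iff_eventuallyEq.1 hn))) (isClosed_tsupport f)

section StarProducts

variable {n : ℕ} {M : Type*} [TopologicalSpace M] [ChartedSpace (E n) M]
  {Ω : TwoForm n M} {B : ℕ → Sm n M → Sm n M → Sm n M}

namespace IsStarProduct

/-- The operators of a star product as bilinear maps. -/
def lin (h : IsStarProduct Ω B) (k : ℕ) : Sm n M →ₗ[ℂ] Sm n M →ₗ[ℂ] Sm n M :=
  LinearMap.mk₂ ℂ (B k) (h.add_left k) (h.smul_left k) (h.add_right k) (h.smul_right k)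

/-- The underlying formal star product. -/
def formalStar (h : IsStarProduct Ω B) : FormalStar (Sm n M) where
  M := h.lin
  assoc := h.assoc
  zeroth := h.zeroth
  one_star := h.one_star
  star_one := h.star_one

theorem zero_left (h : IsStarProduct Ω B) (k : ℕ) (g : Sm n M) : B k 0 g = 0 := by
  exact congrArg (fun L : Sm n M →ₗ[ℂ] Sm n M => L g) (map_zero (h.lin k))

theorem zero_right (h : IsStarProduct Ω B) (k : ℕ) (f : Sm n M) : B k f 0 = 0 := by
  exact map_zero (h.lin k f)

theorem eq_zero_of_left (h : IsStarProduct Ω B) (k : ℕ) {f : Sm n M} (g : Sm n M) {x : M}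
    (hf : ∀ᶠ y in 𝓝 x, f.1 y = 0) : (B k f g).1 x = 0 := by
  have hx : x ∉ tsupport f.1 := notMem_tsupport_iff_eventuallyEq.2 hf
  exact image_eq_zero_of_notMem_tsupport fun hx' => hx (h.supp k f g hx').1

theorem eq_zero_of_right (h : IsStarProduct Ω B) (k : ℕ) (f : Sm n M) {g : Sm n M} {x : M}
    (hg : ∀ᶠ y in 𝓝 x, g.1 y = 0) : (B k f g).1 x = 0 := by
  have hx : x ∉ tsupport g.1 := notMem_tsupport_iff_eventuallyEq.2 hg
  exact image_eq_zero_of_notMem_tsupport fun hx' => hx (h.supp k f g hx').2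

/-- Bilinearity writes the difference as two terms with an argument vanishing near `x`; the support
condition kills both. -/
theorem congr_germ (h : IsStarProduct Ω B) (k : ℕ) {f f' g g' : Sm n M} {x : M}
    (hf : ∀ᶠ y in 𝓝 x, f.1 y = f'.1 y) (hg : ∀ᶠ y in 𝓝 x, g.1 y = g'.1 y) :
    (B k f g).1 x = (B k f' g').1 x := by
  have h1 : B k f g = B k f' g' + (h.lin k (f - f') g + h.lin k f' (g - g')) := by
    rw [map_sub, map_sub, LinearMap.sub_apply]
    change h.lin k f g = h.lin k f' g' + _
    abel
  have h2 : (h.lin k (f - f') g).1 x = 0 := h.eq_zero_of_left k g (by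
    filter_upwards [hf] with y hy
    change f.1 y - f'.1 y = 0
    rw [hy, sub_self])
  have h3 : (h.lin k f' (g - g')).1 x = 0 := h.eq_zero_of_right k f' (by
    filter_upwards [hg] with y hy
    change g.1 y - g'.1 y = 0
    rw [hy, sub_self])
  rw [h1]
  change (B k f' g').1 x + ((h.lin k (f - f') g).1 x + (h.lin k f' (g - g')).1 x) = _
  rw [h2, h3, add_zero, add_zero]

end IsStarProduct

end StarProducts

section RestrictStar

variable {n : ℕ} {P : Type*} [TopologicalSpace P] [ChartedSpace (E n) P]
  {Ω : TwoForm n P} {B : ℕ → Sm n P → Sm n P → Sm n P} {U : Opens P}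

theorem eventually_val {x : U} {f : Sm n P} {F : Sm n P}
    (h : ∀ᶠ y : U in 𝓝 x, F.1 y = f.1 y) : ∀ᶠ y in 𝓝 (x : P), F.1 y = f.1 y := by
  rw [← U.2.isOpenEmbedding_subtypeVal.map_nhds_eq x]
  exact h

/-- `F` extends `f` from a neighbourhood of `x`. -/
def SameGerm (x : U) (f : Sm n U) (F : Sm n P) : Prop := ∀ᶠ y : U in 𝓝 x, F.1 y = f.1 y

theorem SameGerm.sum {x : U} {ι : Type*} {s : Finset ι} {f : ι → Sm n U} {F : ι → Sm n P}
    (h : ∀ i ∈ s, SameGerm x (f i) (F i)) : SameGerm x (∑ i ∈ s, f i) (∑ i ∈ s, F i) := by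
  classical
  induction s using Finset.induction_on with
  | empty => exact Filter.Eventually.of_forall fun y => rfl
  | insert a s ha ih =>
    rw [Finset.sum_insert ha, Finset.sum_insert ha]
    filter_upwards [h a (Finset.mem_insert_self a s),
      ih fun i hi => h i (Finset.mem_insert_of_mem hi)] with y h1 h2
    change (F a).1 y + (∑ i ∈ s, F i).1 y = (f a).1 y + (∑ i ∈ s, f i).1 y
    rw [h1, h2]

theorem SameGerm.eq {x : U} {f g : Sm n U} {F : Sm n P} (hf : SameGerm x f F)
    (hg : SameGerm x g F) : f.1 x = g.1 x := hf.self_of_nhds.symm.trans hg.self_of_nhds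

theorem series_ext {f g : (Sm n U)⟦X⟧}
    (h : ∀ k (x : U), (PowerSeries.coeff k f).1 x = (PowerSeries.coeff k g).1 x) : f = g := by
  ext k
  exact h k _

theorem sameGerm_one (x : U) (k : ℕ) : SameGerm x (PowerSeries.coeff k (1 : (Sm n U)⟦X⟧))
    (PowerSeries.coeff k (1 : (Sm n P)⟦X⟧)) := by
  rw [PowerSeries.coeff_one, PowerSeries.coeff_one]
  split_ifs <;> exact Filter.Eventually.of_forall fun y => rfl

variable [T2Space P] [IsManifold (𝓡 n) ∞ P]

theorem isRestriction_restrictOp (h : IsStarProduct Ω B) (k : ℕ) (f g : Sm n U) :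
    IsRestriction (B k) U f g (restrictOp (B k) U f g) := by
  apply Classical.epsilon_spec (p := IsRestriction (B k) U f g)
  choose F hF using fun x : U => Sm.exists_extension x f
  choose G hG using fun x : U => Sm.exists_extension x g
  have key : ∀ (x : U) (F' G' : Sm n P), (∀ᶠ y : U in 𝓝 x, F'.1 y = f.1 y) →
      (∀ᶠ y : U in 𝓝 x, G'.1 y = g.1 y) →
      (B k (F x) (G x)).1 x = (B k F' G').1 x := by
    intro x F' G' h1 h2
    apply h.congr_germ k
    · apply eventually_val
      filter_upwards [hF x, h1] with y a b using a.trans b.symm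
    · apply eventually_val
      filter_upwards [hG x, h2] with y a b using a.trans b.symm
  refine ⟨⟨fun x => (B k (F x) (G x)).1 x, fun x => ?_⟩, key⟩
  have : ContMDiffAt (𝓡 n) 𝓘(ℝ, ℂ) ∞ (fun y : U => (B k (F x) (G x)).1 y) x :=
    contMDiffAt_subtype_iff.2 (Sm.contMDiff (B k (F x) (G x)) _)
  refine this.congr_of_eventuallyEq ?_
  filter_upwards [(hF x).eventually_nhds, (hG x).eventually_nhds] with y h1 h2
  -- The extensions vary with the point without any coherence, but near `x` the fixed pair chosen at
  -- `x` yields the same values, whence smoothness.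
  exact key y _ _ h1 h2

theorem SameGerm.restrictOp (h : IsStarProduct Ω B) (k : ℕ) {x : U} {f g : Sm n U}
    {F G : Sm n P} (hf : SameGerm x f F) (hg : SameGerm x g G) :
    SameGerm x (restrictOp (B k) U f g) (B k F G) := by
  filter_upwards [hf.eventually_nhds, hg.eventually_nhds] with y h1 h2
  exact (isRestriction_restrictOp h k f g y F G h1 h2).symm

theorem SameGerm.star (h : IsStarProduct Ω B) {x : U} {f g : (Sm n U)⟦X⟧} {F G : (Sm n P)⟦X⟧}
    (hf : ∀ k, SameGerm x (PowerSeries.coeff k f) (PowerSeries.coeff k F))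
    (hg : ∀ k, SameGerm x (PowerSeries.coeff k g) (PowerSeries.coeff k G)) (k : ℕ) :
    SameGerm x (PowerSeries.coeff k (star (fun k => StarReduction.restrictOp (B k) U) f g))
      (PowerSeries.coeff k (StarReduction.star B F G)) := by
  simp only [StarReduction.star, PowerSeries.coeff_mk]
  exact SameGerm.sum fun i _ => SameGerm.sum fun j _ => SameGerm.restrictOp h _ (hf _) (hg _)

/-- The neighbourhood of agreement may shrink with `k`; this is harmless because a coefficient of a
star product involves only finitely many coefficients of its factors. -/
theorem exists_sameGerm (x : U) (f : (Sm n U)⟦X⟧) : ∃ F : (Sm n P)⟦X⟧,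
    ∀ k, SameGerm x (PowerSeries.coeff k f) (PowerSeries.coeff k F) := by
  choose F hF using fun k => Sm.exists_extension x (PowerSeries.coeff k f)
  exact ⟨PowerSeries.mk F, fun k => by rw [PowerSeries.coeff_mk]; exact hF k⟩

end RestrictStar

section RestrictSymplectic

variable {n : ℕ} {P : Type*} [TopologicalSpace P] [ChartedSpace (E (n + 2)) P]
  [T2Space P] [IsManifold (𝓡 (n + 2)) ∞ P] {Ω : TwoForm (n + 2) P}
  {B : ℕ → Sm (n + 2) P → Sm (n + 2) P → Sm (n + 2) P}

/-- The operators induced by a star product on an open subset form a star product. -/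
theorem IsStarProduct.restrict (h : IsStarProduct Ω B) (hΩ : Ω.IsSymplectic) (U : Opens P) :
    IsStarProduct (formOn Ω U) (fun k => restrictOp (B k) U) where
  add_left k f f' g := by
    refine Sm.ext fun x => ?_
    obtain ⟨F, hF⟩ := Sm.exists_extension x f
    obtain ⟨F', hF'⟩ := Sm.exists_extension x f'
    obtain ⟨G, hG⟩ := Sm.exists_extension x g
    rw [isRestriction_restrictOp h k (f + f') g x (F + F') G
      (by filter_upwards [hF, hF'] with y h1 h2; exact congrArg₂ (· + ·) h1 h2) hG, h.add_left]
    exact (congrArg₂ (· + ·) (isRestriction_restrictOp h k f g x F G hF hG)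
      (isRestriction_restrictOp h k f' g x F' G hF' hG)).symm
  smul_left k a f g := by
    refine Sm.ext fun x => ?_
    obtain ⟨F, hF⟩ := Sm.exists_extension x f
    obtain ⟨G, hG⟩ := Sm.exists_extension x g
    rw [isRestriction_restrictOp h k (a • f) g x (a • F) G
      (by filter_upwards [hF] with y h1; exact congrArg (a • ·) h1) hG, h.smul_left]
    exact (congrArg (a • ·) (isRestriction_restrictOp h k f g x F G hF hG)).symm
  add_right k f g g' := by
    refine Sm.ext fun x => ?_
    obtain ⟨F, hF⟩ := Sm.exists_extension x f
    obtain ⟨G, hG⟩ := Sm.exists_extension x g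
    obtain ⟨G', hG'⟩ := Sm.exists_extension x g'
    rw [isRestriction_restrictOp h k f (g + g') x F (G + G') hF
      (by filter_upwards [hG, hG'] with y h1 h2; exact congrArg₂ (· + ·) h1 h2), h.add_right]
    exact (congrArg₂ (· + ·) (isRestriction_restrictOp h k f g x F G hF hG)
      (isRestriction_restrictOp h k f g' x F G' hF hG')).symm
  smul_right k a f g := by
    refine Sm.ext fun x => ?_
    obtain ⟨F, hF⟩ := Sm.exists_extension x f
    obtain ⟨G, hG⟩ := Sm.exists_extension x g
    rw [isRestriction_restrictOp h k f (a • g) x F (a • G) hF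
      (by filter_upwards [hG] with y h1; exact congrArg (a • ·) h1), h.smul_right]
    exact (congrArg (a • ·) (isRestriction_restrictOp h k f g x F G hF hG)).symm
  assoc f g e := by
    refine series_ext fun k x => ?_
    obtain ⟨F, hF⟩ := exists_sameGerm x f
    obtain ⟨G, hG⟩ := exists_sameGerm x g
    obtain ⟨H, hH⟩ := exists_sameGerm x e
    have h1 := SameGerm.star h (SameGerm.star h hF hG) hH k
    have h2 := SameGerm.star h hF (SameGerm.star h hG hH) k
    rw [← h.assoc] at h2
    exact h1.eq h2
  zeroth f g := by
    refine Sm.ext fun x => ?_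
    obtain ⟨F, hF⟩ := Sm.exists_extension x f
    obtain ⟨G, hG⟩ := Sm.exists_extension x g
    rw [isRestriction_restrictOp h 0 f g x F G hF hG, h.zeroth]
    exact congrArg₂ (· * ·) hF.self_of_nhds hG.self_of_nhds
  first f g x := by
    obtain ⟨F, hF⟩ := Sm.exists_extension x f
    obtain ⟨G, hG⟩ := Sm.exists_extension x g
    rw [isRestriction_restrictOp h 1 f g x F G hF hG, isRestriction_restrictOp h 1 g f x G F hG hF,
      h.first, poisson_formOn hΩ U x hF hG]
  one_star f := by
    refine series_ext fun k x => ?_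
    obtain ⟨F, hF⟩ := exists_sameGerm x f
    have h1 := SameGerm.star h (sameGerm_one x) hF k
    rw [h.one_star] at h1
    exact h1.eq (hF k)
  star_one f := by
    refine series_ext fun k x => ?_
    obtain ⟨F, hF⟩ := exists_sameGerm x f
    have h1 := SameGerm.star h hF (sameGerm_one x) k
    rw [h.star_one] at h1
    exact h1.eq (hF k)
  supp k f g := by
    apply Set.subset_inter
    · refine tsupport_subset_of_eventually fun x hx => ?_
      obtain ⟨G, hG⟩ := Sm.exists_extension x g
      rw [isRestriction_restrictOp h k f g x 0 G (hx.mono fun y hy => hy.symm) hG, h.zero_left]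
      rfl
    · refine tsupport_subset_of_eventually fun x hx => ?_
      obtain ⟨F, hF⟩ := Sm.exists_extension x f
      rw [isRestriction_restrictOp h k f g x F 0 hF (hx.mono fun y hy => hy.symm), h.zero_right]
      rfl

end RestrictSymplectic

end StarReduction

/-! ### Calculus: local inverses, parameter integrals, Hadamard's lemma -/

namespace StarReduction

section Calculus

variable {X : Type*} [NormedAddCommGroup X] [NormedSpace ℝ X]
  {Y : Type*} [NormedAddCommGroup Y] [NormedSpace ℝ Y]

/-- The inverse function theorem for smooth maps on open sets. -/
theorem exists_local_inverse [CompleteSpace X] {f : X → Y} {W : Set X} (hW : IsOpen W) {a : X}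
    (ha : a ∈ W) (hf : ContDiffOn ℝ ∞ f W) {L : X ≃L[ℝ] Y}
    (hL : HasFDerivAt f (L : X →L[ℝ] Y) a) :
    ∃ (V : Set Y) (g : Y → X), IsOpen V ∧ f a ∈ V ∧ ContDiffOn ℝ ∞ g V ∧ g (f a) = a ∧
      ∀ y ∈ V, g y ∈ W ∧ f (g y) = y := by
  have hfa : ContDiffAt ℝ ∞ f a := (hf a ha).contDiffAt (hW.mem_nhds ha)
  set e := hfa.toOpenPartialHomeomorph f hL (by simp)
  have he : ∀ x, e x = f x := fun x => rfl
  have hae : a ∈ e.source := hfa.mem_toOpenPartialHomeomorph_source hL (by simp)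
  have hfe : f a ∈ e.target := hfa.image_mem_toOpenPartialHomeomorph_target hL (by simp)
  have hinv : e.symm (f a) = a := e.left_inv hae
  -- Invertible operators form an open set, so the differential stays invertible near `a`; this
  -- makes the inverse smooth on a whole neighbourhood.
  have h1 : ∀ᶠ x in 𝓝 a, x ∈ W ∧ fderiv ℝ f x ∈ Set.range ((↑) : (X ≃L[ℝ] Y) → X →L[ℝ] Y) := by
    refine Filter.Eventually.and (show ∀ᶠ x in 𝓝 a, x ∈ W from hW.mem_nhds ha) ?_
    have hc : ContinuousAt (fderiv ℝ f) a :=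
      (hfa.fderiv_right (m := 0) (by simp)).continuousAt
    refine hc.eventually (ContinuousLinearEquiv.isOpen.mem_nhds ?_)
    rw [hL.fderiv]
    exact ⟨L, rfl⟩
  have hc : ContinuousAt e.symm (f a) := e.continuousAt_symm hfe
  have h2 := (hc.eventually (hinv.symm ▸ h1)).and
    (show ∀ᶠ y in 𝓝 (f a), y ∈ e.target from e.open_target.mem_nhds hfe)
  obtain ⟨V, hV, hVo, haV⟩ := mem_nhds_iff.1 h2
  refine ⟨V, e.symm, hVo, haV, fun y hy => ?_, hinv, fun y hy => ⟨(hV hy).1.1, ?_⟩⟩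
  · obtain ⟨⟨hyW, L', hL'⟩, hyt⟩ := hV hy
    have hfy : ContDiffAt ℝ ∞ f (e.symm y) := (hf _ hyW).contDiffAt (hW.mem_nhds hyW)
    refine (e.contDiffAt_symm (f₀' := L') hyt ?_ hfy).contDiffWithinAt
    rw [hL']
    exact (hfy.differentiableAt (by simp)).hasFDerivAt
  · exact e.right_inv (hV hy).2

variable {F : Type*} [NormedAddCommGroup F] [NormedSpace ℝ F]

open MeasureTheory in
/-- Integrals over the unit interval depend smoothly on parameters. -/
theorem contDiffOn_parametric_integral {f : X × ℝ → F} {x₀ : X} {W : Set (X × ℝ)}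
    (hW : IsOpen W) (h0 : ∀ r ∈ Set.Icc (0 : ℝ) 1, (x₀, r) ∈ W) (hf : ContDiffOn ℝ ∞ f W) :
    ∃ u : Set X, IsOpen u ∧ x₀ ∈ u ∧ (∀ x ∈ u, ∀ r ∈ Set.Icc (0 : ℝ) 1, (x, r) ∈ W) ∧
      ContDiffOn ℝ ∞ (fun x => ∫ r in (0 : ℝ)..1, f (x, r)) u := by
  obtain ⟨u, v, hu, hv, hxu, hIv, huv⟩ := generalized_tube_lemma (isCompact_singleton (x := x₀))
    (isCompact_Icc (a := (0 : ℝ)) (b := 1)) hW (by rintro ⟨x, r⟩ ⟨rfl, hr⟩; exact h0 r hr)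
  obtain ⟨δ, hδ, hδv⟩ := (isCompact_Icc (a := (0 : ℝ)) (b := 1)).exists_cthickening_subset_open
    hv hIv
  -- The bump function is one on the unit interval and supported in its `δ`-thickening, so the
  -- integrand extends by zero to the whole line.
  let b : ContDiffBump (1 / 2 : ℝ) := ⟨1 / 2, 1 / 2 + δ, by norm_num, by linarith⟩
  have hb1 : ∀ r ∈ Set.Icc (0 : ℝ) 1, b r = 1 := fun r hr => b.one_of_mem_closedBall (by
    rw [Metric.mem_closedBall, Real.dist_eq, abs_le]
    constructor <;> [linarith [hr.1]; linarith [hr.2]])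
  have hbv : tsupport b ⊆ v := by
    rw [b.tsupport_eq]
    refine fun r hr => hδv ?_
    have hr' : |r - 1 / 2| ≤ 1 / 2 + δ := by
      rwa [Metric.mem_closedBall, Real.dist_eq] at hr
    rw [abs_le] at hr'
    rcases le_total r 0 with h | h
    · refine Metric.mem_cthickening_of_dist_le r 0 δ _ (by simp) ?_
      rw [Real.dist_eq, abs_le]
      constructor <;> linarith
    · rcases le_total r 1 with h' | h'
      · exact Metric.self_subset_cthickening _ ⟨h, h'⟩
      · refine Metric.mem_cthickening_of_dist_le r 1 δ _ (by simp) ?_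
        rw [Real.dist_eq, abs_le]
        constructor <;> linarith
  refine ⟨u, hu, hxu rfl, fun x hx r hr => huv ⟨hx, hIv hr⟩, ?_⟩
  let g : X → ℝ → F := fun x y => b (-y) • f (x, -y)
  have hg : ContDiffOn ℝ ∞ (Function.uncurry g) (u ×ˢ Set.univ) := by
    rintro ⟨x, y⟩ ⟨hx, -⟩
    apply ContDiffAt.contDiffWithinAt
    by_cases hy : -y ∈ tsupport b
    · have hm : (x, -y) ∈ W := huv ⟨hx, hbv hy⟩
      have h1 : ContDiffAt ℝ ∞ f (x, -y) := (hf _ hm).contDiffAt (hW.mem_nhds hm)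
      have h2 : ContDiffAt ℝ ∞ (fun q : X × ℝ => (q.1, -q.2)) (x, y) := by fun_prop
      have h3 : ContDiffAt ℝ ∞ (fun q : X × ℝ => b (-q.2)) (x, y) :=
        b.contDiff.contDiffAt.comp (x, y) (by fun_prop)
      exact h3.smul (ContDiffAt.comp (x, y) (g := f) h1 h2)
    · have h1 : ∀ᶠ q : X × ℝ in 𝓝 (x, y), Function.uncurry g q = 0 := by
        have h2 : Filter.Tendsto (fun q : X × ℝ => -q.2) (𝓝 (x, y)) (𝓝 (-y)) :=
          (by fun_prop : Continuous fun q : X × ℝ => -q.2).tendsto (x, y)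
        filter_upwards [h2.eventually (notMem_tsupport_iff_eventuallyEq.1 hy)] with q hq
        change b (-q.2) • f (q.1, -q.2) = 0
        rw [hq]
        simp
      exact (contDiffAt_const (c := (0 : F))).congr_of_eventuallyEq h1
  -- The integral is the value at `0` of the convolution of the indicator function of `(0, 1]` with
  -- `g x`, which explains the reflected argument in `g`.
  have hconv := contDiffOn_convolution_right_with_param_comp (𝕜 := ℝ) (μ := volume) (n := ⊤)
    (ContinuousLinearMap.lsmul ℝ ℝ) (s := u) (v := fun _ => (0 : ℝ)) contDiffOn_const
    (f := Set.indicator (Set.Ioc (0 : ℝ) 1) (fun _ => (1 : ℝ))) (g := g)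
    (k := Neg.neg '' tsupport b) hu (b.hasCompactSupport.isCompact.image continuous_neg) ?_ ?_ hg
  · refine hconv.congr fun x hx => ?_
    rw [convolution_def, intervalIntegral.integral_of_le zero_le_one,
      ← integral_indicator measurableSet_Ioc]
    congr 1
    ext r
    by_cases hr : r ∈ Set.Ioc (0 : ℝ) 1
    · simp [g, hr, hb1 r ⟨hr.1.le, hr.2⟩]
    · simp [hr]
  · intro p x _ hx
    have : -x ∉ tsupport b := fun h => hx ⟨-x, h, neg_neg x⟩
    simp [g, image_eq_zero_of_notMem_tsupport this]
  · exact ((integrable_indicator_iff measurableSet_Ioc).2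
      (integrableOn_const (by simp))).locallyIntegrable

/-- A smooth function that vanishes on a regular hypersurface `j = 0` is locally divisible
by `j`. -/
theorem exists_smooth_quotient [CompleteSpace X] {g : X → ℂ} {j : X → ℝ} {W : Set X}
    (hW : IsOpen W) {a : X} (ha : a ∈ W) (hg : ContDiffOn ℝ ∞ g W) (hj : ContDiffOn ℝ ∞ j W)
    (hja : j a = 0) (hdj : fderiv ℝ j a ≠ 0) (h : ∀ y ∈ W, j y = 0 → g y = 0) :
    ∃ (q : X → ℂ) (V : Set X), IsOpen V ∧ a ∈ V ∧ ContDiffOn ℝ ∞ q V ∧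
      ∀ y ∈ V, g y = q y * j y := by
  obtain ⟨v, hv⟩ : ∃ v, fderiv ℝ j a v = 1 := by
    obtain ⟨w, hw⟩ : ∃ w, fderiv ℝ j a w ≠ 0 := by
      by_contra! hcon
      exact hdj (ContinuousLinearMap.ext hcon)
    exact ⟨(fderiv ℝ j a w)⁻¹ • w, by simp [hw]⟩
  -- The local inverse of `θ` at `(y, 0)` finds the time `τ y` at which the line through `y` in the
  -- transversal direction `v` meets the hypersurface.
  let θ : X × ℝ → X × ℝ := fun z => (z.1, j (z.1 + z.2 • v))
  let W' : Set (X × ℝ) := {z | z.1 + z.2 • v ∈ W}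
  have hW' : IsOpen W' := hW.preimage (by fun_prop)
  have haW' : (a, (0 : ℝ)) ∈ W' := by simpa [W'] using ha
  have hθ : ContDiffOn ℝ ∞ θ W' :=
    contDiff_fst.contDiffOn.prodMk (hj.comp (by fun_prop) fun z hz => hz)
  let L : (X × ℝ) ≃L[ℝ] (X × ℝ) := ContinuousLinearEquiv.equivOfInverse
    ((ContinuousLinearMap.fst ℝ X ℝ).prod
      ((fderiv ℝ j a).comp (ContinuousLinearMap.fst ℝ X ℝ) + ContinuousLinearMap.snd ℝ X ℝ))
    ((ContinuousLinearMap.fst ℝ X ℝ).prod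
      (ContinuousLinearMap.snd ℝ X ℝ - (fderiv ℝ j a).comp (ContinuousLinearMap.fst ℝ X ℝ)))
    (fun z => by ext <;> simp) (fun z => by ext <;> simp)
  have hdja : HasFDerivAt j (fderiv ℝ j a) a :=
    (((hj a ha).contDiffAt (hW.mem_nhds ha)).differentiableAt (by simp)).hasFDerivAt
  have hL : HasFDerivAt θ (L : (X × ℝ) →L[ℝ] (X × ℝ)) (a, 0) := by
    have h1 : HasFDerivAt (fun z : X × ℝ => z.1 + z.2 • v)
        (ContinuousLinearMap.fst ℝ X ℝ + (ContinuousLinearMap.snd ℝ X ℝ).smulRight v) (a, 0) :=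
      hasFDerivAt_fst.add (hasFDerivAt_snd.smul_const v)
    have h2 : HasFDerivAt j (fderiv ℝ j a) ((a, (0 : ℝ)).1 + (a, (0 : ℝ)).2 • v) := by
      simpa using hdja
    refine (hasFDerivAt_fst.prodMk (h2.comp (a, (0 : ℝ)) h1)).congr_fderiv ?_
    ext z <;> simp [L, hv]
  obtain ⟨V, σ, hV, haV, hσ, hσa, hσV⟩ := exists_local_inverse hW' haW' hθ hL
  have hθa : θ (a, 0) = (a, 0) := by simp [θ, hja]
  rw [hθa] at haV hσa
  let τ : X → ℝ := fun y => (σ (y, 0)).2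
  let V₁ : Set X := {y | (y, (0 : ℝ)) ∈ V}
  have hV₁ : IsOpen V₁ := hV.preimage (by fun_prop)
  have hτ : ContDiffOn ℝ ∞ τ V₁ :=
    contDiff_snd.comp_contDiffOn (hσ.comp (by fun_prop) fun y hy => hy)
  have hτa : τ a = 0 := by simp [τ, hσa]
  have hτ0 : ∀ y ∈ V₁, y + τ y • v ∈ W ∧ j (y + τ y • v) = 0 := by
    intro y hy
    obtain ⟨h1, h2⟩ := hσV _ hy
    have h3 : (σ (y, 0)).1 = y := congrArg Prod.fst h2
    have h4 : j ((σ (y, 0)).1 + (σ (y, 0)).2 • v) = 0 := congrArg Prod.snd h2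
    have h5 : (σ (y, 0)).1 + (σ (y, 0)).2 • v ∈ W := h1
    rw [h3] at h4 h5
    exact ⟨h5, h4⟩
  let W₂ : Set (X × ℝ) := (V₁ ×ˢ Set.univ) ∩ (fun z => z.1 + (z.2 * τ z.1) • v) ⁻¹' W
  have hc₂ : ContDiffOn ℝ ∞ (fun z : X × ℝ => z.1 + (z.2 * τ z.1) • v) (V₁ ×ˢ Set.univ) := by
    have : ContDiffOn ℝ ∞ (fun z : X × ℝ => τ z.1) (V₁ ×ˢ Set.univ) :=
      hτ.comp contDiff_fst.contDiffOn fun z hz => hz.1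
    exact contDiff_fst.contDiffOn.add ((contDiff_snd.contDiffOn.mul this).smul contDiffOn_const)
  have hW₂ : IsOpen W₂ := hc₂.continuousOn.isOpen_inter_preimage (hV₁.prod isOpen_univ) hW
  have haW₂ : ∀ r ∈ Set.Icc (0 : ℝ) 1, (a, r) ∈ W₂ := fun r _ => by
    refine ⟨⟨haV, trivial⟩, ?_⟩
    simpa [hτa] using ha
  have hd : ∀ {F : Type} [NormedAddCommGroup F] [NormedSpace ℝ F] {f : X → F},
      ContDiffOn ℝ ∞ f W →
      ContDiffOn ℝ ∞ (fun z : X × ℝ => fderiv ℝ f (z.1 + (z.2 * τ z.1) • v) v) W₂ := by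
    intro F _ _ f hf
    have h1 : ContDiffOn ℝ ∞ (fun y => fderiv ℝ f y v) W :=
      (hf.fderiv_of_isOpen hW (by simp)).clm_apply contDiffOn_const
    exact h1.comp (hc₂.mono Set.inter_subset_left) fun z hz => hz.2
  obtain ⟨u₁, hu₁, hau₁, hsub₁, hG⟩ := contDiffOn_parametric_integral hW₂ haW₂ (hd hg)
  obtain ⟨u₂, hu₂, hau₂, -, hJ⟩ := contDiffOn_parametric_integral hW₂ haW₂ (hd hj)
  -- The fundamental theorem of calculus on the segment from `y` to its projection onto the
  -- hypersurface.
  have hmean : ∀ {F : Type} [NormedAddCommGroup F] [NormedSpace ℝ F] [CompleteSpace F] {f : X → F},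
      ContDiffOn ℝ ∞ f W → ∀ y ∈ u₁, f (y + τ y • v) - f y
        = τ y • ∫ r in (0 : ℝ)..1, fderiv ℝ f (y + (r * τ y) • v) v := by
    intro F _ _ _ f hf y hy
    rw [← intervalIntegral.integral_smul]
    have hmem : ∀ r ∈ Set.uIcc (0 : ℝ) 1, y + (r * τ y) • v ∈ W := by
      rw [Set.uIcc_of_le zero_le_one]
      exact fun r hr => (hsub₁ y hy r hr).2
    have hderiv : ∀ r ∈ Set.uIcc (0 : ℝ) 1, HasDerivAt (fun r => f (y + (r * τ y) • v))
        (τ y • fderiv ℝ f (y + (r * τ y) • v) v) r := by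
      intro r hr
      have h1 : HasFDerivAt f (fderiv ℝ f (y + (r * τ y) • v)) (y + (r * τ y) • v) :=
        (((hf _ (hmem r hr)).contDiffAt (hW.mem_nhds (hmem r hr))).differentiableAt
          (by simp)).hasFDerivAt
      have h2 : HasDerivAt (fun r : ℝ => y + (r * τ y) • v) (τ y • v) r := by
        simpa using (((hasDerivAt_id r).mul_const (τ y)).smul_const v).const_add y
      have h3 := h1.comp_hasDerivAt r h2
      rw [map_smul] at h3
      exact h3
    have hcont : ContinuousOn (fun r : ℝ => τ y • fderiv ℝ f (y + (r * τ y) • v) v)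
        (Set.uIcc (0 : ℝ) 1) := by
      have h1 : ContinuousOn (fun y => fderiv ℝ f y v) W :=
        ((hf.fderiv_of_isOpen hW (m := 0) (by simp)).clm_apply contDiffOn_const).continuousOn
      have h2 : Continuous fun r : ℝ => y + (r * τ y) • v := by fun_prop
      exact (h1.comp h2.continuousOn hmem).const_smul (τ y)
    rw [intervalIntegral.integral_eq_sub_of_hasDerivAt hderiv hcont.intervalIntegrable]
    simp
  set A : X → ℂ := fun y => ∫ r in (0 : ℝ)..1, fderiv ℝ g (y + (r * τ y) • v) v with hA
  set B : X → ℝ := fun y => ∫ r in (0 : ℝ)..1, fderiv ℝ j (y + (r * τ y) • v) v with hB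
  have hBa : B a = 1 := by simp [hB, hτa, hv]
  have hBc : ∀ᶠ y in 𝓝 a, B y ≠ 0 := by
    have : ContinuousAt B a := hJ.continuousOn.continuousAt (hu₂.mem_nhds hau₂)
    exact this.eventually_ne (by simp [hBa])
  obtain ⟨u₃, hu₃, hu₃o, hau₃⟩ := mem_nhds_iff.1 hBc
  have hBC : ContDiffOn ℝ ∞ (fun y => (B y : ℂ)) u₂ :=
    Complex.ofRealCLM.contDiff.comp_contDiffOn hJ
  -- Both functions vanish at the far end of the segment, so `g = -τ A` and `j = -τ B`. The
  -- normalization of `v` gives `B a = 1`, hence the smooth quotient `A / B` near `a`.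
  refine ⟨fun y => A y * (B y : ℂ)⁻¹, (u₁ ∩ u₂) ∩ (u₃ ∩ (W ∩ V₁)),
    (hu₁.inter hu₂).inter (hu₃o.inter (hW.inter hV₁)), ⟨⟨hau₁, hau₂⟩, hau₃, ha, haV⟩, ?_, ?_⟩
  · refine (hG.mono fun y hy => hy.1.1).mul ?_
    intro y hy
    have h1 : ContDiffWithinAt ℝ ∞ (fun y => (B y : ℂ)) _ y := (hBC.mono fun y hy => hy.1.2) y hy
    exact (contDiffAt_inv ℝ (Complex.ofReal_ne_zero.2 (hu₃ hy.2.1))).comp_contDiffWithinAt y h1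
  · intro y hy
    have h1 := hmean hg y hy.1.1
    have h2 := hmean hj y hy.1.1
    rw [(hτ0 y hy.2.2.2).2] at h2
    rw [h _ (hτ0 y hy.2.2.2).1 (hτ0 y hy.2.2.2).2] at h1
    have h3 : g y = -(τ y • A y) := by rw [← h1]; simp
    have h4 : j y = -(τ y * B y) := by rw [← smul_eq_mul, ← h2]; simp
    have h5 : (B y : ℂ) ≠ 0 := Complex.ofReal_ne_zero.2 (hu₃ hy.2.1)
    rw [h3, h4, Complex.real_smul]
    push_cast
    field_simp

end Calculus

end StarReduction

/-! ### Division by the constraint function -/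

namespace StarReduction

section Division

variable {n : ℕ} {M : Type*} [TopologicalSpace M] [ChartedSpace (E n) M]
  {F : Type*} [NormedAddCommGroup F] [NormedSpace ℝ F] {J : M → ℝ}

theorem not_eventually_eq_zero (hdJ : ∀ x, J x = 0 → mfderiv (𝓡 n) 𝓘(ℝ, ℝ) J x ≠ 0) (x : M) :
    ¬ ∀ᶠ y in 𝓝 x, J y = 0 := fun h => by
  apply hdJ x h.self_of_nhds
  have h' : J =ᶠ[𝓝 x] fun _ => (0 : ℝ) := h
  rw [h'.mfderiv_eq, mfderiv_const]
  rfl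

/-- If continuous quotients differed at `x`, they would differ nearby and force `J` to vanish on a
neighbourhood, against the nonvanishing of its differential. -/
theorem eq_of_mul_eventuallyEq (hdJ : ∀ x, J x = 0 → mfderiv (𝓡 n) 𝓘(ℝ, ℝ) J x ≠ 0)
    {q q' : M → ℂ} {x : M} (hq : ContinuousAt q x) (hq' : ContinuousAt q' x)
    (h : ∀ᶠ y in 𝓝 x, q y * J y = q' y * J y) : q x = q' x := by
  by_contra hne
  apply not_eventually_eq_zero hdJ x
  have h1 : ContinuousAt (fun y => q y - q' y) x := hq.sub hq'
  filter_upwards [h, h1.eventually_ne (sub_ne_zero.2 hne)] with y h2 h3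
  rw [← sub_eq_zero, ← sub_mul] at h2
  simpa [h3] using h2

variable [IsManifold (𝓡 n) ∞ M]

theorem contDiffOn_comp_chart_symm {f : M → F} (hf : ContMDiff (𝓡 n) 𝓘(ℝ, F) ∞ f) (x₀ : M) :
    ContDiffOn ℝ ∞ (fun y => f ((chartAt (E n) x₀).symm y)) (chartAt (E n) x₀).target := by
  rw [← contMDiffOn_iff_contDiffOn]
  exact hf.comp_contMDiffOn (contMDiffOn_chart_symm (I := 𝓡 n) (x := x₀))

theorem contMDiffOn_comp_chart {g : E n → F} {V : Set (E n)} (hg : ContDiffOn ℝ ∞ g V) (x₀ : M) :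
    ContMDiffOn (𝓡 n) 𝓘(ℝ, F) ∞ (fun x => g (chartAt (E n) x₀ x))
      ((chartAt (E n) x₀).source ∩ chartAt (E n) x₀ ⁻¹' V) :=
  hg.contMDiffOn.comp' (contMDiffOn_chart (I := 𝓡 n) (x := x₀))

theorem mfderiv_eq_fderiv_chart {f : M → F} (hf : ContMDiff (𝓡 n) 𝓘(ℝ, F) ∞ f) (x₀ : M) {x : M}
    (hx : x ∈ (chartAt (E n) x₀).source) (v : TangentSpace (𝓡 n) x) :
    mfderiv (𝓡 n) 𝓘(ℝ, F) f x v
      = fderiv ℝ (fun y => f ((chartAt (E n) x₀).symm y)) (chartAt (E n) x₀ x)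
        (mfderiv (𝓡 n) 𝓘(ℝ, E n) (extChartAt (𝓡 n) x₀) x v) := by
  have hxt : chartAt (E n) x₀ x ∈ (chartAt (E n) x₀).target := (chartAt (E n) x₀).map_source hx
  have h1 : DifferentiableAt ℝ (fun y => f ((chartAt (E n) x₀).symm y)) (extChartAt (𝓡 n) x₀ x) :=
    ((contDiffOn_comp_chart_symm hf x₀ _ hxt).contDiffAt
      ((chartAt (E n) x₀).open_target.mem_nhds hxt)).differentiableAt (by simp)
  have h2 : f =ᶠ[𝓝 x] (fun y => f ((chartAt (E n) x₀).symm y)) ∘ (extChartAt (𝓡 n) x₀) := by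
    filter_upwards [(chartAt (E n) x₀).open_source.mem_nhds hx] with y hy
    exact congrArg f ((chartAt (E n) x₀).left_inv hy).symm
  rw [h2.mfderiv_eq, mfderiv_comp x h1.mdifferentiableAt (mdifferentiableAt_extChartAt hx),
    mfderiv_eq_fderiv]
  rfl

variable [T2Space M]

theorem exists_local_quotient (hJ : ContMDiff (𝓡 n) 𝓘(ℝ, ℝ) ∞ J)
    (hdJ : ∀ x, J x = 0 → mfderiv (𝓡 n) 𝓘(ℝ, ℝ) J x ≠ 0) (f : Sm n M)
    (hf : ∀ x, J x = 0 → f.1 x = 0) (x : M) :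
    ∃ q : Sm n M, ∀ᶠ y in 𝓝 x, f.1 y = q.1 y * J y := by
  set φ := chartAt (E n) x
  have hx : x ∈ φ.source := mem_chart_source _ x
  have hxt : φ x ∈ φ.target := φ.map_source hx
  have hg := contDiffOn_comp_chart_symm (Sm.contMDiff f) x
  have hj := contDiffOn_comp_chart_symm hJ x
  suffices ∃ (q : E n → ℂ) (V : Set (E n)), IsOpen V ∧ φ x ∈ V ∧ ContDiffOn ℝ ∞ q V ∧
      ∀ y ∈ V, f.1 (φ.symm y) = q y * J (φ.symm y) by
    obtain ⟨q, V, hV, hxV, hq, hqV⟩ := this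
    obtain ⟨G, hG⟩ := Sm.exists_germ_of_open x (φ.isOpen_inter_preimage hV) ⟨hx, hxV⟩ _
      (contMDiffOn_comp_chart hq x)
    refine ⟨G, ?_⟩
    filter_upwards [hG, (φ.isOpen_inter_preimage hV).mem_nhds ⟨hx, hxV⟩] with y h1 h2
    rw [h1]
    have := hqV _ h2.2
    rwa [φ.left_inv h2.1] at this
  by_cases h0 : J x = 0
  · obtain ⟨q, V, h1, h2, h3, h4⟩ := exists_smooth_quotient φ.open_target hxt hg hj
      (by rw [φ.left_inv hx]; exact h0) (fun h => hdJ x h0 (by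
        ext v
        rw [mfderiv_eq_fderiv_chart hJ x hx, h]
        rfl)) fun y _ => hf _
    exact ⟨q, V, h1, h2, h3, h4⟩
  · refine ⟨fun y => f.1 (φ.symm y) * ((J (φ.symm y) : ℝ) : ℂ)⁻¹,
      φ.target ∩ (fun y => J (φ.symm y)) ⁻¹' {0}ᶜ,
      hj.continuousOn.isOpen_inter_preimage φ.open_target isOpen_compl_singleton,
      ⟨hxt, by simpa [φ.left_inv hx] using h0⟩, ?_, ?_⟩
    · refine (hg.mono Set.inter_subset_left).mul fun y hy => ?_
      have h1 : ContDiffWithinAt ℝ ∞ (fun y => ((J (φ.symm y) : ℝ) : ℂ)) _ y :=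
        Complex.ofRealCLM.contDiff.comp_contDiffOn (hj.mono Set.inter_subset_left) y hy
      exact (contDiffAt_inv ℝ (Complex.ofReal_ne_zero.2 hy.2)).comp_contDiffWithinAt y h1
    · intro y hy
      have : ((J (φ.symm y) : ℝ) : ℂ) ≠ 0 := Complex.ofReal_ne_zero.2 hy.2
      field_simp

/-- Smooth functions that vanish on the regular hypersurface `J = 0` are divisible by `J`. -/
theorem exists_quotient (hJ : ContMDiff (𝓡 n) 𝓘(ℝ, ℝ) ∞ J)
    (hdJ : ∀ x, J x = 0 → mfderiv (𝓡 n) 𝓘(ℝ, ℝ) J x ≠ 0) (f : Sm n M)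
    (hf : ∀ x, J x = 0 → f.1 x = 0) : ∃ h : Sm n M, ∀ x, f.1 x = h.1 x * J x := by
  choose q hq using exists_local_quotient hJ hdJ f hf
  -- Local quotients are unique, so they agree where they overlap and glue to a smooth function.
  have key : ∀ x, ∀ᶠ y in 𝓝 x, (q y).1 y = (q x).1 y := by
    intro x
    filter_upwards [(hq x).eventually_nhds] with y hy
    refine eq_of_mul_eventuallyEq hdJ (Sm.continuous (q y)).continuousAt
      (Sm.continuous (q x)).continuousAt ?_
    filter_upwards [hy, hq y] with z h1 h2
    rw [← h1, ← h2]
  refine ⟨⟨fun x => (q x).1 x, fun x => ?_⟩, fun x => (hq x).self_of_nhds⟩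
  exact (Sm.contMDiff (q x) x).congr_of_eventuallyEq (key x)

end Division

namespace Constraint

variable {n : ℕ} {P : Type*} [TopologicalSpace P] [ChartedSpace (E (n + 2)) P] {U : Opens P}
  {C : Type*} [TopologicalSpace C] [ChartedSpace (E (n + 1)) C] (K : Constraint n U C)

theorem J_ι (c : C) : K.J (K.ι c) = 0 := by
  have : K.ι c ∈ Set.range K.ι := ⟨c, rfl⟩
  rwa [K.range_ι] at this

theorem exists_of_J {x : U} (h : K.J x = 0) : ∃ c, K.ι c = x := by
  have : x ∈ {x | K.J x = 0} := h
  rwa [← K.range_ι] at this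

theorem dJ_ne_zero' (x : U) (h : K.J x = 0) : mfderiv (𝓡 (n + 2)) 𝓘(ℝ, ℝ) K.J x ≠ 0 := by
  obtain ⟨c, rfl⟩ := K.exists_of_J h
  exact K.dJ_ne_zero c

theorem res_JC : K.res K.JC = 0 := Sm.ext fun c => by
  change ((K.J (K.ι c) : ℝ) : ℂ) = 0
  rw [K.J_ι, Complex.ofReal_zero]

theorem regular (h : Sm (n + 2) U) (h0 : h * K.JC = 0) : h = 0 := Sm.ext fun x =>
  eq_of_mul_eventuallyEq (q' := fun _ => 0) K.dJ_ne_zero' (Sm.continuous h).continuousAt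
    continuousAt_const (Filter.Eventually.of_forall fun y => by
      rw [zero_mul]
      exact congrArg (fun f : Sm (n + 2) U => f.1 y) h0)

variable [T2Space P] [IsManifold (𝓡 (n + 2)) ∞ P]

theorem exists_eq_mul (f : Sm (n + 2) U) (hf : K.res f = 0) :
    ∃ h : Sm (n + 2) U, f = h * K.JC := by
  obtain ⟨h, hh⟩ := exists_quotient K.J_smooth K.dJ_ne_zero' f fun x hx => by
    obtain ⟨c, rfl⟩ := K.exists_of_J hx
    exact congrArg (fun g : Sm (n + 1) C => g.1 c) hf
  exact ⟨h, Sm.ext hh⟩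

theorem existsUnique_comp (p : Prolongation K) (f : Sm (n + 2) U) :
    ∃! h, f - p.prolFun f = h * K.JC := by
  obtain ⟨h, hh⟩ := K.exists_eq_mul (f - p.prolFun f) (by
    rw [map_sub, Prolongation.prolFun, p.res_p, sub_self])
  refine ⟨h, hh, fun h' hh' => ?_⟩
  rw [← sub_eq_zero]
  apply K.regular
  rw [sub_mul, ← hh, ← hh', sub_self]

end Constraint

end StarReduction

/-! ### Tangent geometry of the constraint surface and of the projection -/

namespace StarReduction

section Submersion

variable {n : ℕ} {M : Type*} [TopologicalSpace M] [ChartedSpace (E n) M]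
  {m : ℕ} {N : Type*} [TopologicalSpace N] [ChartedSpace (E m) N]

/-- The differential of a submersion is surjective. -/
theorem surjective_mfderiv_of_isSubmersionAt {f : M → N} {x : M}
    (h : Manifold.IsSubmersionAt (𝓡 n) (𝓡 m) ∞ f x) :
    Function.Surjective (mfderiv (𝓡 n) (𝓡 m) f x) := by
  set z := h.domChart x
  have hx : x ∈ h.domChart.source := h.mem_domChart_source
  have hfx : f x ∈ h.codChart.source := h.mem_codChart_source
  have hz : z ∈ h.domChart.target := h.domChart.map_source hx
  have hw : ∀ y ∈ h.domChart.target, h.codChart (f (h.domChart.symm y)) = (h.equiv y).1 :=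
    fun y hy => h.writtenInCharts (by simpa using hy)
  -- In suitable charts a submersion is a linear projection; `l` is its affine section through the
  -- coordinates of `x` and provides a local right inverse of `f`.
  let l : E m → E n := fun y => h.equiv.symm (y, (h.equiv z).2)
  have hl : ContDiff ℝ ∞ l :=
    h.equiv.symm.contDiff.comp (contDiff_id.prodMk contDiff_const)
  have hlz : l (h.codChart (f x)) = z := by
    have := hw z hz
    rw [h.domChart.left_inv hx] at this
    simp [l, this]
  let s : N → M := fun q => h.domChart.symm (l (h.codChart q))
  have hsx : s (f x) = x := by
    change h.domChart.symm (l (h.codChart (f x))) = x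
    rw [hlz, h.domChart.left_inv hx]
  have hc1 : ContMDiffAt (𝓡 m) 𝓘(ℝ, E m) ∞ h.codChart (f x) :=
    contMDiffAt_of_mem_maximalAtlas h.codChart_mem_maximalAtlas hfx
  have hc2 : ContMDiffAt (𝓡 m) 𝓘(ℝ, E n) ∞ (fun q => l (h.codChart q)) (f x) :=
    hl.contMDiff.contMDiffAt.comp (f x) hc1
  have hs : ContMDiffAt (𝓡 m) (𝓡 n) ∞ s (f x) := by
    have h3 : ContMDiffAt 𝓘(ℝ, E n) (𝓡 n) ∞ h.domChart.symm (l (h.codChart (f x))) := by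
      rw [hlz]
      exact contMDiffAt_symm_of_mem_maximalAtlas h.domChart_mem_maximalAtlas hz
    exact h3.comp (f x) hc2
  have hfs : ∀ᶠ q in 𝓝 (f x), f (s q) = q := by
    have h1 : ∀ᶠ q in 𝓝 (f x), l (h.codChart q) ∈ h.domChart.target :=
      hc2.continuousAt.eventually (h.domChart.open_target.mem_nhds (by
        change l (h.codChart (f x)) ∈ _
        rwa [hlz]))
    filter_upwards [h1, h.codChart.open_source.mem_nhds hfx] with q h2 h3
    apply h.codChart.injOn (h.source_subset_preimage_source (h.domChart.map_target h2)) h3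
    rw [hw _ h2]
    simp [l]
  intro w
  have hf : ContMDiffAt (𝓡 n) (𝓡 m) ∞ f (s (f x)) := by
    rw [hsx]
    exact h.contMDiffAt
  have hcomp := mfderiv_comp (f x) (hf.mdifferentiableAt (by simp)) (hs.mdifferentiableAt (by simp))
  have hid : mfderiv (𝓡 m) (𝓡 m) (f ∘ s) (f x) = ContinuousLinearMap.id ℝ _ := by
    have h' : f ∘ s =ᶠ[𝓝 (f x)] id := hfs
    rw [h'.mfderiv_eq, mfderiv_id]
  rw [hid] at hcomp
  have h4 := congrArg (fun L : TangentSpace (𝓡 m) (f x) →L[ℝ] TangentSpace (𝓡 m) (f x) => L w) hcomp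
  -- The chain rule yields a preimage at the point `s (f x)`, which has to be transported along its
  -- equality with `x`.
  have key : ∀ y, y = x → ∀ (D : TangentSpace (𝓡 m) (f x) →L[ℝ] E n),
      w = (mfderiv (𝓡 n) (𝓡 m) f y : E n →L[ℝ] E m) (D w) →
      ∃ v, (mfderiv (𝓡 n) (𝓡 m) f x : E n →L[ℝ] E m) v = w := by
    rintro y rfl D hD
    exact ⟨_, hD.symm⟩
  exact key _ hsx _ h4

end Submersion

namespace Constraint

variable {n : ℕ} {P : Type*} [TopologicalSpace P] [ChartedSpace (E (n + 2)) P] {U : Opens P}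
  {C : Type*} [TopologicalSpace C] [ChartedSpace (E (n + 1)) C] (K : Constraint n U C)
  {Q : Type*} [TopologicalSpace Q] [ChartedSpace (E n) Q]

theorem d_res (f : Sm (n + 2) U) (c : C) (ξ : TangentSpace (𝓡 (n + 1)) c) :
    Sm.d (K.res f) c ξ = Sm.d f (K.ι c) (mfderiv (𝓡 (n + 1)) (𝓡 (n + 2)) K.ι c ξ) :=
  Sm.d_pullback K.ι K.ι_smooth f c ξ

theorem d_JC (x : U) (v : TangentSpace (𝓡 (n + 2)) x) :
    Sm.d K.JC x v = Complex.ofReal (mfderiv (𝓡 (n + 2)) 𝓘(ℝ, ℝ) K.J x v) :=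
  Sm.ofReal_d K.J K.J_smooth x v

theorem dJ_dι (c : C) (ξ : TangentSpace (𝓡 (n + 1)) c) :
    mfderiv (𝓡 (n + 2)) 𝓘(ℝ, ℝ) K.J (K.ι c) (mfderiv (𝓡 (n + 1)) (𝓡 (n + 2)) K.ι c ξ) = 0 := by
  have h := K.d_res K.JC c ξ
  rw [K.res_JC, K.d_JC] at h
  have h0 : Sm.d (0 : Sm (n + 1) C) c ξ = 0 := by
    rw [← map_zero (algebraMap ℂ (Sm (n + 1) C)), Sm.d_algebraMap]
    rfl
  rw [h0] at h
  exact Complex.ofReal_eq_zero.1 h.symm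

theorem formOn_dι {Ω : TwoForm (n + 2) P} (R : ReducedPhaseSpace Ω K Q) (c : C) (ξ η : TangentSpace (𝓡 (n + 1)) c) :
    formOn Ω U (K.ι c) (mfderiv (𝓡 (n + 1)) (𝓡 (n + 2)) K.ι c ξ)
      (mfderiv (𝓡 (n + 1)) (𝓡 (n + 2)) K.ι c η)
    = R.form (R.π c) (mfderiv (𝓡 (n + 1)) (𝓡 n) R.π c ξ) (mfderiv (𝓡 (n + 1)) (𝓡 n) R.π c η) :=
  congrArg (fun F : TwoForm (n + 1) C => F c ξ η) R.pullback_form.symm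

theorem surjective_dπ {Ω : TwoForm (n + 2) P} (R : ReducedPhaseSpace Ω K Q) (c : C) :
    Function.Surjective (mfderiv (𝓡 (n + 1)) (𝓡 n) R.π c) :=
  surjective_mfderiv_of_isSubmersionAt (R.π_submersion.isSubmersionAt c)

variable [T2Space C] [IsManifold (𝓡 (n + 1)) ∞ C]

/-- Every function on `C` is the restriction of its prolongation, so a vector killed by the
differential of `ι` is killed by all functions on `C`. -/
theorem injective_dι (p : Prolongation K) (c : C) :
    Function.Injective (mfderiv (𝓡 (n + 1)) (𝓡 (n + 2)) K.ι c) := by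
  rw [injective_iff_map_eq_zero]
  intro ξ hξ
  apply Sm.eq_zero_of_d
  intro u
  rw [← p.res_p u, K.d_res, hξ, map_zero]

/-- The image of the differential of `ι` lies in the kernel of `dJ`, and both have dimension `n +
1`. -/
theorem exists_dι (p : Prolongation K) (c : C) (v : TangentSpace (𝓡 (n + 2)) (K.ι c))
    (hv : mfderiv (𝓡 (n + 2)) 𝓘(ℝ, ℝ) K.J (K.ι c) v = 0) :
    ∃ ξ, mfderiv (𝓡 (n + 1)) (𝓡 (n + 2)) K.ι c ξ = v := by
  let A : E (n + 1) →ₗ[ℝ] E (n + 2) :=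
    (mfderiv (𝓡 (n + 1)) (𝓡 (n + 2)) K.ι c : E (n + 1) →L[ℝ] E (n + 2)).toLinearMap
  let l : E (n + 2) →ₗ[ℝ] ℝ :=
    (mfderiv (𝓡 (n + 2)) 𝓘(ℝ, ℝ) K.J (K.ι c) : E (n + 2) →L[ℝ] ℝ).toLinearMap
  have hA : Function.Injective A := K.injective_dι p c
  have hl : l ≠ 0 := fun h => K.dJ_ne_zero c (by
    ext w
    exact congrArg (fun l : E (n + 2) →ₗ[ℝ] ℝ => l w) h)
  have hle : LinearMap.range A ≤ LinearMap.ker l := by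
    rintro _ ⟨ξ, rfl⟩
    exact K.dJ_dι c ξ
  have h1 : Module.finrank ℝ (LinearMap.range A) = n + 1 := by
    rw [LinearMap.finrank_range_of_inj hA]
    exact finrank_euclideanSpace_fin
  have h2 : Module.finrank ℝ (LinearMap.ker l) = n + 1 := by
    have h3 := LinearMap.finrank_range_add_finrank_ker l
    rw [LinearMap.range_eq_top.2 (LinearMap.surjective hl), finrank_top, Module.finrank_self,
      finrank_euclideanSpace_fin] at h3
    omega
  have h3 := Submodule.eq_of_le_of_finrank_eq hle (h1.trans h2.symm)
  have h4 : (v : E (n + 2)) ∈ LinearMap.range A := by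
    rw [h3]
    exact hv
  exact h4

/-- The Hamiltonian vector field of the constraint function along the constraint surface. -/
def leafVec (Ω : TwoForm (n + 2) P) (c : C) : TangentSpace (𝓡 (n + 1)) c :=
  Classical.epsilon fun ξ => mfderiv (𝓡 (n + 1)) (𝓡 (n + 2)) K.ι c ξ = hamVec (formOn Ω U) K.J (K.ι c)

variable [T2Space P] [IsManifold (𝓡 (n + 2)) ∞ P] {Ω : TwoForm (n + 2) P}

/-- `X_J` is tangent to the surface because `dJ(X_J) = ω(X_J, X_J) = 0`. -/
theorem dι_leafVec (hΩ : Ω.IsSymplectic) (p : Prolongation K) (c : C) :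
    mfderiv (𝓡 (n + 1)) (𝓡 (n + 2)) K.ι c (K.leafVec Ω c) = hamVec (formOn Ω U) K.J (K.ι c) := by
  refine Classical.epsilon_spec (p := fun ξ => mfderiv (𝓡 (n + 1)) (𝓡 (n + 2)) K.ι c ξ
    = hamVec (formOn Ω U) K.J (K.ι c)) (K.exists_dι p c _ ?_)
  have h := symplecticAt_formOn hΩ U (K.ι c)
  rw [← h.hamVec_spec, h.alternating]
  rfl

theorem leafVec_ne_zero (hΩ : Ω.IsSymplectic) (p : Prolongation K) (c : C) :
    K.leafVec Ω c ≠ 0 := by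
  intro h
  apply K.dJ_ne_zero c
  ext v
  rw [← (symplecticAt_formOn hΩ U (K.ι c)).hamVec_spec, ← K.dι_leafVec hΩ p c, h]
  simp
  rfl

theorem poisson_JC (hΩ : Ω.IsSymplectic) (p : Prolongation K) (f : Sm (n + 2) U) (c : C) :
    poisson (formOn Ω U) f.1 K.JC.1 (K.ι c) = Sm.d (K.res f) c (K.leafVec Ω c) := by
  rw [K.d_res, K.dι_leafVec hΩ p]
  exact poisson_ofReal (symplecticAt_formOn hΩ U (K.ι c)) f K.J

/-- The reduced form pairs the projection of `X_J` with that of any tangent `η` to `ω(X_J, η) =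
dJ(η) = 0`; nondegeneracy concludes. -/
theorem dπ_leafVec (hΩ : Ω.IsSymplectic) (p : Prolongation K) (R : ReducedPhaseSpace Ω K Q)
    (c : C) : mfderiv (𝓡 (n + 1)) (𝓡 n) R.π c (K.leafVec Ω c) = 0 := by
  apply (R.form_symplectic.symplecticAt _).nondegenerate
  intro w
  obtain ⟨η, rfl⟩ := K.surjective_dπ R c w
  rw [← K.formOn_dι, K.dι_leafVec hΩ p, (symplecticAt_formOn hΩ U (K.ι c)).hamVec_spec, K.dJ_dι]
  rfl

/-- Vectors tangent to the fibres of `π` are multiples of the Hamiltonian vector. -/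
theorem exists_smul_leafVec (hΩ : Ω.IsSymplectic) (p : Prolongation K)
    (R : ReducedPhaseSpace Ω K Q) (c : C) (ξ : TangentSpace (𝓡 (n + 1)) c)
    (hξ : mfderiv (𝓡 (n + 1)) (𝓡 n) R.π c ξ = 0) : ∃ a : ℝ, ξ = a • K.leafVec Ω c := by
  let B : E (n + 1) →ₗ[ℝ] E n :=
    (mfderiv (𝓡 (n + 1)) (𝓡 n) R.π c : E (n + 1) →L[ℝ] E n).toLinearMap
  have hB : LinearMap.range B = ⊤ := LinearMap.range_eq_top.2 (K.surjective_dπ R c)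
  have h1 : Module.finrank ℝ (LinearMap.ker B) = 1 := by
    have h3 := LinearMap.finrank_range_add_finrank_ker B
    rw [hB, finrank_top, finrank_euclideanSpace_fin, finrank_euclideanSpace_fin] at h3
    omega
  let X : LinearMap.ker B := ⟨K.leafVec Ω c, K.dπ_leafVec hΩ p R c⟩
  have hX : X ≠ 0 := fun h => K.leafVec_ne_zero hΩ p c (congrArg Subtype.val h)
  obtain ⟨a, ha⟩ := (finrank_eq_one_iff_of_nonzero' X hX).1 h1 ⟨ξ, hξ⟩
  exact ⟨a, (congrArg Subtype.val ha).symm⟩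

/-- The projection to the reduced phase space is a Poisson map. -/
theorem poisson_lift (hΩ : Ω.IsSymplectic) (p : Prolongation K) (R : ReducedPhaseSpace Ω K Q)
    (c : C) (f g : Sm (n + 2) U) (u v : Sm n Q) (hf : K.res f = Sm.pullback R.π R.π_smooth u)
    (hg : K.res g = Sm.pullback R.π R.π_smooth v) :
    poisson (formOn Ω U) f.1 g.1 (K.ι c) = poisson R.form u.1 v.1 (R.π c) := by
  have hs := symplecticAt_formOn hΩ U (K.ι c)
  have hq := R.form_symplectic.symplecticAt (R.π c)
  have hd : ∀ {f : Sm (n + 2) U} {u : Sm n Q}, K.res f = Sm.pullback R.π R.π_smooth u → ∀ η,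
      Sm.d f (K.ι c) (mfderiv (𝓡 (n + 1)) (𝓡 (n + 2)) K.ι c η)
        = Sm.d u (R.π c) (mfderiv (𝓡 (n + 1)) (𝓡 n) R.π c η) := fun h η => by
    rw [← K.d_res, h, Sm.d_pullback]
  -- A function that agrees to first order along `C` with a pull-back from `Q` has zero derivative
  -- along `X_J`. So its Hamiltonian vector is tangent to `C`, and it projects to the Hamiltonian
  -- vector downstairs because `π` pulls back the reduced form to the restricted one.
  have key : ∀ (a : U → ℝ) (b : Q → ℝ), (∀ η, mfderiv (𝓡 (n + 2)) 𝓘(ℝ, ℝ) a (K.ι c)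
        (mfderiv (𝓡 (n + 1)) (𝓡 (n + 2)) K.ι c η)
      = mfderiv (𝓡 n) 𝓘(ℝ, ℝ) b (R.π c) (mfderiv (𝓡 (n + 1)) (𝓡 n) R.π c η)) →
      ∃ ξ, mfderiv (𝓡 (n + 1)) (𝓡 (n + 2)) K.ι c ξ = hamVec (formOn Ω U) a (K.ι c) ∧
        mfderiv (𝓡 (n + 1)) (𝓡 n) R.π c ξ = hamVec R.form b (R.π c) := by
    intro a b hab
    obtain ⟨ξ, hξ⟩ := K.exists_dι p c (hamVec (formOn Ω U) a (K.ι c)) (by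
      rw [← hs.hamVec_spec, hs.skew, hs.hamVec_spec, ← K.dι_leafVec hΩ p, hab,
        K.dπ_leafVec hΩ p, map_zero]
      exact neg_zero)
    refine ⟨ξ, hξ, hq.eq_hamVec _ _ fun w => ?_⟩
    obtain ⟨η, rfl⟩ := K.surjective_dπ R c w
    rw [← K.formOn_dι, hξ, hs.hamVec_spec]
    exact hab η
  rw [poisson_eq hs, poisson_eq hq]
  obtain ⟨ξ, h1, h2⟩ := key (fun y => (f.1 y).re) (fun y => (u.1 y).re) (fun η => by
    rw [Sm.mfderiv_re, Sm.mfderiv_re, hd hf])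
  obtain ⟨ξ', h3, h4⟩ := key (fun y => (f.1 y).im) (fun y => (u.1 y).im) (fun η => by
    rw [Sm.mfderiv_im, Sm.mfderiv_im, hd hf])
  rw [← h1, ← h2, ← h3, ← h4, hd hg, hd hg]

end Constraint

end StarReduction

/-! ### Integral curves tested on functions -/

namespace StarReduction

section Curves

variable {n : ℕ} {M : Type*} [TopologicalSpace M] [ChartedSpace (E n) M]

/-- The chain rule for a function along a curve. -/
theorem hasDerivWithinAt_comp_curve {γ : ℝ → M} {s : Set ℝ} {t : ℝ}
    {v : TangentSpace (𝓡 n) (γ t)}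
    (h : HasMFDerivWithinAt 𝓘(ℝ, ℝ) (𝓡 n) γ s t ((1 : ℝ →L[ℝ] ℝ).smulRight v)) (f : Sm n M) :
    HasDerivWithinAt (fun τ => f.1 (γ τ)) (Sm.d f (γ t) v) s t := by
  have h1 := ((Sm.mdifferentiableAt f (γ t)).hasMFDerivAt.comp_hasMFDerivWithinAt t h)
  have h2 : HasFDerivWithinAt (fun τ => f.1 (γ τ))
      ((mfderiv (𝓡 n) 𝓘(ℝ, ℂ) f.1 (γ t) : E n →L[ℝ] ℂ).comp
        ((1 : ℝ →L[ℝ] ℝ).smulRight (v : E n))) s t :=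
    hasMFDerivWithinAt_iff_hasFDerivWithinAt.1 h1
  have h3 : ((mfderiv (𝓡 n) 𝓘(ℝ, ℂ) f.1 (γ t) : E n →L[ℝ] ℂ).comp
        ((1 : ℝ →L[ℝ] ℝ).smulRight (v : E n))) = ContinuousLinearMap.toSpanSingleton ℝ
          ((mfderiv (𝓡 n) 𝓘(ℝ, ℂ) f.1 (γ t) : E n →L[ℝ] ℂ) v) := by
    refine ContinuousLinearMap.ext fun r => ?_
    exact map_smul (mfderiv (𝓡 n) 𝓘(ℝ, ℂ) f.1 (γ t) : E n →L[ℝ] ℂ) r v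
  rw [h3] at h2
  exact h2

theorem Sm.d_coord (x : M) (l : E n →L[ℝ] ℂ) (G : Sm n M)
    (hG : ∀ᶠ y in 𝓝 x, G.1 y = l (chartAt (E n) x y)) (v : TangentSpace (𝓡 n) x) :
    Sm.d G x v = l v := by
  have h1 : mfderiv (𝓡 n) 𝓘(ℝ, ℂ) G.1 x = mfderiv (𝓡 n) 𝓘(ℝ, ℂ) (fun y => l (chartAt (E n) x y)) x :=
    Filter.EventuallyEq.mfderiv_eq hG
  have h2 : mfderiv (𝓡 n) 𝓘(ℝ, ℂ) (fun y => l (chartAt (E n) x y)) x = l := by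
    have h3 : MDifferentiableAt (𝓡 n) 𝓘(ℝ, ℂ) (fun y => l (chartAt (E n) x y)) x :=
      (Sm.mdifferentiableAt G x).congr_of_eventuallyEq (by filter_upwards [hG] with y hy using hy.symm)
    rw [h3.mfderiv]
    simp only [writtenInExtChartAt, mfld_simps, fderivWithin_univ]
    have h4 : (fun y : E n => l (chartAt (E n) x ((chartAt (E n) x).symm y)))
        =ᶠ[𝓝 (chartAt (E n) x x)] l := by
      filter_upwards [(chartAt (E n) x).open_target.mem_nhds (mem_chart_target _ x)] with y hy
      rw [(chartAt (E n) x).right_inv hy]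
    exact h4.fderiv_eq.trans l.fderiv
  rw [Sm.d, h1, h2]
  rfl

variable [IsManifold (𝓡 n) ∞ M]

theorem Sm.d_coord' (x₀ : M) {x : M} (hx : x ∈ (chartAt (E n) x₀).source) (l : E n →L[ℝ] ℂ)
    (G : Sm n M) (hG : ∀ᶠ y in 𝓝 x, G.1 y = l (chartAt (E n) x₀ y)) (v : TangentSpace (𝓡 n) x) :
    Sm.d G x v = l (mfderiv (𝓡 n) 𝓘(ℝ, E n) (extChartAt (𝓡 n) x₀) x v : E n) := by
  refine (mfderiv_eq_fderiv_chart (Sm.contMDiff G) x₀ hx v).trans ?_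
  have h4 : (fun y : E n => G.1 ((chartAt (E n) x₀).symm y)) =ᶠ[𝓝 (chartAt (E n) x₀ x)] l := by
    have h5 := ((chartAt (E n) x₀).symm.continuousAt ((chartAt (E n) x₀).map_source hx)).tendsto
    rw [(chartAt (E n) x₀).left_inv hx] at h5
    filter_upwards [(chartAt (E n) x₀).open_target.mem_nhds ((chartAt (E n) x₀).map_source hx),
      h5.eventually hG] with y hy hy'
    rw [hy', (chartAt (E n) x₀).right_inv hy]
  rw [h4.fderiv_eq, l.fderiv]

variable [T2Space M]

/-- A curve is differentiable with a given velocity if all functions along it are. -/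
theorem hasMFDerivWithinAt_of_forall {γ : ℝ → M} {s : Set ℝ} {t : ℝ}
    (hc : ContinuousWithinAt γ s t) (v : TangentSpace (𝓡 n) (γ t))
    (h : ∀ f : Sm n M, HasDerivWithinAt (fun τ => f.1 (γ τ)) (Sm.d f (γ t) v) s t) :
    HasMFDerivWithinAt 𝓘(ℝ, ℝ) (𝓡 n) γ s t ((1 : ℝ →L[ℝ] ℝ).smulRight v) := by
  refine ⟨hc, ?_⟩
  simp only [writtenInExtChartAt, mfld_simps]
  suffices H : HasFDerivWithinAt ((chartAt (E n) (γ t)) ∘ γ)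
    ((1 : ℝ →L[ℝ] ℝ).smulRight (v : E n)) s t from H
  rw [hasFDerivWithinAt_euclidean]
  intro i
  obtain ⟨G, hG⟩ := Sm.exists_coord (γ t) (γ t) (mem_chart_source _ _)
    (Complex.ofRealCLM.comp (EuclideanSpace.proj i))
  have h1 := h G
  rw [Sm.d_coord _ _ _ hG] at h1
  have h2 := (Complex.reCLM.hasFDerivAt.comp_hasFDerivWithinAt t h1.hasFDerivWithinAt)
  refine (h2.congr_of_eventuallyEq ?_ ?_).congr_fderiv ?_
  · filter_upwards [hc.eventually hG] with τ hτ
    have := congrArg Complex.re hτ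
    exact this.symm
  · have := congrArg Complex.re hG.self_of_nhds
    exact this.symm
  · refine ContinuousLinearMap.ext fun r => ?_
    change ((r : ℂ) * (((EuclideanSpace.proj i : E n →L[ℝ] ℝ) v : ℝ) : ℂ)).re
      = r * (EuclideanSpace.proj i : E n →L[ℝ] ℝ) v
    simp

/-- The components of `v` in a chart are its derivatives of coordinate functions, which extend from
a neighbourhood to smooth functions. -/
theorem contMDiff_section_of_forall (v : ∀ x : M, TangentSpace (𝓡 n) x)
    (hv : ∀ f : Sm n M, ∃ g : Sm n M, ∀ x, g.1 x = Sm.d f x (v x)) :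
    ContMDiff (𝓡 n) (𝓡 n).tangent 1 (fun x => (⟨x, v x⟩ : TangentBundle (𝓡 n) M)) := by
  intro x₀
  have : IsManifold (𝓡 n) 1 M := IsManifold.of_le (n := ∞) (by simp)
  refine (Bundle.contMDiffAt_section (IB := 𝓡 n) (F := E n) (E := (TangentSpace (𝓡 n) : M → Type _)) (s := v) x₀).2 ?_
  have h0 : ∀ᶠ x in 𝓝 x₀, x ∈ (chartAt (E n) x₀).source :=
    (chartAt (E n) x₀).open_source.mem_nhds (mem_chart_source _ x₀)
  suffices H : ContMDiffAt (𝓡 n) 𝓘(ℝ, E n) ∞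
      (fun x => (mfderiv (𝓡 n) 𝓘(ℝ, E n) (extChartAt (𝓡 n) x₀) x (v x) : E n)) x₀ by
    refine (H.of_le (by simp)).congr_of_eventuallyEq ?_
    filter_upwards [h0] with x hx
    have h1 := congrArg (fun L : TangentSpace (𝓡 n) x →L[ℝ] E n => L (v x))
      (TangentBundle.continuousLinearMapAt_trivializationAt (I := 𝓡 n) hx)
    refine Eq.trans ?_ h1
    have h2 : x ∈ (trivializationAt (E n) (TangentSpace (𝓡 n)) x₀).baseSet := by simpa using hx
    exact (congrFun (Bundle.Trivialization.coe_linearMapAt_of_mem (R := ℝ) _ h2) (v x)).symm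
  have h1 : ∀ i, ContMDiffAt (𝓡 n) 𝓘(ℝ, ℝ) ∞
      (fun x => (EuclideanSpace.proj i : E n →L[ℝ] ℝ)
        (mfderiv (𝓡 n) 𝓘(ℝ, E n) (extChartAt (𝓡 n) x₀) x (v x))) x₀ := by
    intro i
    obtain ⟨G, hG⟩ := Sm.exists_coord x₀ x₀ (mem_chart_source _ _)
      (Complex.ofRealCLM.comp (EuclideanSpace.proj i))
    obtain ⟨g, hg⟩ := hv G
    refine ContMDiffAt.congr_of_eventuallyEq
      ((Complex.reCLM.contDiff.contMDiff.comp (Sm.contMDiff g)).contMDiffAt) ?_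
    filter_upwards [h0, hG.eventually_nhds] with x hx hGx
    have := hg x
    rw [Sm.d_coord' x₀ hx _ _ hGx] at this
    exact (congrArg Complex.re this).symm
  exact (EuclideanSpace.equiv (Fin n) ℝ).symm.contDiff.contMDiff.contMDiffAt.comp x₀
    (contMDiffAt_pi_space.2 h1)

/-- Integral curves are characterized by their action on functions. -/
theorem isMIntegralCurveOn_iff {γ : ℝ → M} {v : ∀ x : M, TangentSpace (𝓡 n) x} {s : Set ℝ} :
    IsMIntegralCurveOn γ v s ↔ ∀ t ∈ s, ContinuousWithinAt γ s t ∧ ∀ f : Sm n M,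
      HasDerivWithinAt (fun τ => f.1 (γ τ)) (Sm.d f (γ t) (v (γ t))) s t :=
  ⟨fun h t ht => ⟨(h t ht).1, fun f => hasDerivWithinAt_comp_curve (h t ht) f⟩,
    fun h t ht => hasMFDerivWithinAt_of_forall (h t ht).1 _ (h t ht).2⟩

theorem _root_.IsMIntegralCurveOn.glue {γ₁ γ₂ : ℝ → M} {v : ∀ x : M, TangentSpace (𝓡 n) x}
    {a b c : ℝ} (hab : a ≤ b) (hbc : b ≤ c) (h₁ : IsMIntegralCurveOn γ₁ v (Set.Icc a b))
    (h₂ : IsMIntegralCurveOn γ₂ v (Set.Icc b c)) (h : γ₁ b = γ₂ b) :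
    IsMIntegralCurveOn (fun τ => if τ ≤ b then γ₁ τ else γ₂ τ) v (Set.Icc a c) := by
  rw [isMIntegralCurveOn_iff] at h₁ h₂ ⊢
  set γ := fun τ => if τ ≤ b then γ₁ τ else γ₂ τ
  have e₁ : ∀ τ ∈ Set.Icc a b, γ τ = γ₁ τ := fun τ hτ => if_pos hτ.2
  have e₂ : ∀ τ ∈ Set.Icc b c, γ τ = γ₂ τ := by
    intro τ hτ
    rcases hτ.1.eq_or_lt with rfl | h'
    · exact (if_pos le_rfl).trans h
    · exact if_neg (not_le.2 h')
  have k₁ : ∀ t ∈ Set.Icc a b, ContinuousWithinAt γ (Set.Icc a b) t ∧ ∀ f : Sm n M,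
      HasDerivWithinAt (fun τ => f.1 (γ τ)) (Sm.d f (γ t) (v (γ t))) (Set.Icc a b) t := by
    intro t ht
    refine ⟨(h₁ t ht).1.congr e₁ (e₁ t ht), fun f => ?_⟩
    rw [e₁ t ht]
    exact ((h₁ t ht).2 f).congr (fun τ hτ => congrArg f.1 (e₁ τ hτ)) (congrArg f.1 (e₁ t ht))
  have k₂ : ∀ t ∈ Set.Icc b c, ContinuousWithinAt γ (Set.Icc b c) t ∧ ∀ f : Sm n M,
      HasDerivWithinAt (fun τ => f.1 (γ τ)) (Sm.d f (γ t) (v (γ t))) (Set.Icc b c) t := by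
    intro t ht
    refine ⟨(h₂ t ht).1.congr e₂ (e₂ t ht), fun f => ?_⟩
    rw [e₂ t ht]
    exact ((h₂ t ht).2 f).congr (fun τ hτ => congrArg f.1 (e₂ τ hτ)) (congrArg f.1 (e₂ t ht))
  rw [← Set.Icc_union_Icc_eq_Icc hab hbc]
  intro t ht
  -- Away from `b` one of the two intervals is a neighbourhood of `t` in their union; at `b` the
  -- one-sided derivatives agree.
  rcases lt_trichotomy t b with htb | rfl | htb
  · have ht' : t ∈ Set.Icc a b := ht.resolve_right fun h => (not_le.2 htb) h.1
    have hm : Set.Icc a b ∈ 𝓝[Set.Icc a b ∪ Set.Icc b c] t := by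
      filter_upwards [self_mem_nhdsWithin, nhdsWithin_le_nhds (Iio_mem_nhds htb)] with τ hτ hτ'
      exact hτ.resolve_right fun h => (not_le.2 hτ') h.1
    exact ⟨(k₁ t ht').1.mono_of_mem_nhdsWithin hm, fun f => ((k₁ t ht').2 f).mono_of_mem_nhdsWithin hm⟩
  · exact ⟨(k₁ t ⟨hab, le_rfl⟩).1.union (k₂ t ⟨le_rfl, hbc⟩).1,
      fun f => ((k₁ t ⟨hab, le_rfl⟩).2 f).union ((k₂ t ⟨le_rfl, hbc⟩).2 f)⟩
  · have ht' : t ∈ Set.Icc b c := ht.resolve_left fun h => (not_le.2 htb) h.2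
    have hm : Set.Icc b c ∈ 𝓝[Set.Icc a b ∪ Set.Icc b c] t := by
      filter_upwards [self_mem_nhdsWithin, nhdsWithin_le_nhds (Ioi_mem_nhds htb)] with τ hτ hτ'
      exact hτ.resolve_left fun h => (not_le.2 hτ') h.2
    exact ⟨(k₂ t ht').1.mono_of_mem_nhdsWithin hm, fun f => ((k₂ t ht').2 f).mono_of_mem_nhdsWithin hm⟩

/-- An integral curve on a compact interval extends to a larger open interval. -/
theorem exists_extend_curve {v : ∀ x : M, TangentSpace (𝓡 n) x}
    (hv : ContMDiff (𝓡 n) (𝓡 n).tangent 1 (fun x => (⟨x, v x⟩ : TangentBundle (𝓡 n) M)))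
    {γ : ℝ → M} {a b : ℝ} (hab : a ≤ b) (h : IsMIntegralCurveOn γ v (Set.Icc a b)) :
    ∃ (Γ : ℝ → M) (a' b' : ℝ), a' < a ∧ b < b' ∧ IsMIntegralCurveOn Γ v (Set.Ioo a' b') ∧
      Set.EqOn Γ γ (Set.Icc a b) := by
  have : IsManifold (𝓡 n) 1 M := IsManifold.of_le (n := ∞) (by simp)
  obtain ⟨α, hα, hα'⟩ := exists_isMIntegralCurveAt_of_contMDiffAt_boundaryless (I := 𝓡 n) a (hv (γ a))
  obtain ⟨β, hβ, hβ'⟩ := exists_isMIntegralCurveAt_of_contMDiffAt_boundaryless (I := 𝓡 n) b (hv (γ b))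
  obtain ⟨ε, hε, hα'⟩ := isMIntegralCurveAt_iff'.1 hα'
  obtain ⟨δ, hδ, hβ'⟩ := isMIntegralCurveAt_iff'.1 hβ'
  rw [Real.ball_eq_Ioo] at hα' hβ'
  have h1 := h.glue hab (by linarith : b ≤ b + δ / 2)
    (hβ'.mono fun τ hτ => ⟨by linarith [hτ.1], by linarith [hτ.2]⟩) hβ.symm
  have h2 := IsMIntegralCurveOn.glue (by linarith : a - ε / 2 ≤ a) (by linarith : a ≤ b + δ / 2)
    (hα'.mono fun τ hτ => ⟨by linarith [hτ.1], by linarith [hτ.2]⟩) h1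
    (by simp only [if_pos hab]; exact hα)
  refine ⟨_, a - ε / 2, b + δ / 2, by linarith, by linarith, h2.mono Set.Ioo_subset_Icc_self, ?_⟩
  intro τ hτ
  by_cases h3 : τ ≤ a
  · obtain rfl : τ = a := le_antisymm h3 hτ.1
    simp [hα]
  · simp [h3, hτ.2]

theorem exists_extend_curve_uIcc {v : ∀ x : M, TangentSpace (𝓡 n) x}
    (hv : ContMDiff (𝓡 n) (𝓡 n).tangent 1 (fun x => (⟨x, v x⟩ : TangentBundle (𝓡 n) M)))
    {γ : ℝ → M} {t : ℝ} (h : IsMIntegralCurveOn γ v (Set.uIcc 0 t)) :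
    ∃ (Γ : ℝ → M) (a b : ℝ), (0 : ℝ) ∈ Set.Ioo a b ∧ t ∈ Set.Ioo a b ∧
      IsMIntegralCurveOn Γ v (Set.Ioo a b) ∧ Γ 0 = γ 0 ∧ Γ t = γ t := by
  obtain ⟨Γ, a, b, ha, hb, h1, h2⟩ := exists_extend_curve hv inf_le_sup h
  exact ⟨Γ, a, b, ⟨ha.trans_le inf_le_left, lt_of_le_of_lt le_sup_left hb⟩,
    ⟨ha.trans_le inf_le_right, lt_of_le_of_lt le_sup_right hb⟩, h1, h2 Set.left_mem_uIcc,
    h2 Set.right_mem_uIcc⟩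

/-- Uniqueness of integral curves on compact intervals. -/
theorem eq_of_isMIntegralCurveOn {v : ∀ x : M, TangentSpace (𝓡 n) x}
    (hv : ContMDiff (𝓡 n) (𝓡 n).tangent 1 (fun x => (⟨x, v x⟩ : TangentBundle (𝓡 n) M)))
    {Γ γ : ℝ → M} {a b t : ℝ} (h0 : (0 : ℝ) ∈ Set.Ioo a b) (ht : t ∈ Set.Ioo a b)
    (hΓ : IsMIntegralCurveOn Γ v (Set.Ioo a b)) (hγ : IsMIntegralCurveOn γ v (Set.uIcc 0 t))
    (h : Γ 0 = γ 0) : Γ t = γ t := by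
  have : IsManifold (𝓡 n) 1 M := IsManifold.of_le (n := ∞) (by simp)
  obtain ⟨Γ', a', b', h0', ht', h1, h2, h3⟩ := exists_extend_curve_uIcc hv hγ
  rw [← h3]
  refine isMIntegralCurveOn_Ioo_eqOn_of_contMDiff_boundaryless (I := 𝓡 n) (t₀ := 0) (a := max a a')
    (b := min b b') ⟨max_lt h0.1 h0'.1, lt_min h0.2 h0'.2⟩ hv
    (hΓ.mono (Set.Ioo_subset_Ioo (le_max_left _ _) (min_le_left _ _)))
    (h1.mono (Set.Ioo_subset_Ioo (le_max_right _ _) (min_le_right _ _))) (h.trans h2.symm)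
    ⟨max_lt ht.1 ht'.1, lt_min ht.2 ht'.2⟩

end Curves

end StarReduction

/-! ### The flow on the constraint surface and the flow parameter -/

namespace StarReduction

variable {n : ℕ} {P : Type*} [TopologicalSpace P] [ChartedSpace (E (n + 2)) P] {U : Opens P}
  {C : Type*} [TopologicalSpace C] [ChartedSpace (E (n + 1)) C] {K : Constraint n U C}
  {Q : Type*} [TopologicalSpace Q] [ChartedSpace (E n) Q]
  {Ω : TwoForm (n + 2) P}

namespace Constraint

variable (K Ω) in
/-- The Hamiltonian vector field of the constraint function is smooth along the constraint
surface. -/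
def SmoothLeaves : Prop :=
  ∀ u : Sm (n + 1) C, ∃ g : Sm (n + 1) C, ∀ c, g.1 c = Sm.d u c (K.leafVec Ω c)

theorem FlowsTo.exists_mul {x y : C} {T : ℝ} (h : K.FlowsTo Ω x T y) {r : ℝ}
    (hr : r ∈ Set.Icc (0 : ℝ) 1) : ∃ y', K.FlowsTo Ω x (r * T) y' := by
  obtain ⟨γ, h0, -, hγ⟩ := h
  refine ⟨γ (r * T), γ, h0, rfl, hγ.mono (Set.uIcc_subset_uIcc_left ?_)⟩
  rw [Set.mem_uIcc]
  rcases le_total 0 T with hT | hT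
  · exact Or.inl ⟨mul_nonneg hr.1 hT, mul_le_of_le_one_left hT hr.2⟩
  · exact Or.inr ⟨by nlinarith [hr.2], mul_nonpos_of_nonneg_of_nonpos hr.1 hT⟩

variable [T2Space C] [IsManifold (𝓡 (n + 1)) ∞ C] [T2Space P] [IsManifold (𝓡 (n + 2)) ∞ P]

/-- The derivative of `u` along `X_J` is the restriction of the bracket of `p u` with `J`. That
bracket is `-i` times the antisymmetric part of `M_1`, which takes smooth functions to smooth
functions. -/
theorem smoothLeaves (hΩ : Ω.IsSymplectic) {B : ℕ → Sm (n + 2) U → Sm (n + 2) U → Sm (n + 2) U}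
    (hB : IsStarProduct (formOn Ω U) B) (p : Prolongation K) : K.SmoothLeaves Ω := by
  intro u
  refine ⟨K.res (-Complex.I • (B 1 (p.p u) K.JC - B 1 K.JC (p.p u))), fun c => ?_⟩
  rw [← p.res_p u, ← K.poisson_JC hΩ p]
  have h := hB.first (p.p u) K.JC (K.ι c)
  rw [p.res_p]
  change -Complex.I * ((B 1 (p.p u) K.JC).1 (K.ι c) - (B 1 K.JC (p.p u)).1 (K.ι c)) = _
  rw [h, ← mul_assoc]
  simp

/-- Integral curves are tested on functions, and functions on `C` and on `U` are exchanged by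
restriction and prolongation. Continuity transfers because `ι` is an embedding. -/
theorem flowsTo_iff (hΩ : Ω.IsSymplectic) (p : Prolongation K) {x y : C} {T : ℝ} :
    K.FlowsTo Ω x T y ↔ ∃ γ : ℝ → C, γ 0 = x ∧ γ T = y ∧
      IsMIntegralCurveOn (I := 𝓡 (n + 1)) γ (K.leafVec Ω) (Set.uIcc 0 T) := by
  have hι := K.ι_embedding.isEmbedding
  refine exists_congr fun γ => and_congr_right fun _ => and_congr_right fun _ => ?_
  rw [isMIntegralCurveOn_iff, isMIntegralCurveOn_iff]
  refine forall₂_congr fun t _ => and_congr ?_ ⟨fun h f => ?_, fun h f => ?_⟩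
  · exact (hι.isInducing.continuousWithinAt_iff).symm
  · have := h (p.p f)
    rw [← K.dι_leafVec hΩ p, ← K.d_res, p.res_p] at this
    convert this using 2 with τ
    rw [← p.res_p f]
    simp only [p.res_p]
    exact congrArg (fun u : Sm (n + 1) C => u.1 (γ τ)) (p.res_p f).symm
  · rw [← K.dι_leafVec hΩ p, ← K.d_res]
    exact h (K.res f)

theorem FlowsTo.apply_eq (hΩ : Ω.IsSymplectic) (p : Prolongation K) {x y : C} {T : ℝ}
    (h : K.FlowsTo Ω x T y) (f : Sm (n + 1) C) (a : ℂ)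
    (hf : ∀ c, Sm.d f c (K.leafVec Ω c) = a) : f.1 y = f.1 x + a * T := by
  obtain ⟨γ, rfl, rfl, hγ⟩ := (flowsTo_iff hΩ p).1 h
  have h1 : ∀ t ∈ Set.uIcc 0 T, HasDerivWithinAt (fun τ : ℝ => f.1 (γ τ) - a * (τ : ℂ)) 0
      (Set.uIcc 0 T) t := by
    intro t ht
    have h2 := (isMIntegralCurveOn_iff.1 hγ t ht).2 f
    rw [hf] at h2
    have h3 : HasDerivWithinAt (fun τ : ℝ => a * (τ : ℂ)) (a * 1) (Set.uIcc 0 T) t :=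
      (Complex.ofRealCLM.hasDerivAt.hasDerivWithinAt).const_mul a
    have h4 := h2.sub h3
    rw [mul_one, sub_self] at h4
    exact h4
  have h4 := (convex_uIcc (0 : ℝ) T).norm_image_sub_le_of_norm_hasDerivWithin_le (C := 0) h1
    (fun _ _ => by simp) Set.left_mem_uIcc Set.right_mem_uIcc
  rw [zero_mul, norm_le_zero_iff] at h4
  rw [← sub_eq_zero, ← h4]
  push_cast
  ring

theorem FlowsTo.unique {hΩ : Ω.IsSymplectic} {p : Prolongation K}
    (hX : K.SmoothLeaves Ω) {x y y' : C}
    {T : ℝ} (h : K.FlowsTo Ω x T y) (h' : K.FlowsTo Ω x T y') : y = y' := by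
  obtain ⟨γ, h1, rfl, hγ⟩ := (flowsTo_iff hΩ p).1 h
  obtain ⟨γ', h2, rfl, hγ'⟩ := (flowsTo_iff hΩ p).1 h'
  have hv := contMDiff_section_of_forall _ hX
  obtain ⟨Γ, a, b, h0, hT, hΓ, e0, eT⟩ := exists_extend_curve_uIcc hv hγ
  rw [← eT]
  exact eq_of_isMIntegralCurveOn hv h0 hT hΓ hγ' (e0.trans (h1.trans h2.symm))

theorem FlowsTo.flow_eq {hΩ : Ω.IsSymplectic} {p : Prolongation K}
    (hX : K.SmoothLeaves Ω) {x y : C}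
    {T : ℝ} (h : K.FlowsTo Ω x T y) : K.flow Ω T x = y := by
  have h1 : ∃ y, K.FlowsTo Ω x T y := ⟨y, h⟩
  rw [flow, dif_pos h1]
  exact FlowsTo.unique (hΩ := hΩ) (p := p) hX h1.choose_spec h

end Constraint

namespace TransversalSection

variable [T2Space C] [IsManifold (𝓡 (n + 1)) ∞ C] [T2Space P] [IsManifold (𝓡 (n + 2)) ∞ P]
  {R : ReducedPhaseSpace Ω K Q} (σ : TransversalSection R)

/-- The flow parameter as a complex valued function. -/
def tC : Sm (n + 1) C :=
  ⟨fun c => (σ.t c : ℂ), Complex.ofRealCLM.contDiff.contMDiff.comp σ.t_smooth⟩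

/-- The flow parameter has derivative one along the leaves. -/
theorem d_tC (hΩ : Ω.IsSymplectic) (p : Prolongation K)
    (hX : K.SmoothLeaves Ω) (c : C) :
    Sm.d σ.tC c (K.leafVec Ω c) = 1 := by
  obtain ⟨γ, h0, hc, hγ⟩ := (Constraint.flowsTo_iff hΩ p).1 (σ.flowsTo c)
  have hv := contMDiff_section_of_forall _ hX
  obtain ⟨Γ, a, b, m0, mt, hΓ, e0, et⟩ := exists_extend_curve_uIcc hv hγ
  have hn : Set.Ioo a b ∈ 𝓝 (σ.t c) := Ioo_mem_nhds mt.1 mt.2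
  have hder : ∀ f : Sm (n + 1) C, HasDerivAt (fun τ => f.1 (Γ τ)) (Sm.d f c (K.leafVec Ω c)) (σ.t c) := by
    intro f
    have := ((isMIntegralCurveOn_iff.1 hΓ _ mt).2 f).hasDerivAt hn
    rwa [et, hc] at this
  obtain ⟨f, hf⟩ : ∃ f : Sm (n + 1) C, Sm.d f c (K.leafVec Ω c) ≠ 0 := by
    by_contra! h
    exact K.leafVec_ne_zero hΩ p c (Sm.eq_zero_of_d c _ h)
  -- The point `Γ τ` is also reached from the section after time `θ τ`, so `Γ (θ τ) = Γ τ`.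
  -- Differentiating `f ∘ Γ ∘ θ = f ∘ Γ` at `σ.t c`, with `f` of nonzero derivative along the leaf,
  -- gives derivative one for `θ`.
  let θ : ℝ → ℝ := fun τ => σ.t (Γ τ)
  have hθ0 : θ (σ.t c) = σ.t c := by
    simp only [θ, et, hc]
  have hθ : HasDerivAt θ (Sm.d σ.tC c (K.leafVec Ω c)).re (σ.t c) := by
    have := Complex.reCLM.hasFDerivAt.comp_hasDerivAt (σ.t c) (hder σ.tC)
    exact this
  have hloop : ∀ᶠ τ in 𝓝 (σ.t c), f.1 (Γ (θ τ)) = f.1 (Γ τ) := by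
    have h1 : ∀ᶠ τ in 𝓝 (σ.t c), θ τ ∈ Set.Ioo a b :=
      hθ.continuousAt.eventually_mem (by rwa [hθ0])
    filter_upwards [hn, h1] with τ hτ hτ'
    have h2 : K.FlowsTo Ω (Γ 0) τ (Γ τ) :=
      (Constraint.flowsTo_iff hΩ p).2 ⟨Γ, rfl, rfl, hΓ.mono (by
        exact Set.ordConnected_Ioo.uIcc_subset m0 hτ)⟩
    have h3 : R.π (Γ τ) = R.π c := by
      rw [← (R.fibers _ _).2 ⟨τ, h2⟩, e0, h0, σ.π_s]
    obtain ⟨γ', k0, k1, hγ'⟩ := (Constraint.flowsTo_iff hΩ p).1 (σ.flowsTo (Γ τ))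
    rw [eq_of_isMIntegralCurveOn hv m0 hτ' hΓ hγ' (by rw [e0, h0, k0, h3])]
    exact congrArg f.1 k1
  have h5 := hder f
  rw [← hθ0] at h5
  have h6 := h5.scomp (σ.t c) hθ
  have h7 := h6.unique ((hder f).congr_of_eventuallyEq hloop)
  have h8 : (Sm.d σ.tC c (K.leafVec Ω c)).re = 1 := by
    rw [Complex.real_smul] at h7
    exact_mod_cast mul_right_cancel₀ hf (h7.trans (one_mul _).symm)
  have h9 : (Sm.d σ.tC c (K.leafVec Ω c)).im = 0 := by
    have := Complex.imCLM.hasFDerivAt.comp_hasDerivAt (σ.t c) (hder σ.tC)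
    refine this.unique ?_
    exact hasDerivAt_const _ _
  exact Complex.ext h8 h9

theorem t_of_flowsTo (hΩ : Ω.IsSymplectic) (p : Prolongation K)
    (hX : K.SmoothLeaves Ω) {x y : C}
    {T : ℝ} (h : K.FlowsTo Ω x T y) : σ.t y = σ.t x + T := by
  have := h.apply_eq hΩ p σ.tC 1 (σ.d_tC hΩ p hX)
  rw [one_mul] at this
  exact Complex.ofReal_injective (this.trans (Complex.ofReal_add _ _).symm)

theorem t_s (hΩ : Ω.IsSymplectic) (p : Prolongation K)
    (hX : K.SmoothLeaves Ω) (q : Q) :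
    σ.t (σ.s q) = 0 := by
  have h := σ.t_of_flowsTo hΩ p hX (σ.flowsTo (σ.s q))
  rw [σ.π_s] at h
  linarith

/-- The section and the flow parameter determine the flow of the points of the section. -/
theorem flowsTo_s_iff (hΩ : Ω.IsSymplectic) (p : Prolongation K)
    (hX : K.SmoothLeaves Ω) {q : Q}
    {T : ℝ} {y : C} : K.FlowsTo Ω (σ.s q) T y ↔ R.π y = q ∧ σ.t y = T := by
  constructor
  · intro h
    refine ⟨?_, ?_⟩
    · rw [← (R.fibers _ _).2 ⟨T, h⟩, σ.π_s]
    · rw [σ.t_of_flowsTo hΩ p hX h, σ.t_s hΩ p hX, zero_add]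
  · rintro ⟨rfl, rfl⟩
    exact σ.flowsTo y

end TransversalSection

end StarReduction

/-! ### Integration along the leaves -/

namespace StarReduction

namespace TransversalSection

variable {n : ℕ} {P : Type*} [TopologicalSpace P] [ChartedSpace (E (n + 2)) P] {U : Opens P}
  {C : Type*} [TopologicalSpace C] [ChartedSpace (E (n + 1)) C] {K : Constraint n U C}
  {Q : Type*} [TopologicalSpace Q] [ChartedSpace (E n) Q]
  [T2Space C] [IsManifold (𝓡 (n + 1)) ∞ C] [T2Space P] [IsManifold (𝓡 (n + 2)) ∞ P]
  {Ω : TwoForm (n + 2) P} {R : ReducedPhaseSpace Ω K Q} (σ : TransversalSection R)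

/-- The leaf through a point, parametrized by the flow parameter. -/
theorem exists_leaf_curve (hΩ : Ω.IsSymplectic) (p : Prolongation K) (hX : K.SmoothLeaves Ω) (c : C) :
    ∃ (Γ : ℝ → C) (a b : ℝ), (0 : ℝ) ∈ Set.Ioo a b ∧ σ.t c ∈ Set.Ioo a b ∧ Γ (σ.t c) = c ∧
      IsMIntegralCurveOn (I := 𝓡 (n + 1)) Γ (K.leafVec Ω) (Set.Ioo a b) ∧
      ∀ τ ∈ Set.Ioo a b, K.flow Ω τ (σ.s (R.π c)) = Γ τ ∧ R.π (Γ τ) = R.π c ∧ σ.t (Γ τ) = τ := by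
  obtain ⟨γ, h0, hc, hγ⟩ := (Constraint.flowsTo_iff hΩ p).1 (σ.flowsTo c)
  obtain ⟨Γ, a, b, m0, mt, hΓ, e0, et⟩ :=
    exists_extend_curve_uIcc (contMDiff_section_of_forall _ hX) hγ
  refine ⟨Γ, a, b, m0, mt, et.trans hc, hΓ, fun τ hτ => ?_⟩
  have h1 : K.FlowsTo Ω (σ.s (R.π c)) τ (Γ τ) :=
    (Constraint.flowsTo_iff hΩ p).2 ⟨Γ, e0.trans h0, rfl,
      hΓ.mono (Set.ordConnected_Ioo.uIcc_subset m0 hτ)⟩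
  exact ⟨h1.flow_eq (hΩ := hΩ) (p := p) hX, (σ.flowsTo_s_iff hΩ p hX).1 h1⟩

/-- The integral of a function along the leaves, starting at the section. -/
def leafInt (w : Sm (n + 1) C) (c : C) : ℂ :=
  -Complex.I * ∫ τ in (0 : ℝ)..σ.t c, w.1 (K.flow Ω τ (σ.s (R.π c)))

theorem leafInt_s (hΩ : Ω.IsSymplectic) (p : Prolongation K) (hX : K.SmoothLeaves Ω)
    (w : Sm (n + 1) C) (q : Q) : σ.leafInt w (σ.s q) = 0 := by
  rw [leafInt, σ.t_s hΩ p hX, intervalIntegral.integral_same, mul_zero]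

/-- Functions constant along the leaves can be taken out of the integral. -/
theorem leafInt_congr (hΩ : Ω.IsSymplectic) (p : Prolongation K) (hX : K.SmoothLeaves Ω)
    (w w' : Sm (n + 1) C) (a : ℂ) (c : C) (h : ∀ c', R.π c' = R.π c → w.1 c' = a * w'.1 c') :
    σ.leafInt w c = a * σ.leafInt w' c := by
  obtain ⟨Γ, b, b', m0, mt, -, -, h1⟩ := σ.exists_leaf_curve hΩ p hX c
  rw [leafInt, leafInt, mul_left_comm, ← intervalIntegral.integral_const_mul a]
  congr 1
  refine intervalIntegral.integral_congr fun r hr => ?_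
  obtain ⟨h2, h3, -⟩ := h1 r (Set.ordConnected_Ioo.uIcc_subset m0 mt hr)
  change w.1 _ = a * w'.1 _
  rw [h2]
  exact h _ h3

theorem continuousOn_leaf (hΩ : Ω.IsSymplectic) (p : Prolongation K) (hX : K.SmoothLeaves Ω) (w : Sm (n + 1) C)
    (c : C) : ContinuousOn (fun τ => w.1 (K.flow Ω τ (σ.s (R.π c)))) (Set.uIcc 0 (σ.t c)) := by
  obtain ⟨Γ, a, b, m0, mt, -, hΓ, h⟩ := σ.exists_leaf_curve hΩ p hX c
  have h1 : ContinuousOn Γ (Set.Ioo a b) := fun τ hτ => (isMIntegralCurveOn_iff.1 hΓ τ hτ).1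
  have h2 := (Set.ordConnected_Ioo (a := a) (b := b)).uIcc_subset m0 mt
  refine ((Sm.continuous w).comp_continuousOn (h1.mono h2)).congr fun τ hτ => ?_
  exact congrArg w.1 (h τ (h2 hτ)).1

variable [IsManifold (𝓡 n) ∞ Q]

/-- The functions `q, τ ↦ w(Φ_τ(s(q)))` are smooth. -/
theorem exists_contDiffOn_flow (hΩ : Ω.IsSymplectic) (p : Prolongation K) (hX : K.SmoothLeaves Ω)
    (w : Sm (n + 1) C) (y : C) :
    ∃ V : Set (E n × ℝ), IsOpen V ∧ (chartAt (E n) (R.π y) (R.π y), σ.t y) ∈ V ∧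
      ContDiffOn ℝ ∞ (fun z : E n × ℝ =>
        w.1 (K.flow Ω z.2 (σ.s ((chartAt (E n) (R.π y)).symm z.1)))) V := by
  set φ := chartAt (E (n + 1)) y with hφ
  set ψ := chartAt (E n) (R.π y) with hψ
  -- This is `(π, t)` in charts. It is a local diffeomorphism, and its local inverse sends `(q, τ)`
  -- to the point reached from `s q` after time `τ`.
  let f : E (n + 1) → E n × ℝ := fun x => (ψ (R.π (φ.symm x)), σ.t (φ.symm x))
  have hy : φ y ∈ φ.target := mem_chart_target _ y
  have hWo : IsOpen (φ.target ∩ φ.symm ⁻¹' (R.π ⁻¹' ψ.source)) :=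
    φ.isOpen_inter_preimage_symm (ψ.open_source.preimage R.π_smooth.continuous)
  have hyW : φ y ∈ φ.target ∩ φ.symm ⁻¹' (R.π ⁻¹' ψ.source) := by
    refine ⟨hy, ?_⟩
    change R.π (φ.symm (φ y)) ∈ ψ.source
    rw [φ.left_inv (mem_chart_source _ y)]
    exact mem_chart_source _ _
  have hf : ContDiffOn ℝ ∞ f (φ.target ∩ φ.symm ⁻¹' (R.π ⁻¹' ψ.source)) := by
    have h1 : ContMDiffOn 𝓘(ℝ, E (n + 1)) (𝓡 (n + 1)) ∞ φ.symm φ.target :=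
      contMDiffOn_chart_symm (I := 𝓡 (n + 1)) (x := y)
    have h2 : ContMDiffOn (𝓡 n) 𝓘(ℝ, E n) ∞ ψ ψ.source := contMDiffOn_chart (I := 𝓡 n)
    rw [← contMDiffOn_iff_contDiffOn]
    refine ContMDiffOn.prodMk_space ?_ ?_
    · exact h2.comp ((R.π_smooth.comp_contMDiffOn h1).mono Set.inter_subset_left) fun x hx => hx.2
    · exact (σ.t_smooth.comp_contMDiffOn h1).mono Set.inter_subset_left
  let A : E (n + 1) →L[ℝ] E n := mfderiv (𝓡 (n + 1)) (𝓡 n) R.π y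
  let l : E (n + 1) →L[ℝ] ℝ := mfderiv (𝓡 (n + 1)) 𝓘(ℝ, ℝ) σ.t y
  have hA : HasFDerivAt (fun x => ψ (R.π (φ.symm x))) A (φ y) := by
    have := (R.π_smooth.mdifferentiableAt (by simp) (x := y)).hasMFDerivAt.2
    simp only [mfld_simps] at this
    have h' : HasFDerivWithinAt (fun x => ψ (R.π (φ.symm x))) A Set.univ (φ y) := this
    exact h'.hasFDerivAt Filter.univ_mem
  have hl : HasFDerivAt (fun x => σ.t (φ.symm x)) l (φ y) := by
    have := (σ.t_smooth.mdifferentiableAt (by simp) (x := y)).hasMFDerivAt.2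
    simp only [mfld_simps] at this
    have h' : HasFDerivWithinAt (fun x => σ.t (φ.symm x)) l Set.univ (φ y) := this
    exact h'.hasFDerivAt Filter.univ_mem
  -- The kernel of the differential of `π` is spanned by `X_J`, on which `dt` takes the value one.
  have hinj : Function.Injective (A.prod l) := by
    rw [injective_iff_map_eq_zero]
    intro ξ hξ
    obtain ⟨a, ha⟩ := K.exists_smul_leafVec hΩ p R y ξ (congrArg Prod.fst hξ)
    have h1 : l ξ = 0 := congrArg Prod.snd hξ
    have h2 : Sm.d σ.tC y ξ = 0 := by
      have := Sm.ofReal_d σ.t σ.t_smooth y ξ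
      refine this.trans ?_
      exact congrArg Complex.ofReal h1
    rw [ha, map_smul, σ.d_tC hΩ p hX, Complex.real_smul, mul_one, Complex.ofReal_eq_zero] at h2
    rw [ha, h2]
    exact zero_smul ℝ (K.leafVec Ω y)
  have hfin : Module.finrank ℝ (E (n + 1)) = Module.finrank ℝ (E n × ℝ) := by
    simp
  let L : E (n + 1) ≃L[ℝ] E n × ℝ :=
    (LinearEquiv.ofInjectiveOfFinrankEq (A.prod l).toLinearMap hinj hfin).toContinuousLinearEquiv
  have hL : HasFDerivAt f (L : E (n + 1) →L[ℝ] E n × ℝ) (φ y) := hA.prodMk hl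
  obtain ⟨V, g, hV, hfV, hg, hgf, hgV⟩ := exists_local_inverse hWo hyW hf hL
  have hfy : f (φ y) = (ψ (R.π y), σ.t y) := by
    simp only [f, φ.left_inv (mem_chart_source _ y)]
  rw [hfy] at hfV
  refine ⟨V ∩ (Prod.fst ⁻¹' ψ.target), hV.inter (ψ.open_target.preimage continuous_fst), ⟨hfV, mem_chart_target _ _⟩, ?_⟩
  have h3 : ContDiffOn ℝ ∞ (fun z => w.1 (φ.symm (g z))) V :=
    (contDiffOn_comp_chart_symm (Sm.contMDiff w) y).comp hg fun z hz => (hgV z hz).1.1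
  refine (h3.mono Set.inter_subset_left).congr fun z hz => ?_
  have h4 := (hgV z hz.1).2
  have h5 : K.FlowsTo Ω (σ.s (ψ.symm z.1)) z.2 (φ.symm (g z)) := by
    refine (σ.flowsTo_s_iff hΩ p hX).2 ⟨?_, congrArg Prod.snd h4⟩
    rw [← congrArg Prod.fst h4]
    exact (ψ.left_inv (hgV z hz.1).1.2).symm
  change w.1 (K.flow Ω z.2 (σ.s (ψ.symm z.1))) = _
  rw [h5.flow_eq (hΩ := hΩ) (p := p) hX]

theorem contMDiff_leafInt (hΩ : Ω.IsSymplectic) (p : Prolongation K) (hX : K.SmoothLeaves Ω)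
    (w : Sm (n + 1) C) : ContMDiff (𝓡 (n + 1)) 𝓘(ℝ, ℂ) ∞ (σ.leafInt w) := by
  intro c
  set ψ := chartAt (E n) (R.π c) with hψ
  let F : E n × ℝ → ℂ := fun z => w.1 (K.flow Ω z.2 (σ.s (ψ.symm z.1)))
  have hF : ∀ y, R.π y = R.π c → ∃ V : Set (E n × ℝ), IsOpen V ∧ (ψ (R.π c), σ.t y) ∈ V ∧
      ContDiffOn ℝ ∞ F V := by
    intro y hy
    have := σ.exists_contDiffOn_flow hΩ p hX w y
    rwa [hy] at this
  choose! V hVo hV hFV using hF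
  -- Smoothness is known near `(π c, t y)` for each `y` of the leaf; the union of these
  -- neighbourhoods contains the whole path of integration.
  let W : Set (E n × ℝ) := ⋃ y ∈ {y | R.π y = R.π c}, V y
  have hW : IsOpen W := isOpen_biUnion fun y hy => hVo y hy
  have hFW : ContDiffOn ℝ ∞ F W := by
    intro z hz
    obtain ⟨y, hy, hzy⟩ := Set.mem_iUnion₂.1 hz
    exact ((hFV y hy z hzy).contDiffAt ((hVo y hy).mem_nhds hzy)).contDiffWithinAt
  -- The substitution `τ = r t(c')` makes the bounds of integration constant.
  let m : (E n × ℝ) × ℝ → E n × ℝ := fun x => (x.1.1, x.2 * x.1.2)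
  have hm : ContDiff ℝ ∞ m :=
    (contDiff_fst.comp contDiff_fst).prodMk (contDiff_snd.mul (contDiff_snd.comp contDiff_fst))
  have h0 : ∀ r ∈ Set.Icc (0 : ℝ) 1, ((ψ (R.π c), σ.t c), r) ∈ m ⁻¹' W := by
    intro r hr
    obtain ⟨y, hy⟩ := (σ.flowsTo c).exists_mul hr
    obtain ⟨h1, h2⟩ := (σ.flowsTo_s_iff hΩ p hX).1 hy
    refine Set.mem_iUnion₂.2 ⟨y, h1, ?_⟩
    have := hV y h1
    rwa [h2] at this
  obtain ⟨u, hu, hcu, -, hG⟩ := contDiffOn_parametric_integral (hW.preimage hm.continuous) h0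
    (hFW.comp hm.contDiffOn fun x hx => hx)
  have h1 : ∀ᶠ c' in 𝓝 c, σ.leafInt w c' = -Complex.I * ((σ.t c' : ℂ) *
      ∫ r in (0 : ℝ)..1, F (m ((ψ (R.π c'), σ.t c'), r))) := by
    filter_upwards [R.π_smooth.continuous.continuousAt.eventually_mem
      (ψ.open_source.mem_nhds (mem_chart_source _ (R.π c)))] with c' hc'
    have h2 := intervalIntegral.smul_integral_comp_mul_right (a := 0) (b := 1)
      (fun τ => w.1 (K.flow Ω τ (σ.s (R.π c')))) (σ.t c')
    rw [zero_mul, one_mul] at h2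
    rw [leafInt, ← h2, Complex.real_smul]
    simp only [F, m, ψ.left_inv hc']
  refine ContMDiffAt.congr_of_eventuallyEq ?_ h1
  have h3 : ContMDiffAt (𝓡 (n + 1)) 𝓘(ℝ, E n × ℝ) ∞ (fun c' => (ψ (R.π c'), σ.t c')) c := by
    refine ContMDiffAt.prodMk_space ?_ (σ.t_smooth c)
    exact ((contMDiffOn_chart (I := 𝓡 n) (x := R.π c)).contMDiffAt
      (ψ.open_source.mem_nhds (mem_chart_source _ (R.π c)))).comp c (R.π_smooth c)
  have h4 : ContDiffAt ℝ ∞ (fun x : E n × ℝ => -Complex.I * ((x.2 : ℂ) *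
      ∫ r in (0 : ℝ)..1, F (m (x, r)))) (ψ (R.π c), σ.t c) :=
    contDiffAt_const.mul ((Complex.ofRealCLM.contDiff.comp contDiff_snd).contDiffAt.mul
      ((hG _ hcu).contDiffAt (hu.mem_nhds hcu)))
  exact ContMDiffAt.comp (I' := 𝓘(ℝ, E n × ℝ)) (f := fun c' => (ψ (R.π c'), σ.t c')) c
    h4.contMDiffAt h3

/-- Integration along the leaves as a linear operator. -/
def leafIntL (hΩ : Ω.IsSymplectic) (p : Prolongation K) (hX : K.SmoothLeaves Ω) :
    Sm (n + 1) C →ₗ[ℂ] Sm (n + 1) C where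
  toFun w := ⟨σ.leafInt w, σ.contMDiff_leafInt hΩ p hX w⟩
  map_add' w w' := Sm.ext fun c => by
    change -Complex.I * (∫ τ in (0 : ℝ)..σ.t c, (w.1 (K.flow Ω τ (σ.s (R.π c)))
      + w'.1 (K.flow Ω τ (σ.s (R.π c))))) = σ.leafInt w c + σ.leafInt w' c
    rw [intervalIntegral.integral_add (σ.continuousOn_leaf hΩ p hX w c).intervalIntegrable
      (σ.continuousOn_leaf hΩ p hX w' c).intervalIntegrable, mul_add]
    rfl
  map_smul' a w := Sm.ext fun c => by
    change -Complex.I * (∫ τ in (0 : ℝ)..σ.t c, a * w.1 (K.flow Ω τ (σ.s (R.π c))))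
      = a * σ.leafInt w c
    rw [intervalIntegral.integral_const_mul, leafInt]
    ring

/-- Along the leaf curve `Γ` the base point on the section is fixed and the upper bound `t (Γ τ)` is
`τ`, so this is the fundamental theorem of calculus. -/
theorem d_leafIntL (hΩ : Ω.IsSymplectic) (p : Prolongation K) (hX : K.SmoothLeaves Ω)
    (w : Sm (n + 1) C) (c : C) :
    Sm.d (σ.leafIntL hΩ p hX w) c (K.leafVec Ω c) = -Complex.I * w.1 c := by
  obtain ⟨Γ, a, b, m0, mt, hc, hΓ, h⟩ := σ.exists_leaf_curve hΩ p hX c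
  have hn : Set.Ioo a b ∈ 𝓝 (σ.t c) := Ioo_mem_nhds mt.1 mt.2
  have h1 := ((isMIntegralCurveOn_iff.1 hΓ _ mt).2 (σ.leafIntL hΩ p hX w)).hasDerivAt hn
  rw [hc] at h1
  have h2 : ContinuousOn (fun τ => w.1 (Γ τ)) (Set.Ioo a b) :=
    (Sm.continuous w).comp_continuousOn fun τ hτ => (isMIntegralCurveOn_iff.1 hΓ τ hτ).1
  have h3 : HasDerivAt (fun τ => ∫ r in (0 : ℝ)..τ, w.1 (Γ r)) (w.1 (Γ (σ.t c))) (σ.t c) :=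
    intervalIntegral.integral_hasDerivAt_right
      (h2.mono (Set.ordConnected_Ioo.uIcc_subset m0 mt)).intervalIntegrable
      (h2.stronglyMeasurableAtFilter isOpen_Ioo _ mt) (h2.continuousAt hn)
  rw [hc] at h3
  refine h1.unique ((h3.const_mul (-Complex.I)).congr_of_eventuallyEq ?_)
  filter_upwards [hn] with τ hτ
  obtain ⟨-, h5, h6⟩ := h τ hτ
  change σ.leafInt w (Γ τ) = _
  rw [leafInt, h5, h6]
  congr 1
  refine intervalIntegral.integral_congr fun r hr => ?_
  exact congrArg w.1 (h r (Set.ordConnected_Ioo.uIcc_subset m0 hτ hr)).1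

end TransversalSection

end StarReduction

/-! ### From the geometric data to the formal reduction -/

namespace StarReduction

namespace FormalConstraint

variable {A B : Type*} [CommRing A] [Algebra ℂ A] [CommRing B] [Algebra ℂ B]
  (d : FormalConstraint A B)

/-- In each summand the index drops by at least two: by `j ≥ 2` in the first sum, by `i + j ≥ 2` in
the second. This makes the recursion for `S` well founded. -/
theorem Fop_congr {x y : ℕ → A} {k : ℕ} (h : ∀ j ≤ k, x j = y j) :
    d.Fop x (k + 2) = d.Fop y (k + 2) := by
  rw [Fop, Fop]
  congr 1
  · refine Finset.sum_congr rfl fun j hj => ?_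
    rw [Finset.mem_Icc] at hj
    rw [h _ (by omega)]
  · refine Finset.sum_congr rfl fun i hi => Finset.sum_congr rfl fun j hj => ?_
    rw [Finset.mem_Icc] at hi hj
    rw [h _ (by omega)]

theorem Fop_add (x y : ℕ → A) (k : ℕ) : d.Fop (fun j => x j + y j) k = d.Fop x k + d.Fop y k := by
  simp only [Fop, map_add, Finset.sum_add_distrib]
  abel

theorem Fop_smul (a : ℂ) (x : ℕ → A) (k : ℕ) : d.Fop (fun j => a • x j) k = a • d.Fop x k := by
  simp only [Fop, map_smul, smul_add, Finset.smul_sum]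

end FormalConstraint

variable {n : ℕ} {P : Type*} [TopologicalSpace P] [ChartedSpace (E (n + 2)) P] {U : Opens P}
  {C : Type*} [TopologicalSpace C] [ChartedSpace (E (n + 1)) C] {K : Constraint n U C}
  {Q : Type*} [TopologicalSpace Q] [ChartedSpace (E n) Q]
  {Ω : TwoForm (n + 2) P} {B : ℕ → Sm (n + 2) U → Sm (n + 2) U → Sm (n + 2) U}

namespace Prolongation

variable (p : Prolongation K) {R : ReducedPhaseSpace Ω K Q}

theorem SUpTo_eq (σ : TransversalSection R) {k j : ℕ} (h : j ≤ k) : p.SUpTo B σ k j = p.S B σ j := by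
  induction k with
  | zero => rw [Nat.le_zero.1 h, S]
  | succ k ih =>
    rcases h.eq_or_lt with rfl | h
    · rw [S]
    · rw [SUpTo, Function.update_of_ne (by omega), ih (by omega)]

variable [T2Space P] [IsManifold (𝓡 (n + 2)) ∞ P]

theorem compJ_spec (f : Sm (n + 2) U) : f - p.p (K.res f) = p.compJ f * K.JC :=
  Classical.epsilon_spec (p := fun h => f - p.prolFun f = h * K.JC) (K.existsUnique_comp p f).exists

theorem compJ_eq {f h : Sm (n + 2) U} (hh : f - p.p (K.res f) = h * K.JC) : p.compJ f = h :=
  (K.existsUnique_comp p f).unique (p.compJ_spec f) hh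

/-- The component along the constraint function as a linear map. -/
def compL : Sm (n + 2) U →ₗ[ℂ] Sm (n + 2) U where
  toFun := p.compJ
  map_add' f g := p.compJ_eq (by
    rw [add_mul, ← p.compJ_spec, ← p.compJ_spec, map_add, map_add]
    ring)
  map_smul' a f := p.compJ_eq (by
    rw [RingHom.id_apply, smul_mul_assoc, ← p.compJ_spec, map_smul, map_smul, smul_sub])

/-- The formal constraint given by a star product on `U` and a prolongation. -/
def formalConstraint (hB : IsStarProduct (formOn Ω U) B) :
    FormalConstraint (Sm (n + 2) U) (Sm (n + 1) C) where
  toFormalStar := hB.formalStar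
  res := K.res
  p := p.p
  res_p := p.res_p
  J := K.JC
  res_J := K.res_JC
  regular := K.regular
  comp := p.compL
  comp_spec := p.compJ_spec

theorem T_eq (hB : IsStarProduct (formOn Ω U) B) (k : ℕ) (f : Sm (n + 2) U) :
    p.T B k f = (p.formalConstraint hB).T k f := by
  induction k using Nat.strong_induction_on generalizing f with
  | _ k ih =>
    rcases k with _ | k
    · rw [T, FormalConstraint.T]; rfl
    · rw [T, FormalConstraint.T]
      simp only [LinearMap.neg_apply, LinearMap.sum_apply, LinearMap.comp_apply]
      congr 1
      refine Finset.sum_congr rfl fun j _ => ?_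
      rw [ih _ (by omega)]
      rfl

theorem act_T (hB : IsStarProduct (formOn Ω U) B) (f : (Sm (n + 2) U)⟦X⟧) :
    act (p.T B) f = ser (p.formalConstraint hB).T f := by
  ext k
  simp only [act, coeff_ser, PowerSeries.coeff_mk, p.T_eq hB]

theorem Fop_eq (hB : IsStarProduct (formOn Ω U) B) (S : ℕ → Sm (n + 2) U → Sm (n + 2) U) (k : ℕ)
    (f : Sm (n + 2) U) : p.Fop B S k f = (p.formalConstraint hB).Fop (fun j => S j f) k := by
  rw [Fop, FormalConstraint.Fop]
  simp only [p.T_eq hB]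
  rfl

/-- The derivative along the leaves. -/
def leafDer (hB : IsStarProduct (formOn Ω U) B) : Sm (n + 1) C →ₗ[ℂ] Sm (n + 1) C :=
  Complex.I • (K.res.toLinearMap ∘ₗ (p.formalConstraint hB).commJ 1 ∘ₗ p.p.toLinearMap)

variable (σ : TransversalSection R)

theorem leafIntegral_eq (hB : IsStarProduct (formOn Ω U) B)
    (S : ℕ → Sm (n + 2) U → Sm (n + 2) U) (k : ℕ) (f : Sm (n + 2) U) :
    p.leafIntegral B σ S k f
      = σ.leafInt (K.res ((p.formalConstraint hB).Fop (fun j => S j f) (k + 1))) := by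
  rw [← p.Fop_eq hB]
  rfl

variable [T2Space C] [IsManifold (𝓡 (n + 1)) ∞ C] [IsManifold (𝓡 n) ∞ Q]

theorem res_commJ (hΩ : Ω.IsSymplectic) (hB : IsStarProduct (formOn Ω U) B) (f : Sm (n + 2) U)
    (c : C) : (K.res ((p.formalConstraint hB).commJ 1 f)).1 c
      = -Complex.I * Sm.d (K.res f) c (K.leafVec Ω c) := by
  have h := hB.first f K.JC (K.ι c)
  rw [K.poisson_JC hΩ p] at h
  rw [neg_mul, ← h]
  exact (neg_sub _ _).symm

theorem leafDer_apply (hΩ : Ω.IsSymplectic) (hB : IsStarProduct (formOn Ω U) B) (u : Sm (n + 1) C)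
    (c : C) : (p.leafDer hB u).1 c = Sm.d u c (K.leafVec Ω c) := by
  change Complex.I * (K.res ((p.formalConstraint hB).commJ 1 (p.p u))).1 c = _
  rw [p.res_commJ hΩ, p.res_p, ← mul_assoc]
  simp

theorem contMDiff_leafIntegral (hΩ : Ω.IsSymplectic) (hB : IsStarProduct (formOn Ω U) B)
    (S : ℕ → Sm (n + 2) U → Sm (n + 2) U) (k : ℕ) (f : Sm (n + 2) U) :
    ContMDiff (𝓡 (n + 1)) 𝓘(ℝ, ℂ) ∞ (p.leafIntegral B σ S k f) := by
  rw [p.leafIntegral_eq σ hB]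
  exact σ.contMDiff_leafInt hΩ p (K.smoothLeaves hΩ hB p) _

/-- The truncated list `SUpTo k` may be replaced by all of `S`, since only members of index at most
`k` enter; and `Sm.ofFun` does not take its default value, since leaf integrals are smooth. -/
theorem S_succ (hΩ : Ω.IsSymplectic) (hB : IsStarProduct (formOn Ω U) B) (k : ℕ)
    (f : Sm (n + 2) U) : p.S B σ (k + 1) f = p.p (σ.leafIntL hΩ p (K.smoothLeaves hΩ hB p)
      (K.res ((p.formalConstraint hB).Fop (fun j => p.S B σ j f) (k + 2)))) := by
  rw [S, SUpTo, Function.update_self]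
  congr 1
  refine Sm.ext fun c => ?_
  rw [Sm.ofFun_apply (p.contMDiff_leafIntegral σ hΩ hB _ _ _), p.leafIntegral_eq σ hB,
    (p.formalConstraint hB).Fop_congr (y := fun j => p.S B σ j f)
      fun j hj => by rw [p.SUpTo_eq σ hj]]
  rfl

theorem S_add (hΩ : Ω.IsSymplectic) (hB : IsStarProduct (formOn Ω U) B) (k : ℕ)
    (f g : Sm (n + 2) U) : p.S B σ k (f + g) = p.S B σ k f + p.S B σ k g := by
  induction k using Nat.strong_induction_on with
  | _ k ih =>
    rcases k with _ | k
    · rfl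
    · rw [p.S_succ σ hΩ hB, p.S_succ σ hΩ hB, p.S_succ σ hΩ hB,
        (p.formalConstraint hB).Fop_congr (y := fun j => p.S B σ j f + p.S B σ j g)
          fun j hj => ih j (by omega), FormalConstraint.Fop_add, map_add, map_add, map_add]

theorem S_smul (hΩ : Ω.IsSymplectic) (hB : IsStarProduct (formOn Ω U) B) (k : ℕ) (a : ℂ)
    (f : Sm (n + 2) U) : p.S B σ k (a • f) = a • p.S B σ k f := by
  induction k using Nat.strong_induction_on with
  | _ k ih =>
    rcases k with _ | k
    · rfl
    · rw [p.S_succ σ hΩ hB, p.S_succ σ hΩ hB,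
        (p.formalConstraint hB).Fop_congr (y := fun j => a • p.S B σ j f)
          fun j hj => ih j (by omega), FormalConstraint.Fop_smul, map_smul, map_smul, map_smul]

/-- The formal reduction given by a star product, a prolongation and a transversal section. -/
def formalReduction (hΩ : Ω.IsSymplectic) (hB : IsStarProduct (formOn Ω U) B) :
    FormalReduction (Sm (n + 2) U) (Sm (n + 1) C) (Sm n Q) where
  toFormalConstraint := p.formalConstraint hB
  δ := p.leafDer hB
  res_commJ f := Sm.ext fun c => by
    refine (p.res_commJ hΩ hB f c).trans ?_
    rw [← p.leafDer_apply hΩ hB]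
    rfl
  L := σ.leafIntL hΩ p (K.smoothLeaves hΩ hB p)
  δ_L w := Sm.ext fun c => by
    rw [p.leafDer_apply hΩ hB, σ.d_leafIntL]
    rfl
  π := Sm.pullback R.π R.π_smooth
  s := Sm.pullback σ.s σ.s_smooth
  s_π v := Sm.ext fun q => congrArg v.1 (σ.π_s q)
  s_L w := Sm.ext fun q => σ.leafInt_s hΩ p (K.smoothLeaves hΩ hB p) w q
  δ_π v := Sm.ext fun c => by
    rw [p.leafDer_apply hΩ hB, Sm.d_pullback, K.dπ_leafVec hΩ p, map_zero]
    rfl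
  π_s u hu := Sm.ext fun c => by
    -- A function with vanishing leaf derivative takes the same value at `c` and at the starting
    -- point `s (π c)` of the flow line.
    have h := (σ.flowsTo c).apply_eq hΩ p u 0 fun c => by
      rw [← p.leafDer_apply hΩ hB, hu]
      rfl
    rw [zero_mul, add_zero] at h
    exact h.symm
  S k := ⟨⟨p.S B σ k, p.S_add σ hΩ hB k⟩, p.S_smul σ hΩ hB k⟩
  S_zero := rfl
  S_succ := p.S_succ σ hΩ hB

theorem preStar_eq (hΩ : Ω.IsSymplectic) (hB : IsStarProduct (formOn Ω U) B)
    (f g : (Sm (n + 2) U)⟦X⟧) : p.preStar B σ f g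
      = (p.formalReduction σ hΩ hB).prodS (ser (p.formalReduction σ hΩ hB).S f)
        (ser (p.formalReduction σ hΩ hB).S g) := by
  rw [preStar, p.act_T hB]
  rfl

theorem BStarF_eq (hΩ : Ω.IsSymplectic) (hB : IsStarProduct (formOn Ω U) B) :
    p.BStarF B = (p.formalReduction σ hΩ hB).NF :=
  Set.inter_comm _ _

/-- It suffices to test with `J`: coefficients of elements of `I` are multiples `g J`, and on `C`
the Leibniz rule leaves only `{f, g J} = g {f, J}`. -/
theorem mem_algB_iff (hΩ : Ω.IsSymplectic) (hB : IsStarProduct (formOn Ω U) B)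
    (f : (Sm (n + 2) U)⟦X⟧) :
    f ∈ algB Ω K ↔ ∀ k, p.leafDer hB (K.res (PowerSeries.coeff k f)) = 0 := by
  have hs := fun c => symplecticAt_formOn hΩ U (K.ι c)
  constructor
  · intro h k
    refine Sm.ext fun c => ?_
    have h1 := h (PowerSeries.C K.JC) (by
      change PowerSeries.map _ _ = 0
      rw [PowerSeries.map_C]
      exact (congrArg PowerSeries.C K.res_JC).trans (map_zero _)) k c
    rw [poissonSeries, Finset.sum_eq_single (k, 0)] at h1
    · rw [p.leafDer_apply hΩ hB, ← K.poisson_JC hΩ p]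
      rw [PowerSeries.coeff_zero_C] at h1
      exact h1
    · rintro ⟨i, j⟩ hij hne
      have hj : j ≠ 0 := by
        rintro rfl
        rw [Finset.HasAntidiagonal.mem_antidiagonal] at hij
        simp_all
      rw [PowerSeries.coeff_C, if_neg hj, poisson_eq (hs c)]
      have h0 : ∀ v, Sm.d (0 : Sm (n + 2) U) (K.ι c) v = 0 := fun v => by
        rw [← map_zero (algebraMap ℂ (Sm (n + 2) U)), Sm.d_algebraMap]
        rfl
      rw [h0, h0]
      simp
    · simp
  · intro h f' hf' k c
    refine Finset.sum_eq_zero fun i _ => ?_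
    have h1 : K.res (PowerSeries.coeff i.2 f') = 0 := by
      have := congrArg (PowerSeries.coeff i.2) hf'
      simpa using this
    obtain ⟨g, hg⟩ := K.exists_eq_mul _ h1
    have h2 : poisson (formOn Ω U) (PowerSeries.coeff i.1 f).1 (g * K.JC).1 (K.ι c)
        = g.1 (K.ι c) * poisson (formOn Ω U) (PowerSeries.coeff i.1 f).1 K.JC.1 (K.ι c) := by
      rw [poisson_eq (hs c), poisson_eq (hs c), Sm.d_mul, Sm.d_mul]
      have h3 : K.JC.1 (K.ι c) = 0 := congrArg Complex.ofReal (K.J_ι c)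
      rw [h3]
      ring
    rw [hg, h2, K.poisson_JC hΩ p, ← p.leafDer_apply hΩ hB, h i.1]
    exact mul_zero _

theorem BF_eq (hΩ : Ω.IsSymplectic) (hB : IsStarProduct (formOn Ω U) B) :
    p.BF Ω = (p.formalReduction σ hΩ hB).BF := by
  ext f
  rw [BF, Set.inter_comm, Set.mem_inter_iff, p.mem_algB_iff hΩ hB]
  rfl

/-- By `Slift_redM`, `S` maps the lift of the product to `prol (T (S f * S g))`; the inverse of `S`
on `B ∩ F` therefore returns that lift. -/
theorem lift_star_redM (hΩ : Ω.IsSymplectic) (hB : IsStarProduct (formOn Ω U) B)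
    (u v : (Sm n Q)⟦X⟧) :
    p.lift R (bser (p.formalReduction σ hΩ hB).redM u v)
      = p.reducedStar B σ (p.lift R u) (p.lift R v) := by
  rw [reducedStar, p.preStar_eq σ hΩ hB]
  have h1 : ser (p.formalReduction σ hΩ hB).S (p.lift R (bser (p.formalReduction σ hΩ hB).redM u v))
      = (p.formalReduction σ hΩ hB).prodS (ser (p.formalReduction σ hΩ hB).S (p.lift R u))
        (ser (p.formalReduction σ hΩ hB).S (p.lift R v)) := by
    have := (p.formalReduction σ hΩ hB).Slift_redM u v
    rwa [FormalReduction.ser_Slift, FormalReduction.ser_Slift, FormalReduction.ser_Slift] at this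
  rw [← h1]
  have h2 := (p.formalReduction σ hΩ hB).bijOn_S.injOn.leftInvOn_invFunOn
  rw [← p.BF_eq σ hΩ hB] at h2
  exact (h2 (by
    rw [p.BF_eq σ hΩ hB]
    exact (p.formalReduction σ hΩ hB).lift_mem _)).symm

theorem redM_first (hΩ : Ω.IsSymplectic) (hB : IsStarProduct (formOn Ω U) B) (u v : Sm n Q)
    (q : Q) : ((p.formalReduction σ hΩ hB).redM 1 u v).1 q
      - ((p.formalReduction σ hΩ hB).redM 1 v u).1 q = Complex.I * poisson R.form u.1 v.1 q := by
  have h1 := congrArg (fun w : Sm n Q => w.1 q) ((p.formalReduction σ hΩ hB).redM_one_sub u v)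
  refine h1.trans ((hB.first (p.p (Sm.pullback R.π R.π_smooth u))
    (p.p (Sm.pullback R.π R.π_smooth v)) (K.ι (σ.s q))).trans ?_)
  rw [K.poisson_lift hΩ p R (σ.s q) _ _ u v (p.res_p _) (p.res_p _), σ.π_s]

end Prolongation

end StarReduction

/-! ### Local and differential operators over the functions on the leaf space -/

namespace StarReduction

section DifferentialOperators

variable {A X Y Z : Type*} [CommRing A] [Algebra ℂ A] [CommRing X] [Algebra ℂ X]
  [CommRing Y] [Algebra ℂ Y] [CommRing Z] [Algebra ℂ Z]
  (φ : A →ₐ[ℂ] X) (ψ : A →ₐ[ℂ] Y) (χ : A →ₐ[ℂ] Z)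

/-- The commutator of a linear map with the actions of an element. -/
def comm (D : X →ₗ[ℂ] Y) (f : A) : X →ₗ[ℂ] Y :=
  D ∘ₗ LinearMap.mulLeft ℂ (φ f) - LinearMap.mulLeft ℂ (ψ f) ∘ₗ D

theorem comm_apply (D : X →ₗ[ℂ] Y) (f : A) (x : X) :
    comm φ ψ D f x = D (φ f * x) - ψ f * D x := rfl

/-- Algebraic differential operators of order less than `r`. -/
def DiffOrderLT : ℕ → (X →ₗ[ℂ] Y) → Prop
  | 0, D => D = 0
  | r + 1, D => ∀ f, DiffOrderLT r (comm φ ψ D f)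

variable {φ ψ χ}

namespace DiffOrderLT

theorem zero (r : ℕ) : DiffOrderLT φ ψ r 0 := by
  induction r with
  | zero => rfl
  | succ r ih =>
    intro f
    have : comm φ ψ 0 f = 0 := by
      ext x
      simp [comm_apply]
    rwa [this]

theorem succ {r : ℕ} {D : X →ₗ[ℂ] Y} (h : DiffOrderLT φ ψ r D) : DiffOrderLT φ ψ (r + 1) D := by
  induction r generalizing D with
  | zero =>
    rw [show D = 0 from h]
    exact zero 1
  | succ r ih => exact fun f => ih (h f)

theorem mono {r s : ℕ} (hrs : r ≤ s) {D : X →ₗ[ℂ] Y} (h : DiffOrderLT φ ψ r D) :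
    DiffOrderLT φ ψ s D := by
  induction s, hrs using Nat.le_induction with
  | base => exact h
  | succ s _ ih => exact ih.succ

theorem add {r : ℕ} {D D' : X →ₗ[ℂ] Y} (h : DiffOrderLT φ ψ r D) (h' : DiffOrderLT φ ψ r D') :
    DiffOrderLT φ ψ r (D + D') := by
  induction r generalizing D D' with
  | zero => rw [show D = 0 from h, show D' = 0 from h', add_zero]; exact zero 0
  | succ r ih =>
    intro f
    have : comm φ ψ (D + D') f = comm φ ψ D f + comm φ ψ D' f := by
      ext x
      simp only [comm_apply, LinearMap.add_apply]
      ring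
    rw [this]
    exact ih (h f) (h' f)

theorem neg {r : ℕ} {D : X →ₗ[ℂ] Y} (h : DiffOrderLT φ ψ r D) : DiffOrderLT φ ψ r (-D) := by
  induction r generalizing D with
  | zero => rw [show D = 0 from h, neg_zero]; exact zero 0
  | succ r ih =>
    intro f
    have : comm φ ψ (-D) f = -comm φ ψ D f := by
      ext x
      simp only [comm_apply, LinearMap.neg_apply]
      ring
    rw [this]
    exact ih (h f)

/-- The commutator with `f` obeys the Leibniz rule `[F D, f] = F [D, f] + [F, f] D`, so induction on
the sum of the bounds applies. -/
theorem comp {r s : ℕ} {D : X →ₗ[ℂ] Y} {F : Y →ₗ[ℂ] Z} (hF : DiffOrderLT ψ χ s F)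
    (hD : DiffOrderLT φ ψ r D) : DiffOrderLT φ χ (s + r) (F ∘ₗ D) := by
  generalize hm : s + r = m
  induction m generalizing r s D F with
  | zero =>
    obtain ⟨rfl, rfl⟩ := Nat.add_eq_zero_iff.1 hm
    rw [show D = 0 from hD, LinearMap.comp_zero]
    exact zero 0
  | succ m ih =>
    rcases s with _ | s
    · rw [show F = 0 from hF, LinearMap.zero_comp]
      exact zero _
    · rcases r with _ | r
      · rw [show D = 0 from hD, LinearMap.comp_zero]
        exact zero _
      · intro f
        have : comm φ χ (F ∘ₗ D) f = F ∘ₗ comm φ ψ D f + comm ψ χ F f ∘ₗ D := by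
          ext x
          simp only [comm_apply, LinearMap.add_apply, LinearMap.comp_apply, map_sub]
          ring
        rw [this]
        exact (ih hF (hD f) (by omega)).add (ih (hF f) hD (by omega))

theorem of_linear {D : X →ₗ[ℂ] Y} (h : ∀ f x, D (φ f * x) = ψ f * D x) : DiffOrderLT φ ψ 1 D :=
  fun f => LinearMap.ext fun x => by
    rw [comm_apply, h, sub_self]
    rfl

theorem restrict {r : ℕ} {D : X →ₗ[ℂ] X} (h : DiffOrderLT (AlgHom.id ℂ X) (AlgHom.id ℂ X) r D) :
    DiffOrderLT φ φ r D := by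
  induction r generalizing D with
  | zero => exact h
  | succ r ih => exact fun f => ih (h (φ f))

end DiffOrderLT

variable (φ ψ)

/-- Families of local operators; if `b` holds they are required to be differential operators of
uniformly bounded order. -/
def LocalFamily (b : Prop) {ι : Type*} (D : ι → X →ₗ[ℂ] Y) : Prop :=
  (∀ i f x, φ f * x = 0 → ψ f * D i x = 0) ∧ (b → ∃ r, ∀ i, DiffOrderLT φ ψ r (D i))

variable {φ ψ} {b : Prop} {ι κ : Type*}

namespace LocalFamily

theorem reindex {D : ι → X →ₗ[ℂ] Y} (h : LocalFamily φ ψ b D) (e : κ → ι) :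
    LocalFamily φ ψ b fun k => D (e k) :=
  ⟨fun k => h.1 (e k), fun hb => (h.2 hb).imp fun _ hr k => hr (e k)⟩

theorem zero : LocalFamily φ ψ b fun _ : ι => (0 : X →ₗ[ℂ] Y) :=
  ⟨fun _ _ _ _ => by rw [LinearMap.zero_apply, mul_zero], fun _ => ⟨0, fun _ => rfl⟩⟩

theorem add {D D' : ι → X →ₗ[ℂ] Y} (h : LocalFamily φ ψ b D) (h' : LocalFamily φ ψ b D') :
    LocalFamily φ ψ b fun i => D i + D' i := by
  refine ⟨fun i f x hx => ?_, fun hb => ?_⟩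
  · rw [LinearMap.add_apply, mul_add, h.1 i f x hx, h'.1 i f x hx, add_zero]
  · obtain ⟨r, hr⟩ := h.2 hb
    obtain ⟨s, hs⟩ := h'.2 hb
    exact ⟨max r s, fun i => ((hr i).mono (le_max_left _ _)).add ((hs i).mono (le_max_right _ _))⟩

theorem neg {D : ι → X →ₗ[ℂ] Y} (h : LocalFamily φ ψ b D) : LocalFamily φ ψ b fun i => -D i :=
  ⟨fun i f x hx => by rw [LinearMap.neg_apply, mul_neg, h.1 i f x hx, neg_zero],
    fun hb => (h.2 hb).imp fun _ hr i => (hr i).neg⟩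

theorem sum {α : Type*} {s : Finset α} {D : α → ι → X →ₗ[ℂ] Y}
    (h : ∀ a ∈ s, LocalFamily φ ψ b (D a)) : LocalFamily φ ψ b fun i => ∑ a ∈ s, D a i := by
  classical
  induction s using Finset.induction_on with
  | empty => simpa using zero
  | insert a s ha ih =>
    simp only [Finset.sum_insert ha]
    exact (h a (Finset.mem_insert_self a s)).add
      (ih fun i hi => h i (Finset.mem_insert_of_mem hi))

theorem comp {D : ι → X →ₗ[ℂ] Y} {F : ι → Y →ₗ[ℂ] Z} (hF : LocalFamily ψ χ b F)
    (hD : LocalFamily φ ψ b D) : LocalFamily φ χ b fun i => F i ∘ₗ D i := by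
  refine ⟨fun i f x hx => hF.1 i f _ (hD.1 i f x hx), fun hb => ?_⟩
  obtain ⟨r, hr⟩ := hD.2 hb
  obtain ⟨s, hs⟩ := hF.2 hb
  exact ⟨s + r, fun i => (hs i).comp (hr i)⟩

theorem of_linear (D : X →ₗ[ℂ] Y) (h : ∀ f x, D (φ f * x) = ψ f * D x) :
    LocalFamily φ ψ b fun _ : ι => D :=
  ⟨fun _ f x hx => by rw [← h, hx, map_zero], fun _ => ⟨1, fun _ => DiffOrderLT.of_linear h⟩⟩

end LocalFamily

end DifferentialOperators

namespace FormalReduction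

variable {A B D : Type*} [CommRing A] [Algebra ℂ A] [CommRing B] [Algebra ℂ B]
  [CommRing D] [Algebra ℂ D] (d : FormalReduction A B D)

/-- The action of functions on the leaf space on the functions on the ambient space. -/
def pull : D →ₐ[ℂ] A := d.p.comp d.π

variable {b : Prop} {ι : Type*}

/-- Since `p` and `res` are multiplicative, both sides have the same product with `J`, which is not
a zero divisor. -/
theorem comp_p_mul (u : B) (f : A) : d.comp (d.p u * f) = d.p u * d.comp f := by
  rw [← sub_eq_zero]
  apply d.regular
  rw [sub_mul, mul_assoc, ← d.comp_spec, ← d.comp_spec, map_mul, d.res_p, map_mul]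
  ring

variable {d}

theorem localFamily_T (hM : ∀ k, LocalFamily d.pull d.pull b (fun g => d.M k g) ∧
    LocalFamily d.pull d.pull b (fun g => (d.M k).flip g)) (k : ℕ) :
    LocalFamily d.pull d.pull b fun _ : ι => d.T k := by
  induction k using Nat.strong_induction_on with
  | _ k ih =>
    rcases k with _ | k
    · rw [FormalConstraint.T]
      exact LocalFamily.of_linear _ fun _ _ => rfl
    · rw [FormalConstraint.T]
      have h : LocalFamily d.pull d.pull b fun _ : ι => ∑ j : Fin (k + 1),
          d.T (k - j) ∘ₗ (d.M (j + 1)).flip d.J ∘ₗ d.comp :=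
        LocalFamily.sum (D := fun (j : Fin (k + 1)) (_ : ι) =>
          d.T (k - j) ∘ₗ (d.M (j + 1)).flip d.J ∘ₗ d.comp) fun j _ =>
          LocalFamily.comp (ih (k - j) (by omega)) (LocalFamily.comp
            (LocalFamily.reindex (hM (j + 1)).2 fun _ => d.J)
            (LocalFamily.of_linear _ fun _ _ => d.comp_p_mul _ _))
      exact h.neg

theorem localFamily_commJ (hM : ∀ k, LocalFamily d.pull d.pull b (fun g => d.M k g) ∧
    LocalFamily d.pull d.pull b (fun g => (d.M k).flip g)) (k : ℕ) :
    LocalFamily d.pull d.pull b fun _ : ι => d.commJ k := by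
  simp only [FormalConstraint.commJ, sub_eq_add_neg]
  exact ((hM k).1.reindex fun _ => d.J).add ((hM k).2.reindex fun _ => d.J).neg

/-- Prolongation, restriction and leaf integration are all linear over functions on the leaf space,
hence of order zero there; the remaining ingredients are `T`, `commJ` and earlier `S`. -/
theorem localFamily_S (hM : ∀ k, LocalFamily d.pull d.pull b (fun g => d.M k g) ∧
    LocalFamily d.pull d.pull b (fun g => (d.M k).flip g))
    (hL : ∀ v w, d.L (d.π v * w) = d.π v * d.L w) (k : ℕ) :
    LocalFamily d.pull d.pull b fun _ : ι => d.S k := by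
  induction k using Nat.strong_induction_on with
  | _ k ih =>
    rcases k with _ | k
    · rw [d.S_zero]
      exact LocalFamily.of_linear _ fun _ _ => rfl
    · have h : d.S (k + 1) = d.p.toLinearMap ∘ₗ d.L ∘ₗ d.res.toLinearMap ∘ₗ
          (∑ j ∈ Finset.Icc 2 (k + 2), d.commJ j ∘ₗ d.S (k + 2 - j)
            + ∑ i ∈ Finset.Icc 1 (k + 2 - 1), ∑ j ∈ Finset.Icc 1 (k + 2 - i),
              d.T i ∘ₗ d.commJ j ∘ₗ d.S (k + 2 - j - i)) := by
        ext f
        simp [d.S_succ, FormalConstraint.Fop]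
      rw [h]
      refine LocalFamily.comp (ψ := d.π) (LocalFamily.of_linear _ fun _ _ => map_mul d.p _ _) ?_
      refine LocalFamily.comp (ψ := d.π) (LocalFamily.of_linear _ hL) ?_
      refine LocalFamily.comp (ψ := d.pull) (LocalFamily.of_linear _ fun f x => ?_) ?_
      · change d.res (d.p (d.π f) * x) = d.π f * d.res x
        rw [map_mul, d.res_p]
      · refine (LocalFamily.sum fun j hj => ?_).add
          (LocalFamily.sum fun i hi => LocalFamily.sum fun j hj => ?_)
        · rw [Finset.mem_Icc] at hj
          exact (localFamily_commJ hM j).comp (ih _ (by omega))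
        · rw [Finset.mem_Icc] at hi hj
          exact (localFamily_T hM i).comp ((localFamily_commJ hM j).comp (ih _ (by omega)))

theorem localFamily_Slift (hM : ∀ k, LocalFamily d.pull d.pull b (fun g => d.M k g) ∧
    LocalFamily d.pull d.pull b (fun g => (d.M k).flip g))
    (hL : ∀ v w, d.L (d.π v * w) = d.π v * d.L w) (k : ℕ) :
    LocalFamily (AlgHom.id ℂ D) d.pull b fun _ : ι => d.Slift k :=
  (localFamily_S hM hL k).comp (LocalFamily.of_linear _ fun _ _ => map_mul d.pull _ _)

theorem localFamily_eval (hM : ∀ k, LocalFamily d.pull d.pull b (fun g => d.M k g) ∧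
    LocalFamily d.pull d.pull b (fun g => (d.M k).flip g)) (k : ℕ) :
    LocalFamily d.pull (AlgHom.id ℂ D) b
      fun _ : ι => d.s.toLinearMap ∘ₗ d.res.toLinearMap ∘ₗ d.T k := by
  refine LocalFamily.comp (ψ := d.π) (LocalFamily.of_linear _ fun f x => ?_)
    (LocalFamily.comp (ψ := d.pull) (LocalFamily.of_linear _ fun f x => ?_) (localFamily_T hM k))
  · change d.s (d.π f * x) = f * d.s x
    rw [map_mul, d.s_π]
  · change d.res (d.p (d.π f) * x) = d.π f * d.res x
    rw [map_mul, d.res_p]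

/-- The operators of the reduced star product are local, and differential operators if those of the
original one are. -/
theorem localFamily_redM (hM : ∀ k, LocalFamily d.pull d.pull b (fun g => d.M k g) ∧
    LocalFamily d.pull d.pull b (fun g => (d.M k).flip g))
    (hL : ∀ v w, d.L (d.π v * w) = d.π v * d.L w) (k : ℕ) :
    LocalFamily (AlgHom.id ℂ D) (AlgHom.id ℂ D) b (fun v => d.redM k v) ∧
    LocalFamily (AlgHom.id ℂ D) (AlgHom.id ℂ D) b (fun v => (d.redM k).flip v) := by
  constructor
  -- With `v` fixed this is a sum of compositions in the other argument. `v` enters only as the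
  -- index of the family given by `M`, so the bounds on the order are uniform in `v`.
  · have h : (fun v => d.redM k v) = fun v => ∑ i ∈ Finset.HasAntidiagonal.antidiagonal k,
        ∑ j ∈ Finset.HasAntidiagonal.antidiagonal i.2,
          ∑ l ∈ Finset.HasAntidiagonal.antidiagonal j.1,
          (d.s.toLinearMap ∘ₗ d.res.toLinearMap ∘ₗ d.T i.1) ∘ₗ
            (d.M l.1 (d.Slift l.2 v)) ∘ₗ d.Slift j.2 := by
      ext v w
      simp [redM, serCompB, serCompR, serCompL]
    rw [h]
    exact LocalFamily.sum fun i _ => LocalFamily.sum fun j _ => LocalFamily.sum fun l _ =>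
      (localFamily_eval hM _).comp (((hM l.1).1.reindex _).comp (localFamily_Slift hM hL _))
  · have h : (fun v => (d.redM k).flip v) = fun v => ∑ i ∈ Finset.HasAntidiagonal.antidiagonal k,
        ∑ j ∈ Finset.HasAntidiagonal.antidiagonal i.2,
          ∑ l ∈ Finset.HasAntidiagonal.antidiagonal j.1,
          (d.s.toLinearMap ∘ₗ d.res.toLinearMap ∘ₗ d.T i.1) ∘ₗ
            ((d.M l.1).flip (d.Slift j.2 v)) ∘ₗ d.Slift l.2 := by
      ext v w
      simp [redM, serCompB, serCompR, serCompL]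
    rw [h]
    exact LocalFamily.sum fun i _ => LocalFamily.sum fun j _ => LocalFamily.sum fun l _ =>
      (localFamily_eval hM _).comp (((hM l.1).2.reindex _).comp (localFamily_Slift hM hL _))

end FormalReduction

end StarReduction

/-! ### Differential order and vanishing at a point -/

namespace StarReduction

section Orders

variable {n : ℕ} {M : Type*} [TopologicalSpace M] [ChartedSpace (E n) M]

/-- At the point `x`, the commutator of `D` with `f` applied to `u` is `D` applied to `(f - f(x))
u`. Iterated commutators thus amount to factors vanishing at `x`. -/
theorem diffOrderLT_of_apply {r : ℕ} {D : Sm n M →ₗ[ℂ] Sm n M}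
    (h : ∀ x (l : List (Sm n M)), l.length = r → (∀ f ∈ l, f.1 x = 0) →
      ∀ u, (D (l.prod * u)).1 x = 0) :
    DiffOrderLT (AlgHom.id ℂ (Sm n M)) (AlgHom.id ℂ (Sm n M)) r D := by
  induction r generalizing D with
  | zero =>
    refine LinearMap.ext fun u => Sm.ext fun x => ?_
    have := h x [] rfl (by simp) u
    rwa [List.prod_nil, one_mul] at this
  | succ r ih =>
    intro f
    refine ih fun x l hl hlx u => ?_
    have h1 := h x ((f - algebraMap ℂ _ (f.1 x)) :: l) (by simp [hl]) (by
      intro g hg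
      rcases List.mem_cons.1 hg with rfl | hg
      · exact sub_self _
      · exact hlx g hg) u
    rw [List.prod_cons, mul_assoc, sub_mul, map_sub, ← Algebra.smul_def, map_smul] at h1
    exact h1

theorem DiffOrderLT.apply_eq_zero {r : ℕ} {D : Sm n M →ₗ[ℂ] Sm n M}
    (h : DiffOrderLT (AlgHom.id ℂ (Sm n M)) (AlgHom.id ℂ (Sm n M)) r D) {x : M}
    {l : List (Sm n M)} (hl : l.length = r) (hlx : ∀ f ∈ l, f.1 x = 0) (u : Sm n M) :
    (D (l.prod * u)).1 x = 0 := by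
  induction l generalizing r D with
  | nil =>
    subst hl
    rw [show D = 0 from h]
    rfl
  | cons f l ih =>
    subst hl
    have h1 := ih (h f) rfl fun g hg => hlx g (List.mem_cons_of_mem _ hg)
    have h2 : (D (f * (l.prod * u))).1 x - f.1 x * (D (l.prod * u)).1 x = 0 := h1
    rwa [hlx f List.mem_cons_self, zero_mul, sub_zero, ← mul_assoc, ← List.prod_cons] at h2

/-- By the Leibniz rule each derivative can remove at most one vanishing factor, so fewer
derivatives than factors give zero. -/
theorem iteratedFDeriv_prod_eq_zero [IsManifold (𝓡 n) ∞ M] (x₀ : M) {x : M}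
    (hx : x ∈ (chartAt (E n) x₀).source) (l : List (Sm n M)) (hl : ∀ f ∈ l, f.1 x = 0)
    (u : Sm n M) {a : ℕ} (ha : a < l.length) :
    iteratedFDeriv ℝ a (fun y => (l.prod * u).1 ((chartAt (E n) x₀).symm y))
      (chartAt (E n) x₀ x) = 0 := by
  induction l generalizing a with
  | nil => simp at ha
  | cons f l ih =>
    set χ := chartAt (E n) x₀
    have hy : χ x ∈ χ.target := χ.map_source hx
    have hb := norm_iteratedFDerivWithin_mul_le (N := ∞) (n := a)
      (contDiffOn_comp_chart_symm (Sm.contMDiff f) x₀)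
      (contDiffOn_comp_chart_symm (Sm.contMDiff (l.prod * u)) x₀) χ.open_target.uniqueDiffOn hy
      (by exact_mod_cast le_top)
    have h0 : ∑ i ∈ Finset.range (a + 1), (a.choose i : ℝ)
        * ‖iteratedFDerivWithin ℝ i (fun y => f.1 (χ.symm y)) χ.target (χ x)‖
        * ‖iteratedFDerivWithin ℝ (a - i) (fun y => (l.prod * u).1 (χ.symm y)) χ.target (χ x)‖ = 0 := by
      refine Finset.sum_eq_zero fun i hi => ?_
      rcases i with _ | i
      · rw [norm_iteratedFDerivWithin_zero, χ.left_inv hx, hl f List.mem_cons_self]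
        simp
      · rw [Finset.mem_range] at hi
        rw [List.length_cons] at ha
        rw [iteratedFDerivWithin_of_isOpen (a - (i + 1)) χ.open_target hy,
          ih (fun g hg => hl g (List.mem_cons_of_mem _ hg)) (by omega)]
        simp
    rw [h0, norm_le_zero_iff, iteratedFDerivWithin_of_isOpen a χ.open_target hy] at hb
    rw [List.prod_cons, mul_assoc]
    exact hb

end Orders

section Restriction

variable {n : ℕ} {P : Type*} [TopologicalSpace P] [ChartedSpace (E n) P]
  {Ω : TwoForm n P} {B : ℕ → Sm n P → Sm n P → Sm n P} {U : Opens P}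

theorem IsStarProduct.apply_mul_eq_zero (h : IsStarProduct Ω B) (k : ℕ) {x : P} {f g : Sm n P}
    (hfg : f * g = 0) (hx : f.1 x ≠ 0) (v : Sm n P) : (B k v g).1 x = 0 ∧ (B k g v).1 x = 0 := by
  have h1 : ∀ᶠ y in 𝓝 x, g.1 y = 0 := by
    filter_upwards [(Sm.continuous f).continuousAt.eventually_ne hx] with y hy
    have : f.1 y * g.1 y = 0 := congrArg (fun f : Sm n P => f.1 y) hfg
    exact (mul_eq_zero.1 this).resolve_left hy
  exact ⟨h.eq_zero_of_right k v h1, h.eq_zero_of_left k v h1⟩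

variable [T2Space P] [IsManifold (𝓡 n) ∞ P]

theorem exists_extension_list (x : U) (l : List (Sm n U)) (hl : ∀ f ∈ l, f.1 x = 0) :
    ∃ L : List (Sm n P), L.length = l.length ∧ (∀ F ∈ L, F.1 x = 0) ∧
      SameGerm x l.prod L.prod := by
  induction l with
  | nil => exact ⟨[], rfl, by simp, Filter.Eventually.of_forall fun y => rfl⟩
  | cons f l ih =>
    obtain ⟨L, h1, h2, h3⟩ := ih fun g hg => hl g (List.mem_cons_of_mem _ hg)
    obtain ⟨F, hF⟩ := Sm.exists_extension x f
    refine ⟨F :: L, by simp [h1], ?_, ?_⟩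
    · intro G hG
      rcases List.mem_cons.1 hG with rfl | hG
      · exact hF.self_of_nhds.trans (hl f List.mem_cons_self)
      · exact h2 G hG
    · rw [List.prod_cons, List.prod_cons]
      filter_upwards [hF, h3] with y hy hy'
      exact congrArg₂ (· * ·) hy hy'

/-- The coordinate formula sees at most `r` derivatives, which `r + 1` vanishing factors kill. The
bound depends neither on the point nor on the other argument. -/
theorem IsBidifferential.exists_order (hB : IsStarProduct Ω B) (k : ℕ)
    (h : IsBidifferential (B k)) : ∃ r, ∀ (x : U) (l : List (Sm n U)), l.length = r →
      (∀ f ∈ l, f.1 x = 0) → ∀ u v, (restrictOp (B k) U (l.prod * u) v).1 x = 0 ∧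
        (restrictOp (B k) U v (l.prod * u)).1 x = 0 := by
  obtain ⟨r, hr⟩ := h
  refine ⟨r + 1, fun x l hl hlx u v => ?_⟩
  obtain ⟨L, h1, h2, h3⟩ := exists_extension_list x l hlx
  obtain ⟨G, hG⟩ := Sm.exists_extension x u
  obtain ⟨F, hF⟩ := Sm.exists_extension x v
  have h4 : ∀ᶠ y : U in 𝓝 x, (L.prod * G).1 y = (l.prod * u).1 y := by
    filter_upwards [h3, hG] with y hy hy'
    exact congrArg₂ (· * ·) hy hy'
  obtain ⟨V, -, hxV, hVs, c, -, hc⟩ := hr x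
  have h5 : ∀ {a : ℕ} (α : Fin a → Fin n), a ∈ Finset.range (r + 1) →
      partialDeriv (x : P) α (L.prod * G).1 x = 0 := by
    intro a α ha
    rw [partialDeriv, iteratedFDeriv_prod_eq_zero (x : P) (hVs hxV) L h2 G (by
      rw [h1, hl]
      exact Finset.mem_range.1 ha)]
    rfl
  rw [isRestriction_restrictOp hB k _ _ x _ _ h4 hF, isRestriction_restrictOp hB k _ _ x _ _ hF h4,
    hc _ _ _ hxV, hc _ _ _ hxV]
  constructor
  · refine Finset.sum_eq_zero fun a ha => Finset.sum_eq_zero fun b _ => Finset.sum_eq_zero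
      fun α _ => Finset.sum_eq_zero fun β _ => ?_
    rw [h5 α ha, mul_zero, zero_mul]
  · refine Finset.sum_eq_zero fun a _ => Finset.sum_eq_zero fun b hb => Finset.sum_eq_zero
      fun α _ => Finset.sum_eq_zero fun β _ => ?_
    rw [h5 β hb, mul_zero]

end Restriction

end StarReduction

/-! ### Taylor expansion and recovery of coordinate expressions -/

namespace StarReduction

section Taylor

variable {n : ℕ}

open scoped Nat

theorem multilinear_apply_const_eq_sum {k : ℕ}
    (m : ContinuousMultilinearMap ℝ (fun _ : Fin k => E n) ℂ) (v : E n) :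
    m (fun _ => v) = ∑ α : Fin k → Fin n, (∏ j, (v (α j) : ℂ)) *
      m fun j => EuclideanSpace.single (α j) (1 : ℝ) := by
  have hv : v = ∑ i, v i • EuclideanSpace.single i (1 : ℝ) := by
    have := (EuclideanSpace.basisFun (Fin n) ℝ).sum_repr v
    simpa using this.symm
  have h1 : m (fun _ => v) = m (fun _ => ∑ i, v i • EuclideanSpace.single i (1 : ℝ)) := by
    rw [← hv]
  rw [h1, m.map_sum]
  refine Finset.sum_congr rfl fun α _ => ?_
  rw [m.map_smul_univ, Complex.real_smul]
  push_cast
  rfl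

/-- Taylor's formula with a smooth remainder, in terms of partial derivatives. -/
theorem exists_taylor_expansion {W : Set (E n)} {F : E n → ℂ} {y₀ : E n} {ε : ℝ}
    (hW : IsOpen W) (hball : Metric.ball y₀ ε ⊆ W) (hF : ContDiffOn ℝ ∞ F W) (r : ℕ) {y : E n}
    (hy : y ∈ Metric.ball y₀ ε) :
    ∃ (u : Set (E n)) (H : (Fin (r + 1) → Fin n) → E n → ℂ), IsOpen u ∧ y ∈ u ∧
      (∀ α, ContDiffOn ℝ ∞ (H α) u) ∧ ∀ z ∈ Metric.ball y₀ ε, F z =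
        ∑ a ∈ Finset.range (r + 1), ∑ α : Fin a → Fin n, (a ! : ℂ)⁻¹ *
          iteratedFDeriv ℝ a F y (fun j => EuclideanSpace.single (α j) (1 : ℝ)) *
            ∏ j, ((z (α j) : ℂ) - y (α j))
        + ∑ α : Fin (r + 1) → Fin n, (∏ j, ((z (α j) : ℂ) - y (α j))) * H α z := by
  classical
  let D : (Fin (r + 1) → Fin n) → E n → ℂ := fun α w =>
    iteratedFDeriv ℝ (r + 1) F w fun j => EuclideanSpace.single (α j) (1 : ℝ)
  have hD : ∀ α, ContDiffOn ℝ ∞ (D α) W := by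
    intro α w hw
    have h1 : ContDiffAt ℝ ∞ F w := (hF w hw).contDiffAt (hW.mem_nhds hw)
    have h2 : ContDiffAt ℝ ∞ (iteratedFDeriv ℝ (r + 1) F) w := h1.iteratedFDeriv_right (by
      exact_mod_cast le_top)
    exact ((ContinuousMultilinearMap.apply ℝ (fun _ : Fin (r + 1) => E n) ℂ
      (fun j => EuclideanSpace.single (α j) (1 : ℝ))).contDiff.contDiffAt.comp w h2).contDiffWithinAt
  let m : E n × ℝ → E n := fun x => y + x.2 • (x.1 - y)
  have hm : ContDiff ℝ ∞ m := contDiff_const.add (contDiff_snd.smul (contDiff_fst.sub contDiff_const))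
  let K : (Fin (r + 1) → Fin n) → E n × ℝ → ℂ := fun α x => ((1 - x.2) ^ r : ℝ) • D α (m x)
  have hK : ∀ α, ContDiffOn ℝ ∞ (K α) (m ⁻¹' W) := fun α =>
    ((contDiff_const.sub contDiff_snd).pow r).contDiffOn.smul
      ((hD α).comp hm.contDiffOn fun x hx => hx)
  have hmW : ∀ z ∈ Metric.ball y₀ ε, ∀ t ∈ Set.Icc (0 : ℝ) 1, (z, t) ∈ m ⁻¹' W := fun z hz t ht =>
    hball ((convex_ball y₀ ε).add_smul_sub_mem hy hz ht)
  -- The coefficients of the remainder are integrals over segments starting at `y`; they are smooth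
  -- only on some neighbourhood of `y`, while the expansion holds on the whole ball.
  have hint := fun α => contDiffOn_parametric_integral (hW.preimage hm.continuous)
    (hmW y hy) (hK α)
  choose u hu hyu huW hH using hint
  refine ⟨⋂ α, u α, fun α z => ((r ! : ℝ)⁻¹ : ℝ) • ∫ t in (0 : ℝ)..1, K α (z, t),
    isOpen_iInter_of_finite hu, Set.mem_iInter.2 hyu,
    fun α => ((hH α).mono (Set.iInter_subset u α)).const_smul _, fun z hz => ?_⟩
  have hT := map_add_eq_sum_add_integral_iteratedFDeriv (f := F) (x := y) (y := z - y) (n := r)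
    fun t ht => (((hF _ (hmW z hz t ht)).contDiffAt (hW.mem_nhds (hmW z hz t ht))).of_le
      (by exact_mod_cast le_top))
  rw [add_sub_cancel] at hT
  rw [hT]
  have hcoord : ∀ i, (((z - y) i : ℝ) : ℂ) = (z i : ℂ) - y i := fun i => by simp
  congr 1
  · refine Finset.sum_congr rfl fun a _ => ?_
    rw [multilinear_apply_const_eq_sum, Complex.real_smul, Finset.mul_sum]
    refine Finset.sum_congr rfl fun α _ => ?_
    simp only [hcoord]
    push_cast
    ring
  · have h1 : ∀ t : ℝ, ((1 - t) ^ r : ℝ) • iteratedFDeriv ℝ (r + 1) F (y + t • (z - y)) (fun _ => z - y)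
        = ∑ α : Fin (r + 1) → Fin n, (∏ j, ((z (α j) : ℂ) - y (α j))) * K α (z, t) := by
      intro t
      rw [multilinear_apply_const_eq_sum, Finset.smul_sum]
      refine Finset.sum_congr rfl fun α _ => ?_
      simp only [hcoord, K, D, m]
      rw [mul_smul_comm]
    simp only [h1]
    rw [intervalIntegral.integral_finsetSum]
    · rw [Finset.smul_sum]
      refine Finset.sum_congr rfl fun α _ => ?_
      rw [intervalIntegral.integral_const_mul, mul_smul_comm]
    · intro α _
      refine ContinuousOn.intervalIntegrable ?_
      refine continuousOn_const.mul ((hK α).continuousOn.comp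
        (Continuous.continuousOn (by fun_prop)) fun t ht => ?_)
      rw [Set.uIcc_of_le zero_le_one] at ht
      exact hmW z hz t ht

variable {M : Type*} [TopologicalSpace M] [ChartedSpace (E n) M]

/-- The functions in a list, with their values at a point subtracted. -/
def shift (x : M) (l : List (Sm n M)) : List (Sm n M) := l.map fun f => f - algebraMap ℂ _ (f.1 x)

theorem shift_apply_self (x : M) (l : List (Sm n M)) : ∀ f ∈ shift x l, f.1 x = 0 := by
  intro f hf
  obtain ⟨g, -, rfl⟩ := List.mem_map.1 hf
  exact sub_self _

theorem shift_prod_apply (x : M) {a : ℕ} (f : Fin a → Sm n M) (y : M) :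
    (shift x (List.ofFn f)).prod.1 y = ∏ j, ((f j).1 y - (f j).1 x) := by
  rw [shift, List.map_ofFn, List.prod_ofFn]
  simp

/-- The evaluation at a point. -/
def Sm.eval (x : M) : Sm n M →ₗ[ℂ] ℂ := ⟨⟨fun f => f.1 x, fun _ _ => rfl⟩, fun _ _ => rfl⟩

/-- The arguments depend on `x`, but only through the scalars `f(x)`. Pulling these out by
linearity, one factor at a time, leaves a polynomial in smooth functions. -/
theorem exists_coefficient (β : Sm n M →ₗ[ℂ] Sm n M →ₗ[ℂ] Sm n M) (l l' : List (Sm n M)) :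
    ∃ G : Sm n M, ∀ x, G.1 x = (β (shift x l).prod (shift x l').prod).1 x := by
  have step : ∀ (D : Sm n M →ₗ[ℂ] Sm n M) (f : Sm n M) (g : Sm n M) (x : M),
      (D ((f - algebraMap ℂ _ (f.1 x)) * g)).1 x = (D (f * g)).1 x - f.1 x * (D g).1 x := by
    intro D f g x
    rw [sub_mul, map_sub, ← Algebra.smul_def, map_smul]
    rfl
  have h1 : ∀ D : Sm n M →ₗ[ℂ] Sm n M, ∃ G : Sm n M, ∀ x, G.1 x = (D (shift x l').prod).1 x := by
    induction l' with
    | nil => exact fun D => ⟨D 1, fun x => rfl⟩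
    | cons f l' ih =>
      intro D
      obtain ⟨G₁, h₁⟩ := ih (D ∘ₗ LinearMap.mulLeft ℂ f)
      obtain ⟨G₂, h₂⟩ := ih D
      refine ⟨G₁ - f * G₂, fun x => ?_⟩
      have := step D f (shift x l').prod x
      rw [shift, List.map_cons, List.prod_cons]
      refine Eq.trans ?_ this.symm
      change G₁.1 x - f.1 x * G₂.1 x = _
      rw [h₁, h₂]
      rfl
  induction l generalizing β with
  | nil => exact h1 (β 1)
  | cons f l ih =>
    obtain ⟨G₁, h₁⟩ := ih (β ∘ₗ LinearMap.mulLeft ℂ f)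
    obtain ⟨G₂, h₂⟩ := ih β
    refine ⟨G₁ - f * G₂, fun x => ?_⟩
    have := step (β.flip (shift x l').prod) f (shift x l).prod x
    rw [shift, List.map_cons, List.prod_cons]
    refine Eq.trans ?_ this.symm
    change G₁.1 x - f.1 x * G₂.1 x = _
    rw [h₁, h₂]
    rfl

variable [T2Space M] [IsManifold (𝓡 n) ∞ M]

/-- Local functionals of finite order are determined by the partial derivatives. -/
theorem exists_taylor_functional (x₀ : M) : ∃ (V : Set M) (Ξ : Fin n → Sm n M), IsOpen V ∧ x₀ ∈ V ∧
    V ⊆ (chartAt (E n) x₀).source ∧ ∀ (r : ℕ), ∀ x ∈ V, ∀ D : Sm n M →ₗ[ℂ] ℂ,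
      (∀ f : Sm n M, (∀ᶠ y in 𝓝 x, f.1 y = 0) → D f = 0) →
      (∀ l : List (Sm n M), l.length = r + 1 → (∀ f ∈ l, f.1 x = 0) → ∀ h, D (l.prod * h) = 0) →
      ∀ u, D u = ∑ a ∈ Finset.range (r + 1), ∑ α : Fin a → Fin n,
        (a ! : ℂ)⁻¹ * partialDeriv x₀ α u.1 x * D (shift x (List.ofFn fun j => Ξ (α j))).prod := by
  set χ := chartAt (E n) x₀
  have hx₀ : x₀ ∈ χ.source := mem_chart_source _ x₀
  choose Ξ hΞ using fun i : Fin n => Sm.exists_coord x₀ x₀ hx₀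
    (Complex.ofRealCLM.comp (EuclideanSpace.proj i))
  obtain ⟨V₀, hV₀, hV₀o, hx₀V₀⟩ := eventually_nhds_iff.1 (Filter.eventually_all.2 hΞ)
  have hO : IsOpen (χ.target ∩ χ.symm ⁻¹' V₀) := χ.isOpen_inter_preimage_symm hV₀o
  obtain ⟨ε, hε, hball⟩ := Metric.isOpen_iff.1 hO (χ x₀) ⟨χ.map_source hx₀, by
    change χ.symm (χ x₀) ∈ V₀
    rwa [χ.left_inv hx₀]⟩
  have hVo : IsOpen (χ.source ∩ χ ⁻¹' Metric.ball (χ x₀) ε) :=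
    χ.isOpen_inter_preimage Metric.isOpen_ball
  refine ⟨χ.source ∩ χ ⁻¹' Metric.ball (χ x₀) ε, Ξ, hVo, ⟨hx₀, Metric.mem_ball_self hε⟩,
    Set.inter_subset_left, ?_⟩
  rintro r x ⟨hxs, hxb⟩ D hloc hord u
  have hcoord : ∀ z ∈ χ.source ∩ χ ⁻¹' Metric.ball (χ x₀) ε, ∀ i, (Ξ i).1 z = ((χ z i : ℝ) : ℂ) := by
    rintro z ⟨hz, hzb⟩ i
    have := (hball hzb).2
    rw [Set.mem_preimage, χ.left_inv hz] at this
    exact hV₀ z this i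
  obtain ⟨w, H, hw, hxw, hH, hexp⟩ := exists_taylor_expansion χ.open_target
    (fun z hz => (hball hz).1) (contDiffOn_comp_chart_symm (Sm.contMDiff u) x₀) r hxb
  choose h hh using fun α => Sm.exists_germ_of_open x (χ.isOpen_inter_preimage hw) ⟨hxs, hxw⟩ _
    (contMDiffOn_comp_chart (hH α) x₀)
  -- Near `x`, `u` is the Taylor polynomial `T` plus the remainder `R`. The functional kills `R`,
  -- whose terms have `r + 1` factors vanishing at `x`, and it sees only the germ of `u`.
  let T : Sm n M := ∑ a ∈ Finset.range (r + 1), ∑ α : Fin a → Fin n,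
    ((a ! : ℂ)⁻¹ * partialDeriv x₀ α u.1 x) • (shift x (List.ofFn fun j => Ξ (α j))).prod
  let R : Sm n M := ∑ α : Fin (r + 1) → Fin n, (shift x (List.ofFn fun j => Ξ (α j))).prod * h α
  have hR : D R = 0 := by
    rw [map_sum]
    exact Finset.sum_eq_zero fun α _ => hord _ (by simp [shift]) (shift_apply_self _ _) _
  have hu : D (u - (T + R)) = 0 := by
    apply hloc
    filter_upwards [hVo.mem_nhds ⟨hxs, hxb⟩, Filter.eventually_all.2 hh] with z hz hz'
    have h1 : u.1 z = Sm.eval z (T + R) := by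
      have h2 := hexp (χ z) hz.2
      rw [χ.left_inv hz.1] at h2
      rw [h2, map_add, map_sum, map_sum]
      congr 1
      · refine Finset.sum_congr rfl fun a _ => ?_
        rw [map_sum]
        refine Finset.sum_congr rfl fun α _ => ?_
        rw [map_smul]
        change _ = _ * (shift x (List.ofFn fun j => Ξ (α j))).prod.1 z
        rw [shift_prod_apply]
        simp only [hcoord z hz, hcoord x ⟨hxs, hxb⟩]
        rfl
      · refine Finset.sum_congr rfl fun α _ => ?_
        change _ = (shift x (List.ofFn fun j => Ξ (α j))).prod.1 z * (h α).1 z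
        rw [shift_prod_apply, hz' α]
        simp only [hcoord z hz, hcoord x ⟨hxs, hxb⟩]
        rfl
    exact sub_eq_zero.2 h1
  rw [map_sub, map_add, hR, add_zero, sub_eq_zero] at hu
  rw [hu, map_sum]
  refine Finset.sum_congr rfl fun a _ => ?_
  rw [map_sum]
  exact Finset.sum_congr rfl fun α _ => map_smul D _ _

/-- Local bilinear operators that are of finite order in each argument are bidifferential
operators. -/
theorem isBidifferential_of_order (β : Sm n M →ₗ[ℂ] Sm n M →ₗ[ℂ] Sm n M) (r : ℕ)
    (hloc : ∀ (x : M) (f g : Sm n M), (∀ᶠ y in 𝓝 x, f.1 y = 0) →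
      (β f g).1 x = 0 ∧ (β g f).1 x = 0)
    (hord : ∀ (x : M) (l : List (Sm n M)), l.length = r + 1 → (∀ f ∈ l, f.1 x = 0) → ∀ u v,
      (β (l.prod * u) v).1 x = 0 ∧ (β v (l.prod * u)).1 x = 0) :
    IsBidifferential fun u v => β u v := by
  refine ⟨r, fun x₀ => ?_⟩
  obtain ⟨V, Ξ, hV, hx₀, hVs, hT⟩ := exists_taylor_functional (n := n) x₀
  choose G hG using fun (a b : ℕ) (α : Fin a → Fin n) (γ : Fin b → Fin n) =>
    exists_coefficient β (List.ofFn fun j => Ξ (α j)) (List.ofFn fun j => Ξ (γ j))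
  refine ⟨V, hV, hx₀, hVs, fun a b α γ x => (a ! : ℂ)⁻¹ * (b ! : ℂ)⁻¹ * (G a b α γ).1 x, ?_, ?_⟩
  · intro a b α γ
    exact (Sm.contMDiff (((a ! : ℂ)⁻¹ * (b ! : ℂ)⁻¹) • G a b α γ)).contMDiffOn
  · intro f g x hx
    -- The expansion is applied to each argument in turn; what remains are the values of `β` on
    -- shifted coordinate monomials, which depend smoothly on `x`.
    have h1 := hT r x hx (Sm.eval x ∘ₗ β.flip g) (fun f hf => (hloc x f g hf).1)
      (fun l hl hlx u => (hord x l hl hlx u g).1) f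
    have h2 := fun u => hT r x hx (Sm.eval x ∘ₗ β u) (fun f hf => (hloc x f u hf).2)
      (fun l hl hlx v => (hord x l hl hlx v u).2) g
    refine h1.trans (Finset.sum_congr rfl fun a _ => ?_)
    rw [Finset.sum_comm]
    refine Finset.sum_congr rfl fun α _ => ?_
    have h3 := h2 (shift x (List.ofFn fun j => Ξ (α j))).prod
    change _ * (Sm.eval x ∘ₗ β (shift x (List.ofFn fun j => Ξ (α j))).prod) g = _
    rw [h3, Finset.mul_sum]
    refine Finset.sum_congr rfl fun b _ => ?_
    rw [Finset.mul_sum]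
    refine Finset.sum_congr rfl fun γ _ => ?_
    beta_reduce
    rw [hG]
    change _ * (_ * _ * (β _ _).1 x) = _
    ring

end Taylor

end StarReduction

/-! ### Locality and order of the reduced star product -/

namespace StarReduction

namespace Prolongation

variable {n : ℕ} {P : Type*} [TopologicalSpace P] [ChartedSpace (E (n + 2)) P] {U : Opens P}
  {C : Type*} [TopologicalSpace C] [ChartedSpace (E (n + 1)) C] {K : Constraint n U C}
  {Q : Type*} [TopologicalSpace Q] [ChartedSpace (E n) Q]
  [T2Space P] [IsManifold (𝓡 (n + 2)) ∞ P] [T2Space C] [IsManifold (𝓡 (n + 1)) ∞ C]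
  [IsManifold (𝓡 n) ∞ Q] {Ω : TwoForm (n + 2) P}
  (p : Prolongation K) {R : ReducedPhaseSpace Ω K Q} (σ : TransversalSection R)
  {M : ℕ → Sm (n + 2) P → Sm (n + 2) P → Sm (n + 2) P}

theorem localFamily_restrict (hΩ : Ω.IsSymplectic) (hM : IsStarProduct Ω M) (k : ℕ) :
    LocalFamily (p.formalReduction σ hΩ (hM.restrict hΩ U)).pull
      (p.formalReduction σ hΩ (hM.restrict hΩ U)).pull (∀ k, IsBidifferential (M k))
      (fun g => (p.formalReduction σ hΩ (hM.restrict hΩ U)).M k g) ∧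
    LocalFamily (p.formalReduction σ hΩ (hM.restrict hΩ U)).pull
      (p.formalReduction σ hΩ (hM.restrict hΩ U)).pull (∀ k, IsBidifferential (M k))
      (fun g => ((p.formalReduction σ hΩ (hM.restrict hΩ U)).M k).flip g) := by
  have hB := hM.restrict hΩ U
  have hloc : ∀ f g u : Sm (n + 2) U, f * u = 0 →
      f * hB.lin k g u = 0 ∧ f * hB.lin k u g = 0 := by
    intro f g u h
    constructor <;> refine Sm.ext fun x => ?_ <;> by_cases hx : f.1 x = 0
    · exact mul_eq_zero_of_left hx _
    · exact mul_eq_zero_of_right _ (hB.apply_mul_eq_zero k h hx g).1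
    · exact mul_eq_zero_of_left hx _
    · exact mul_eq_zero_of_right _ (hB.apply_mul_eq_zero k h hx g).2
  refine ⟨⟨fun g f u h => (hloc _ g u h).1, fun hb => ?_⟩,
    ⟨fun g f u h => (hloc _ g u h).2, fun hb => ?_⟩⟩
  · obtain ⟨r, hr⟩ := (hb k).exists_order (U := U) hM k
    exact ⟨r, fun g => (diffOrderLT_of_apply fun x l hl hlx u => (hr x l hl hlx u g).2).restrict⟩
  · obtain ⟨r, hr⟩ := (hb k).exists_order (U := U) hM k
    exact ⟨r, fun g => (diffOrderLT_of_apply fun x l hl hlx u => (hr x l hl hlx u g).1).restrict⟩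

theorem leafInt_mul (hΩ : Ω.IsSymplectic) (hX : K.SmoothLeaves Ω) (v : Sm n Q) (w : Sm (n + 1) C) :
    σ.leafIntL hΩ p hX (Sm.pullback R.π R.π_smooth v * w)
      = Sm.pullback R.π R.π_smooth v * σ.leafIntL hΩ p hX w := Sm.ext fun c =>
  σ.leafInt_congr hΩ p hX _ w (v.1 (R.π c)) c fun c' hc' => by
    rw [← hc']
    rfl

theorem localFamily_reduced (hΩ : Ω.IsSymplectic) (hM : IsStarProduct Ω M) (k : ℕ) :
    LocalFamily (AlgHom.id ℂ (Sm n Q)) (AlgHom.id ℂ (Sm n Q)) (∀ k, IsBidifferential (M k))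
      (fun v => (p.formalReduction σ hΩ (hM.restrict hΩ U)).redM k v) ∧
    LocalFamily (AlgHom.id ℂ (Sm n Q)) (AlgHom.id ℂ (Sm n Q)) (∀ k, IsBidifferential (M k))
      (fun v => ((p.formalReduction σ hΩ (hM.restrict hΩ U)).redM k).flip v) :=
  FormalReduction.localFamily_redM (fun k => p.localFamily_restrict σ hΩ hM k)
    (fun v w => p.leafInt_mul σ hΩ (K.smoothLeaves hΩ (hM.restrict hΩ U) p) v w) k

variable [T2Space Q]

/-- A bump function `χ` at `q`, supported where `f` vanishes, satisfies `χ f = 0`. Locality in the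
algebraic sense makes `χ` annihilate the result, and `χ` is one at `q`. -/
theorem redM_eq_zero (hΩ : Ω.IsSymplectic) (hM : IsStarProduct Ω M) (k : ℕ) (q : Q) (f g : Sm n Q)
    (hf : ∀ᶠ y in 𝓝 q, f.1 y = 0) :
    ((p.formalReduction σ hΩ (hM.restrict hΩ U)).redM k f g).1 q = 0 ∧
      ((p.formalReduction σ hΩ (hM.restrict hΩ U)).redM k g f).1 q = 0 := by
  obtain ⟨χ, h1, h2, -⟩ := Sm.exists_bump (n := n) q hf
  have h3 : χ * f = 0 := Sm.ext fun y => by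
    by_cases hy : f.1 y = 0
    · exact mul_eq_zero_of_right _ hy
    · exact mul_eq_zero_of_left (image_eq_zero_of_notMem_tsupport fun h => hy (h2 h)) _
  have key : ∀ u : Sm n Q, χ * u = 0 → u.1 q = 0 := by
    intro u hu
    have h4 : χ.1 q * u.1 q = 0 := congrArg (fun u : Sm n Q => u.1 q) hu
    rwa [h1.self_of_nhds, one_mul] at h4
  obtain ⟨h4, h5⟩ := p.localFamily_reduced σ hΩ hM k
  exact ⟨key _ (h5.1 g χ f h3), key _ (h4.1 g χ f h3)⟩

theorem isStarProduct_redM (hΩ : Ω.IsSymplectic) (hM : IsStarProduct Ω M) :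
    IsStarProduct R.form fun k u v => (p.formalReduction σ hΩ (hM.restrict hΩ U)).redM k u v where
  add_left k f f' g := by rw [map_add, LinearMap.add_apply]
  smul_left k a f g := by rw [map_smul, LinearMap.smul_apply]
  add_right k f g g' := map_add _ _ _
  smul_right k a f g := map_smul _ _ _
  assoc f g h := (p.formalReduction σ hΩ (hM.restrict hΩ U)).redM_assoc f g h
  zeroth f g := (p.formalReduction σ hΩ (hM.restrict hΩ U)).redM_zero f g
  first f g x := p.redM_first σ hΩ (hM.restrict hΩ U) f g x
  one_star f := (p.formalReduction σ hΩ (hM.restrict hΩ U)).one_redM f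
  star_one f := (p.formalReduction σ hΩ (hM.restrict hΩ U)).redM_one f
  supp k f g := Set.subset_inter
    (tsupport_subset_of_eventually fun q hq => (p.redM_eq_zero σ hΩ hM k q f g hq).1)
    (tsupport_subset_of_eventually fun q hq => (p.redM_eq_zero σ hΩ hM k q g f hq).2)

theorem isBidifferential_redM (hΩ : Ω.IsSymplectic) (hM : IsStarProduct Ω M)
    (hb : ∀ k, IsBidifferential (M k)) (k : ℕ) : IsBidifferential
      fun u v => (p.formalReduction σ hΩ (hM.restrict hΩ U)).redM k u v := by
  obtain ⟨h1, h2⟩ := p.localFamily_reduced σ hΩ hM k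
  obtain ⟨r, hr⟩ := h1.2 hb
  obtain ⟨s, hs⟩ := h2.2 hb
  refine isBidifferential_of_order _ (max r s) (p.redM_eq_zero σ hΩ hM k) ?_
  intro x l hl hlx u v
  -- The bound for the first argument comes from the flipped family. `succ` accounts for the `max r
  -- s + 1` factors of the list.
  exact ⟨((hs v).mono (le_max_right r s)).succ.apply_eq_zero hl hlx u,
    ((hr v).mono (le_max_left r s)).succ.apply_eq_zero hl hlx u⟩

end Prolongation

end StarReduction

end

/-! ### The reduction theorem -/

open StarReduction in
theorem mainTheorem1 {n : ℕ}
    {P : Type*} [TopologicalSpace P] [T2Space P] [SigmaCompactSpace P]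
    [ChartedSpace (E (n + 2)) P] [IsManifold (𝓡 (n + 2)) ∞ P]
    {C : Type*} [TopologicalSpace C] [T2Space C] [SigmaCompactSpace C]
    [ChartedSpace (E (n + 1)) C] [IsManifold (𝓡 (n + 1)) ∞ C]
    {Q : Type*} [TopologicalSpace Q] [T2Space Q] [SigmaCompactSpace Q]
    [ChartedSpace (E n) Q] [IsManifold (𝓡 n) ∞ Q]
    (Ω : TwoForm (n + 2) P) (hΩ : Ω.IsSymplectic)
    (M : ℕ → Sm (n + 2) P → Sm (n + 2) P → Sm (n + 2) P) (hM : IsStarProduct Ω M)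
    (U : TopologicalSpace.Opens P) (K : Constraint n U C) (p : Prolongation K)
    (R : ReducedPhaseSpace Ω K Q) (σ : TransversalSection R)
    (MU : ℕ → Sm (n + 2) U → Sm (n + 2) U → Sm (n + 2) U)
    (hMU : MU = fun k => restrictOp (M k) U) :
    (∀ k f g, IsRestriction (M k) U f g (MU k f g)) ∧
    (∀ f, ∃! h, f - p.prolFun f = h * K.JC) ∧
    (∀ k f, ContMDiff (𝓡 (n + 1)) 𝓘(ℝ, ℂ) ∞ (p.leafIntegral MU σ (p.S MU σ) (k + 1) f)) ∧
    Set.BijOn (act (p.S MU σ)) (p.BF Ω) (p.BStarF MU) ∧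
    (∀ f ∈ p.BF Ω, ∀ g ∈ p.BF Ω, p.preStar MU σ f g ∈ p.BStarF MU) ∧
    Set.BijOn (p.lift R) Set.univ (p.BF Ω) ∧
    ∃ M' : ℕ → Sm n Q → Sm n Q → Sm n Q,
      IsStarProduct R.form M' ∧
      (∀ u v, p.lift R (star M' u v) = p.reducedStar MU σ (p.lift R u) (p.lift R v)) ∧
      ((∀ k, IsBidifferential (M k)) → ∀ k, IsBidifferential (M' k)) := by
  subst hMU
  have hB := hM.restrict hΩ U
  refine ⟨fun k f g => isRestriction_restrictOp hM k f g, K.existsUnique_comp p,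
    fun k f => p.contMDiff_leafIntegral σ hΩ hB _ _ f, ?_, ?_, ?_, _,
    p.isStarProduct_redM σ hΩ hM, fun u v => p.lift_star_redM σ hΩ hB u v,
    p.isBidifferential_redM σ hΩ hM⟩
  · rw [p.BF_eq σ hΩ hB, p.BStarF_eq σ hΩ hB]
    exact (p.formalReduction σ hΩ hB).bijOn_S
  · intro f hf g hg
    rw [p.BF_eq σ hΩ hB] at hf hg
    rw [p.preStar_eq σ hΩ hB, p.BStarF_eq σ hΩ hB]
    exact (p.formalReduction σ hΩ hB).prodS_mem_NF ((p.formalReduction σ hΩ hB).S_mem hf)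
      ((p.formalReduction σ hΩ hB).S_mem hg)
  · rw [p.BF_eq σ hΩ hB]
    exact (p.formalReduction σ hΩ hB).bijOn_lift
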